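/- **Setting.** Let $\Omega\subset\mathbb R^d$ be compact and convex with nonempty interior, and let $\mathcal P(\Omega)$ be the set of probability densities $p\ge 0$, $p\in C^\infty(\Omega)$ (smooth up to the boundary), $\int_\Omega p\,dx=1$. For $p,q\in\mathcal P(\Omega)$ put $$\mathrm{Dist}_T(p,q)^2=\inf\Big\{\int_\Omega\|T(x)-x\|^2q(x)\,dx:\ T\colon\Omega\to\Omega \text{ a diffeomorphism with } T_\#q=p\Big\}$$ ($+\infty$ if there is no such $T$). A *transport coordinate* from $q$ to $p$ is a strictly convex $\Phi_p\in C^\infty(\Omega)$ with $(\nabla\Phi_p)_\#q=p$; $T=\nabla\Phi_p$ is then the optimal map ($q$-a.e. unique). We say that $q,p$ are *joined by a geodesic in* $\mathcal P(\Omega)$ if there is a transport coordinate $\Phi_p$ such that $T_t=t\nabla\Phi_p+(1-t)\,\mathrm{id}$ is a bijection of $\Omega$ for every $t\in[0,1]$. A functional $F\colon\mathcal P(\Omega)\to\mathbb R$ is *displacement convex* if $F((T_t)_\#q)\le tF(p)+(1-t)F(q)$ for all such $q,p,\Phi_p$ and all $t\in[0,1]$ with $(T_t)_\#q\in\mathcal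 P(\Omega)$, and *strictly* displacement convex if moreover the inequality is strict when $p\ne q$ and $0<t<1$. A *smooth curve* in $\mathcal P(\Omega)$ is a family $(p_t)_{0\le t\le\tau}$, $\tau>0$, with $(t,x)\mapsto p_t(x)$ smooth on $[0,\tau]\times\Omega$. The $L^2$ *first variation* $\frac{\delta}{\delta q}F(q)\in C^\infty(\Omega)$ is defined, up to an additive constant, by $\frac{d}{dt}\big|_{t=0}F(p_t)=\int_\Omega\frac{\delta}{\delta q(x)}F(q)\,\partial_tp_t(x)|_{t=0}\,dx$ for all smooth curves with $p_0=q$. Let $T_q\mathcal P(\Omega)=\{\sigma\in C^\infty(\Omega):\int_\Omega\sigma=0\}$. $F$ *has a second variation at $q$* if along every smooth curve from $q$ the first variations exist for small $t$ and can be chosen smooth in $(t,x)$, and there is a bilinear form $\delta^2F(q)$ on $T_q\mathcal P(\Omega)$, written $\delta^2F(q)(\sigma,\eta)=\iint\frac{\delta^2}{\delta q(x)\delta q(y)}F(q)\,\sigma(x)\eta(y)\,dx\,dy$ with a possibly distributional kernel, such that $\frac{d}{dt}\big|_{t=0}\int_\Omega\frac{\delta}{\delta q}F(p_t)\,\eta\,dx=\delta^2F(q)(\partial_tp_t|_{t=0},\eta)$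 for all such curves and all $\eta\in T_q\mathcal P(\Omega)$. For $\sigma=-\nabla\cdot(q\nabla\Phi)\in T_q\mathcal P(\Omega)$, $\Phi\in C^\infty(\Omega)$, set $$\mathrm{Hess}_TF(q)(\sigma,\sigma)=\int_\Omega\!\int_\Omega\nabla^2_{xy}\tfrac{\delta^2}{\delta q(x)\delta q(y)}F(q)(\nabla\Phi(x),\nabla\Phi(y))\,q(x)q(y)\,dx\,dy+\int_\Omega\nabla_x^2\tfrac{\delta}{\delta q(x)}F(q)(\nabla\Phi(x),\nabla\Phi(x))\,q(x)\,dx,$$ where the first term is understood in the sense of distributions, i.e. as $\delta^2F(q)(\sigma,\sigma)$. When $F$ has a first variation at $q$ and there is a transport coordinate $\Phi_p$ from $q$ to $p$, the transport Bregman divergence is $$\mathrm D_{T,F}(p\|q)=F(p)-F(q)-\int_\Omega\Big(\nabla_x\tfrac{\delta}{\delta q(x)}F(q),\ \nabla\Phi_p(x)-x\Big)q(x)\,dx.$$ **Proposition.** (i) *Non-negativity.* Let $q,p$ be joined by a geodesic in $\mathcal P(\Omega)$ and let $F$ have a first variation at $q$. If $F$ is displacement convex, then $\mathrm D_{T,F}(p\|q)\ge0$.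 If $F$ is strictly displacement convex, then $\mathrm D_{T,F}(p\|q)=0$ if and only if $\mathrm{Dist}_T(p,q)=0$. (ii) *Transport Hessian metric.* Let $F$ have a second variation at $q$, and let $\Phi\in C^\infty(\Omega)$ with $\sigma=-\nabla\cdot(q\nabla\Phi)\in T_q\mathcal P(\Omega)$ be such that $\mathrm{id}+\epsilon\nabla\Phi$ maps $\Omega$ into $\Omega$ for all $\epsilon\in\mathbb R$ near $0$. Then for all $\epsilon$ near $0$ the push-forward $(\mathrm{id}+\epsilon\nabla\Phi)_\#q$ belongs to $\mathcal P(\Omega)$ and there is a transport coordinate from $q$ to it, and as $\epsilon\to0$ $$\mathrm D_{T,F}\big((\mathrm{id}+\epsilon\nabla\Phi)_\#q\,\big\|\,q\big)=\frac{\epsilon^2}{2}\mathrm{Hess}_TF(q)(\sigma,\sigma)+o(\epsilon^2).$$ If the second variation is given by a kernel in $C^\infty(\Omega\times\Omega)$, the displayed formula for $\mathrm{Hess}_TF(q)(\sigma,\sigma)$ holds with classical derivatives. (iii) *Linearity.* If $F,G$ have first variations at $q$, there is a transport coordinate from $q$ to $p$, and $a>0$, then $F+aG$ has a first variation at $q$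 and $\mathrm D_{T,F+aG}(p\|q)=\mathrm D_{T,F}(p\|q)+a\,\mathrm D_{T,G}(p\|q)$. (iv) *Asymmetry.* In general $\mathrm D_{T,F}(p\|q)\ne\mathrm D_{T,F}(q\|p)$: for $\Omega=[0,1]$ and $F(p)=\int_0^1p\log p\,dx$ there are strictly positive $p,q\in\mathcal P([0,1])$, with transport coordinates in both directions and with $F$ having first variations at both, such that $\mathrm D_{T,F}(p\|q)\neq\mathrm D_{T,F}(q\|p)$; both divergences are given by the Itakura–Saito formula $$\mathrm D_{T,F}(p\|q)=\int_0^1\Big(\frac{(F_p^{-1})'(y)}{(F_q^{-1})'(y)}-\log\frac{(F_p^{-1})'(y)}{(F_q^{-1})'(y)}-1\Big)dy$$ and the same formula with $p,q$ exchanged, where $F_p,F_q$ are the cumulative distribution functions of $p,q$. -/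

import Mathlib

open Set Filter Topology MeasureTheory
open scoped ContDiff ENNReal

noncomputable section

/-- The space `𝓟(Ω)` of smooth probability densities on `Ω`: functions of class `C^∞` on `Ω` (up to
the boundary), nonnegative, with integral one. Densities are normalized to vanish off `Ω`, so that
an element is determined by its values on `Ω`. -/
structure SmoothDensity {d : ℕ} (Ω : Set (EuclideanSpace ℝ (Fin d))) where
  toFun : EuclideanSpace ℝ (Fin d) → ℝ
  smooth : ContDiffOn ℝ ∞ toFun Ω
  nonneg : ∀ x, 0 ≤ toFun x
  eq_zero : ∀ x, x ∉ Ω → toFun x = 0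
  integral_eq_one : ∫ x in Ω, toFun x = 1

instance {d : ℕ} {Ω : Set (EuclideanSpace ℝ (Fin d))} :
    CoeFun (SmoothDensity Ω) (fun _ => EuclideanSpace ℝ (Fin d) → ℝ) :=
  ⟨SmoothDensity.toFun⟩

/-- The probability measure `q(x) dx` on `Ω`. -/
def SmoothDensity.measure {d : ℕ} {Ω : Set (EuclideanSpace ℝ (Fin d))} (q : SmoothDensity Ω) :
    Measure (EuclideanSpace ℝ (Fin d)) :=
  (volume.restrict Ω).withDensity (fun x => ENNReal.ofReal (q x))

/-- `T_# q = p`. -/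
def IsPushforward {d : ℕ} {Ω : Set (EuclideanSpace ℝ (Fin d))}
    (T : EuclideanSpace ℝ (Fin d) → EuclideanSpace ℝ (Fin d)) (q p : SmoothDensity Ω) : Prop :=
  Measure.map T q.measure = p.measure

/-- `T` restricts to a diffeomorphism of `Ω` onto itself, smooth up to the boundary. -/
def IsDiffeoOn {d : ℕ} (Ω : Set (EuclideanSpace ℝ (Fin d)))
    (T : EuclideanSpace ℝ (Fin d) → EuclideanSpace ℝ (Fin d)) : Prop :=
  ContDiffOn ℝ ∞ T Ω ∧ MapsTo T Ω Ω ∧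
    ∃ S : EuclideanSpace ℝ (Fin d) → EuclideanSpace ℝ (Fin d),
      ContDiffOn ℝ ∞ S Ω ∧ MapsTo S Ω Ω ∧ LeftInvOn S T Ω ∧ RightInvOn S T Ω

/-- The `L²`-Wasserstein distance: the square root of the infimum of `∫ ‖T x - x‖² q(x) dx` over
all diffeomorphisms `T` of `Ω` with `T_# q = p` (it is `∞` if there is none). -/
def transportDist {d : ℕ} {Ω : Set (EuclideanSpace ℝ (Fin d))} (p q : SmoothDensity Ω) : ℝ≥0∞ :=
  (⨅ (T : EuclideanSpace ℝ (Fin d) → EuclideanSpace ℝ (Fin d)) (_ : IsDiffeoOn Ω T)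
    (_ : IsPushforward T q p), ∫⁻ x in Ω, ENNReal.ofReal (‖T x - x‖ ^ 2 * q x)) ^ (1 / 2 : ℝ)

/-- Transport coordinates: `Φ` is smooth and strictly convex on `Ω` and `(∇Φ)_# q = p`. -/
structure IsTransportPotential {d : ℕ} {Ω : Set (EuclideanSpace ℝ (Fin d))}
    (q p : SmoothDensity Ω) (Φ : EuclideanSpace ℝ (Fin d) → ℝ) : Prop where
  smooth : ContDiffOn ℝ ∞ Φ Ω
  strictConvex : StrictConvexOn ℝ Ω Φ
  pushforward : IsPushforward (gradientWithin Φ Ω) q p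

/-- There are transport coordinates from `q` to `p`. -/
def HasTransportPotential {d : ℕ} {Ω : Set (EuclideanSpace ℝ (Fin d))}
    (q p : SmoothDensity Ω) : Prop :=
  ∃ Φ, IsTransportPotential q p Φ

open Classical in
/-- The transport coordinate `Φ_p` from `q` to `p`, if there is one. -/
def transportPotential {d : ℕ} {Ω : Set (EuclideanSpace ℝ (Fin d))} (q p : SmoothDensity Ω) :
    EuclideanSpace ℝ (Fin d) → ℝ :=
  if h : HasTransportPotential q p then h.choose else fun x => ‖x‖ ^ 2 / 2

/-- The optimal transport map `T = ∇Φ_p` from `q` to `p`. -/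
def transportMap {d : ℕ} {Ω : Set (EuclideanSpace ℝ (Fin d))} (q p : SmoothDensity Ω) :
    EuclideanSpace ℝ (Fin d) → EuclideanSpace ℝ (Fin d) :=
  gradientWithin (transportPotential q p) Ω

/-- The map `t ∇Φ + (1 - t) id` of displacement interpolation. -/
def displacementMap {d : ℕ} (Ω : Set (EuclideanSpace ℝ (Fin d)))
    (Φ : EuclideanSpace ℝ (Fin d) → ℝ) (t : ℝ) (x : EuclideanSpace ℝ (Fin d)) :
    EuclideanSpace ℝ (Fin d) :=
  t • gradientWithin Φ Ω x + (1 - t) • x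

/-- `Φ` is a transport coordinate from `q` to `p` whose displacement interpolation consists of
bijections of `Ω`, so that the interpolating densities are densities on `Ω`. -/
def IsGeodesicPotential {d : ℕ} {Ω : Set (EuclideanSpace ℝ (Fin d))}
    (q p : SmoothDensity Ω) (Φ : EuclideanSpace ℝ (Fin d) → ℝ) : Prop :=
  IsTransportPotential q p Φ ∧ ∀ t ∈ Icc (0 : ℝ) 1, BijOn (displacementMap Ω Φ t) Ω Ω

/-- `q` and `p` are joined by a displacement interpolation inside `𝓟(Ω)`. -/
def HasGeodesic {d : ℕ} {Ω : Set (EuclideanSpace ℝ (Fin d))} (q p : SmoothDensity Ω) : Prop :=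
  ∃ Φ, IsGeodesicPotential q p Φ

/-- Displacement convexity: convexity along displacement interpolations in `𝓟(Ω)`. -/
def IsDisplacementConvex {d : ℕ} {Ω : Set (EuclideanSpace ℝ (Fin d))}
    (F : SmoothDensity Ω → ℝ) : Prop :=
  ∀ (q p : SmoothDensity Ω) (Φ : EuclideanSpace ℝ (Fin d) → ℝ), IsGeodesicPotential q p Φ →
    ∀ t ∈ Icc (0 : ℝ) 1, ∀ r : SmoothDensity Ω, IsPushforward (displacementMap Ω Φ t) q r →
      F r ≤ t * F p + (1 - t) * F q

/-- Strict displacement convexity. -/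
def IsStrictlyDisplacementConvex {d : ℕ} {Ω : Set (EuclideanSpace ℝ (Fin d))}
    (F : SmoothDensity Ω → ℝ) : Prop :=
  IsDisplacementConvex F ∧
  ∀ (q p : SmoothDensity Ω) (Φ : EuclideanSpace ℝ (Fin d) → ℝ), IsGeodesicPotential q p Φ →
    q ≠ p →
    ∀ t ∈ Ioo (0 : ℝ) 1, ∀ r : SmoothDensity Ω, IsPushforward (displacementMap Ω Φ t) q r →
      F r < t * F p + (1 - t) * F q

/-- A smooth curve `t ↦ c t`, `0 ≤ t ≤ τ`, in `𝓟(Ω)`: `(t, x) ↦ c t x` is smooth on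
`[0, τ] × Ω`. -/
def IsSmoothCurve {d : ℕ} {Ω : Set (EuclideanSpace ℝ (Fin d))} (c : ℝ → SmoothDensity Ω) (τ : ℝ) :
    Prop :=
  0 < τ ∧ ContDiffOn ℝ ∞ (fun z : ℝ × EuclideanSpace ℝ (Fin d) => c z.1 z.2) (Icc 0 τ ×ˢ Ω)

/-- `φ = δF/δq` is the `L²` first variation of `F` at `q`: it is smooth on `Ω`, and
`d/dt F(c_t) = ∫ φ ∂ₜc_t dx` at `t = 0` for every smooth curve `c` in `𝓟(Ω)` that starts at `q`
(in particular for `c_t = q + t (p - q)`). This determines `φ` up to an additive constant. -/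
def IsFirstVariation {d : ℕ} {Ω : Set (EuclideanSpace ℝ (Fin d))} (F : SmoothDensity Ω → ℝ)
    (q : SmoothDensity Ω) (φ : EuclideanSpace ℝ (Fin d) → ℝ) : Prop :=
  ContDiffOn ℝ ∞ φ Ω ∧
  ∀ (c : ℝ → SmoothDensity Ω) (τ : ℝ), IsSmoothCurve c τ → c 0 = q →
    HasDerivWithinAt (fun t => F (c t))
      (∫ x in Ω, φ x * derivWithin (fun t => c t x) (Icc 0 τ) 0) (Icc 0 τ) 0

/-- `F` has a first variation at `q`. -/
def HasFirstVariation {d : ℕ} {Ω : Set (EuclideanSpace ℝ (Fin d))} (F : SmoothDensity Ω → ℝ)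
    (q : SmoothDensity Ω) : Prop :=
  ∃ φ, IsFirstVariation F q φ

open Classical in
/-- The first variation `δF/δq` at `q` (fixed up to an additive constant), if there is one. -/
def firstVariation {d : ℕ} {Ω : Set (EuclideanSpace ℝ (Fin d))} (F : SmoothDensity Ω → ℝ)
    (q : SmoothDensity Ω) : EuclideanSpace ℝ (Fin d) → ℝ :=
  if h : HasFirstVariation F q then h.choose else 0

/-- The transport Bregman divergence
`D_{T,F}(p ‖ q) = F(p) - F(q) - ∫ (∇ δF/δq(x), T(x) - x) q(x) dx`, with `T` the optimal transport
map from `q` to `p`. -/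
def transportBregman {d : ℕ} {Ω : Set (EuclideanSpace ℝ (Fin d))} (F : SmoothDensity Ω → ℝ)
    (p q : SmoothDensity Ω) : ℝ :=
  F p - F q -
    ∫ x in Ω, inner ℝ (gradientWithin (firstVariation F q) Ω x) (transportMap q p x - x) * q x

/-- The tangent space of `𝓟(Ω)`: functions that are smooth on `Ω` and have integral zero (normalized
to vanish off `Ω`). Integrability is automatic for compact `Ω`; it is recorded so that this is a
subspace for every `Ω`. -/
def tangentSpaceAt {d : ℕ} (Ω : Set (EuclideanSpace ℝ (Fin d))) :
    Submodule ℝ (EuclideanSpace ℝ (Fin d) → ℝ) where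
  carrier := {σ | ContDiffOn ℝ ∞ σ Ω ∧ (∀ x, x ∉ Ω → σ x = 0) ∧ IntegrableOn σ Ω ∧
    ∫ x in Ω, σ x = 0}
  zero_mem' := ⟨contDiffOn_const, fun _ _ => rfl, integrableOn_zero, by simp⟩
  add_mem' := by
    rintro σ η ⟨h1, h2, h3, h4⟩ ⟨k1, k2, k3, k4⟩
    refine ⟨h1.add k1, fun x hx => by simp [h2 x hx, k2 x hx], h3.add k3, ?_⟩
    have := integral_add h3 k3
    simpa [h4, k4] using this
  smul_mem' := by
    rintro a σ ⟨h1, h2, h3, h4⟩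
    refine ⟨h1.const_smul a, fun x hx => by simp [h2 x hx], h3.smul a, ?_⟩
    simp [integral_const_mul, h4]

/-- `B` is the `L²` second variation of `F` at `q`, as a bilinear form on tangent functions,
`B σ η = ∫∫ δ²F/δq(x)δq(y) σ(x) η(y) dx dy` (the kernel may be a distribution, as for the entropy).
Along every smooth curve `c` from `q` the first variations exist and depend smoothly on `(t, x)`,
and `d/dt ∫ δF/δq(c_t)(x) η(x) dx = B (∂ₜc) η` at `t = 0`. -/
def IsSecondVariation {d : ℕ} {Ω : Set (EuclideanSpace ℝ (Fin d))} (F : SmoothDensity Ω → ℝ)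
    (q : SmoothDensity Ω) (B : LinearMap.BilinForm ℝ (tangentSpaceAt Ω)) : Prop :=
  ∀ (c : ℝ → SmoothDensity Ω) (τ : ℝ), IsSmoothCurve c τ → c 0 = q →
    ∃ (δ : ℝ) (φ : ℝ → EuclideanSpace ℝ (Fin d) → ℝ), 0 < δ ∧ δ ≤ τ ∧
      ContDiffOn ℝ ∞ (fun z : ℝ × EuclideanSpace ℝ (Fin d) => φ z.1 z.2) (Icc 0 δ ×ˢ Ω) ∧
      (∀ t ∈ Icc 0 δ, IsFirstVariation F (c t) (φ t)) ∧
      ∀ σ η : tangentSpaceAt Ω,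
        (∀ x, HasDerivWithinAt (fun t => c t x) (σ.1 x) (Icc 0 τ) 0) →
        HasDerivWithinAt (fun t => ∫ x in Ω, φ t x * η.1 x) (B σ η) (Icc 0 δ) 0

/-- `F` has a first and second variation at `q`. -/
def HasSecondVariation {d : ℕ} {Ω : Set (EuclideanSpace ℝ (Fin d))} (F : SmoothDensity Ω → ℝ)
    (q : SmoothDensity Ω) : Prop :=
  ∃ B, IsSecondVariation F q B

open Classical in
/-- The second variation of `F` at `q`, if there is one. -/
def secondVariation {d : ℕ} {Ω : Set (EuclideanSpace ℝ (Fin d))} (F : SmoothDensity Ω → ℝ)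
    (q : SmoothDensity Ω) : LinearMap.BilinForm ℝ (tangentSpaceAt Ω) :=
  if h : HasSecondVariation F q then h.choose else 0

/-- The second variation of `F` at `q` is given by the smooth kernel
`K(x, y) = δ²F/δq(x)δq(y)`. -/
def IsSecondVariationKernel {d : ℕ} {Ω : Set (EuclideanSpace ℝ (Fin d))}
    (F : SmoothDensity Ω → ℝ) (q : SmoothDensity Ω)
    (K : EuclideanSpace ℝ (Fin d) → EuclideanSpace ℝ (Fin d) → ℝ) : Prop :=
  ContDiffOn ℝ ∞ (fun z : EuclideanSpace ℝ (Fin d) × EuclideanSpace ℝ (Fin d) => K z.1 z.2)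
    (Ω ×ˢ Ω) ∧
  ∃ B, IsSecondVariation F q B ∧
    ∀ σ η : tangentSpaceAt Ω, B σ η = ∫ x in Ω, ∫ y in Ω, K x y * σ.1 x * η.1 y

/-- The divergence `∇ · v` on `Ω`. -/
def divergenceWithin {d : ℕ} (v : EuclideanSpace ℝ (Fin d) → EuclideanSpace ℝ (Fin d))
    (Ω : Set (EuclideanSpace ℝ (Fin d))) (x : EuclideanSpace ℝ (Fin d)) : ℝ :=
  LinearMap.trace ℝ (EuclideanSpace ℝ (Fin d))
    (fderivWithin ℝ v Ω x : EuclideanSpace ℝ (Fin d) →ₗ[ℝ] EuclideanSpace ℝ (Fin d))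

/-- `Φ` is smooth on `Ω` and `σ = -∇ · (q ∇Φ)`. -/
def IsTangentPotential {d : ℕ} {Ω : Set (EuclideanSpace ℝ (Fin d))} (q : SmoothDensity Ω)
    (σ : tangentSpaceAt Ω) (Φ : EuclideanSpace ℝ (Fin d) → ℝ) : Prop :=
  ContDiffOn ℝ ∞ Φ Ω ∧
    ∀ x ∈ Ω, σ.1 x = -divergenceWithin (fun y => q y • gradientWithin Φ Ω y) Ω x

/-- The term `∫ ∇²_x (δF/δq(x)) (∇Φ(x), ∇Φ(x)) q(x) dx` of the transport Hessian. -/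
def hessianLocalTerm {d : ℕ} {Ω : Set (EuclideanSpace ℝ (Fin d))} (F : SmoothDensity Ω → ℝ)
    (q : SmoothDensity Ω) (Φ : EuclideanSpace ℝ (Fin d) → ℝ) : ℝ :=
  ∫ x in Ω, inner ℝ
    (fderivWithin ℝ (gradientWithin (firstVariation F q) Ω) Ω x (gradientWithin Φ Ω x))
    (gradientWithin Φ Ω x) * q x

/-- The term `∫∫ ∇²_{xy} K(x, y) (∇Φ(x), ∇Φ(y)) q(x) q(y) dx dy` of the transport Hessian, for a
smooth kernel `K`. -/
def hessianKernelTerm {d : ℕ} {Ω : Set (EuclideanSpace ℝ (Fin d))} (q : SmoothDensity Ω)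
    (K : EuclideanSpace ℝ (Fin d) → EuclideanSpace ℝ (Fin d) → ℝ)
    (Φ : EuclideanSpace ℝ (Fin d) → ℝ) : ℝ :=
  ∫ x in Ω, ∫ y in Ω,
    fderivWithin ℝ (fun x' => fderivWithin ℝ (fun y' => K x' y') Ω y (gradientWithin Φ Ω y)) Ω x
      (gradientWithin Φ Ω x) * q x * q y

/-- The transport Hessian `Hess_T F(q)(σ, σ)`, `σ = -∇ · (q ∇Φ)`. The mixed derivative `∇²_{xy}` of
the second variation, tested with `q ∇Φ ⊗ q ∇Φ`, is taken in the sense of distributions: it is the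
second variation tested with `σ ⊗ σ`. For smooth kernels this is `hessianKernelTerm`. -/
def transportHessian {d : ℕ} {Ω : Set (EuclideanSpace ℝ (Fin d))} (F : SmoothDensity Ω → ℝ)
    (q : SmoothDensity Ω) (σ : tangentSpaceAt Ω) (Φ : EuclideanSpace ℝ (Fin d) → ℝ) : ℝ :=
  secondVariation F q σ σ + hessianLocalTerm F q Φ

/-- The negative Boltzmann-Shannon entropy `∫ p log p dx`. -/
def negEntropy {d : ℕ} {Ω : Set (EuclideanSpace ℝ (Fin d))} (p : SmoothDensity Ω) : ℝ :=
  ∫ x in Ω, p x * Real.log (p x)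

/-- The interval `[0, 1]`. -/
def unitSegment : Set (EuclideanSpace ℝ (Fin 1)) := {x | x 0 ∈ Icc (0 : ℝ) 1}

/-- The inverse cumulative distribution function of a density on `[0, 1]`. -/
def quantile (p : SmoothDensity unitSegment) (y : ℝ) : ℝ :=
  sInf {x : ℝ | 0 ≤ x ∧ y ≤ ∫ s in (0 : ℝ)..x, p (EuclideanSpace.single 0 s)}

/-- The Itakura-Saito divergence in transport coordinates,
`∫₀¹ (r - log r - 1) dy` with `r = (F_p⁻¹)'(y) / (F_q⁻¹)'(y)`. -/
def itakuraSaito (p q : SmoothDensity unitSegment) : ℝ :=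
  ∫ y in (0 : ℝ)..1, (deriv (quantile p) y / deriv (quantile q) y
    - Real.log (deriv (quantile p) y / deriv (quantile q) y) - 1)

end

/-! ### Gradients within Ω, densities and their measures, push-forwards. -/

section Basics

/-! The central object is the straight flow `x + t V(x)`, `V = ∇Ψ`, on a time interval so short that
`‖t DV‖ ≤ 1/2` and every map is a bijection of Ω. Its inverse is smooth in `(t, x)` up to the
boundary (`IsStraightFlow.contDiffOn_flowInv`), so the push-forwards of `q`, with density `q / det`
transported along the flow, form a smooth curve in the sense of the first variation. Moreover
`|x|²/2 + tΨ` is strictly convex with gradient `x + tV`, hence a transport coordinate.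
Differentiating `∫ ψ(x + tV) q` gives the weak continuity equation
(`IsStraightFlow.setIntegral_mul_deriv_curve`); no boundary term appears because the flow preserves
Ω. Consequently the derivative of `F` along the curve at time 0 is `∫ (∇δF/δq, V) q`, which is the
linear term subtracted in the divergence.

The divergence is defined through chosen representatives. `transportBregman_eq` removes the choices:
first variations are unique up to a constant, and Kantorovich duality makes optimal maps unique
`q`-a.e.

Non-negativity is the tangent line inequality for `t ↦ F((T_t)_# q)`. For strictness it is applied
at an intermediate time, where strict convexity leaves room. Zero distance forces `p = q`, since
cheap transport maps barely change integrals of Lipschitz functions.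

For the Hessian, the divergence at time `t` is the Taylor remainder of `F` along the flow after the
linear term. The derivative of `F` there is `g(t) = ∫ (∇φ_t(x + tV), V) q`, with `φ_t` the first
variation at time `t`. Differentiating `g` at 0, the dependence of `φ_t` on `t` yields the second
variation on `(σ, σ)` and the moving point yields the local term
(`IsStraightFlow.hasDerivWithinAt_pairing`). Negative ε is reduced to positive ε by changing the
sign of Φ. A smooth kernel is handled by integrating by parts in each variable.

Linearity follows from uniqueness of first variations. Asymmetry is an explicit computation with the
uniform density and `2/(2 - t)²`, for which the transport maps in both directions are Möbius and all
integrals are elementary. -/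

theorem ContDiffOn.gradientWithin {E : Type*} [NormedAddCommGroup E] [InnerProductSpace ℝ E]
    [CompleteSpace E] {Ω : Set E} {f : E → ℝ} (hf : ContDiffOn ℝ ∞ f Ω) (hΩ : UniqueDiffOn ℝ Ω) :
    ContDiffOn ℝ ∞ (gradientWithin f Ω) Ω :=
  (InnerProductSpace.toDual ℝ E).symm.toContinuousLinearEquiv.contDiff.comp_contDiffOn
    (hf.fderivWithin hΩ (m := ∞) (by simp))

theorem HasGradientWithinAt.gradientWithin_eq {E : Type*} [NormedAddCommGroup E]
    [InnerProductSpace ℝ E] [CompleteSpace E] {Ω : Set E} {f : E → ℝ} {v x : E}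
    (hf : HasGradientWithinAt f v Ω x) (hΩ : UniqueDiffOn ℝ Ω) (hx : x ∈ Ω) :
    gradientWithin f Ω x = v := by
  have h := (hasGradientWithinAt_iff_hasFDerivWithinAt.1 hf).fderivWithin (hΩ x hx)
  rw [gradientWithin, h]
  simp

theorem ContDiffOn.hasGradientWithinAt {E : Type*} [NormedAddCommGroup E] [InnerProductSpace ℝ E]
    [CompleteSpace E] {Ω : Set E} {f : E → ℝ} (hf : ContDiffOn ℝ ∞ f Ω) {x : E} (hx : x ∈ Ω) :
    HasGradientWithinAt f (_root_.gradientWithin f Ω x) Ω x :=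
  ((hf.differentiableOn (by simp)) x hx).hasGradientWithinAt

theorem ContDiffOn.hasFDerivWithinAt_inner {E : Type*} [NormedAddCommGroup E]
    [InnerProductSpace ℝ E] [CompleteSpace E] {Ω : Set E} {f : E → ℝ} (hf : ContDiffOn ℝ ∞ f Ω)
    {x : E} (hx : x ∈ Ω) :
    HasFDerivWithinAt f (innerSL ℝ (_root_.gradientWithin f Ω x)) Ω x :=
  hasGradientWithinAt_iff_hasFDerivWithinAt.1 (hf.hasGradientWithinAt hx)

variable {d : ℕ} {Ω : Set (EuclideanSpace ℝ (Fin d))}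

theorem subset_closure_interior_of_convex (hconvex : Convex ℝ Ω) (hint : (interior Ω).Nonempty) :
    Ω ⊆ closure (interior Ω) := by
  rw [hconvex.closure_interior_eq_closure_of_nonempty_interior hint]
  exact subset_closure

/-- Continuity upgrades a.e. equality to equality on the interior, which is dense in a convex body;
boundary values follow. -/
theorem eqOn_of_ae_eq_convex (hconvex : Convex ℝ Ω) (hint : (interior Ω).Nonempty)
    {Y : Type*} [TopologicalSpace Y] [T2Space Y] {f g : EuclideanSpace ℝ (Fin d) → Y}
    (h : f =ᵐ[volume.restrict Ω] g) (hf : ContinuousOn f Ω) (hg : ContinuousOn g Ω) :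
    EqOn f g Ω :=
  Measure.eqOn_of_ae_eq h hf hg (subset_closure_interior_of_convex hconvex hint)

theorem SmoothDensity.ext' {p q : SmoothDensity Ω} (h : EqOn p q Ω) : p = q := by
  obtain ⟨p, hp1, hp2, hp3, hp4⟩ := p
  obtain ⟨q, hq1, hq2, hq3, hq4⟩ := q
  have : p = q := by
    funext x
    by_cases hx : x ∈ Ω
    · exact h hx
    · rw [hp3 x hx, hq3 x hx]
  subst this
  rfl

theorem SmoothDensity.continuousOn (q : SmoothDensity Ω) : ContinuousOn q Ω :=
  q.smooth.continuousOn

theorem SmoothDensity.aemeasurable (q : SmoothDensity Ω) (hΩ : MeasurableSet Ω) :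
    AEMeasurable q (volume.restrict Ω) :=
  q.continuousOn.aemeasurable hΩ

theorem SmoothDensity.measure_ac (q : SmoothDensity Ω) : q.measure ≪ volume.restrict Ω :=
  withDensity_absolutelyContinuous _ _

theorem SmoothDensity.integral_measure (q : SmoothDensity Ω) (hΩ : MeasurableSet Ω)
    (f : EuclideanSpace ℝ (Fin d) → ℝ) :
    ∫ x, f x ∂q.measure = ∫ x in Ω, f x * q x := by
  rw [SmoothDensity.measure, integral_withDensity_eq_integral_toReal_smul₀
    (q.aemeasurable hΩ).ennreal_ofReal (by simp)]
  refine integral_congr_ae (.of_forall fun x => ?_)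
  simp [ENNReal.toReal_ofReal (q.nonneg x), mul_comm]

theorem SmoothDensity.integrable (q : SmoothDensity Ω) (hΩ : IsCompact Ω) :
    IntegrableOn q Ω :=
  q.continuousOn.integrableOn_compact hΩ

theorem SmoothDensity.isProbabilityMeasure (q : SmoothDensity Ω) (hΩ : IsCompact Ω) :
    IsProbabilityMeasure q.measure := by
  refine ⟨?_⟩
  rw [SmoothDensity.measure, withDensity_apply _ MeasurableSet.univ, Measure.restrict_univ,
    ← ofReal_integral_eq_lintegral_ofReal (q.integrable hΩ) (.of_forall q.nonneg),
    q.integral_eq_one]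
  simp

theorem SmoothDensity.ae_mem (q : SmoothDensity Ω) (hΩ : MeasurableSet Ω) :
    ∀ᵐ x ∂q.measure, x ∈ Ω :=
  q.measure_ac.ae_le (ae_restrict_mem hΩ)

theorem ae_mem_interior (hconvex : Convex ℝ Ω) (hΩ : MeasurableSet Ω) :
    ∀ᵐ x ∂(volume.restrict Ω), x ∈ interior Ω := by
  have h0 : ∀ᵐ x ∂(volume.restrict Ω), x ∉ frontier Ω :=
    ae_restrict_of_ae (measure_eq_zero_iff_ae_notMem.1 (hconvex.addHaar_frontier volume))
  filter_upwards [h0, ae_restrict_mem hΩ] with x hx hxΩ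
  by_contra h
  exact hx ⟨subset_closure hxΩ, h⟩

theorem SmoothDensity.eq_of_measure_eq (hcompact : IsCompact Ω) (hconvex : Convex ℝ Ω)
    (hint : (interior Ω).Nonempty) {p q : SmoothDensity Ω} (h : p.measure = q.measure) :
    p = q := by
  refine SmoothDensity.ext' (eqOn_of_ae_eq_convex hconvex hint ?_ p.continuousOn q.continuousOn)
  have := (withDensity_eq_iff (p.aemeasurable hcompact.measurableSet).ennreal_ofReal
    (q.aemeasurable hcompact.measurableSet).ennreal_ofReal ?_).1 h
  · filter_upwards [this] with x hx
    exact (ENNReal.ofReal_eq_ofReal_iff (p.nonneg x) (q.nonneg x)).1 hx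
  · have := p.isProbabilityMeasure hcompact
    have h1 := measure_ne_top p.measure univ
    rwa [SmoothDensity.measure, withDensity_apply _ MeasurableSet.univ, Measure.restrict_univ]
      at h1

theorem ContinuousOn.aemeasurable_measure {q : SmoothDensity Ω} (hΩ : MeasurableSet Ω)
    {Y : Type*} [TopologicalSpace Y] [MeasurableSpace Y] [BorelSpace Y]
    [TopologicalSpace.PseudoMetrizableSpace Y]
    {f : EuclideanSpace ℝ (Fin d) → Y} (hf : ContinuousOn f Ω) : AEMeasurable f q.measure :=
  (hf.aemeasurable hΩ).mono_ac q.measure_ac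

theorem IsPushforward.integral_eq {q p : SmoothDensity Ω}
    {T : EuclideanSpace ℝ (Fin d) → EuclideanSpace ℝ (Fin d)} (h : IsPushforward T q p)
    (hΩ : MeasurableSet Ω) (hT : ContinuousOn T Ω)
    {ψ : EuclideanSpace ℝ (Fin d) → ℝ} (hψ : ContinuousOn ψ Ω) :
    ∫ x in Ω, ψ x * p x = ∫ x in Ω, ψ (T x) * q x := by
  rw [← p.integral_measure hΩ, ← q.integral_measure hΩ (fun x => ψ (T x)), ← h]
  refine integral_map (hT.aemeasurable_measure hΩ) ?_
  rw [h]
  exact (hψ.aemeasurable_measure hΩ).aestronglyMeasurable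

theorem IsPushforward.congr {q p : SmoothDensity Ω}
    {T T' : EuclideanSpace ℝ (Fin d) → EuclideanSpace ℝ (Fin d)} (h : IsPushforward T q p)
    (hΩ : MeasurableSet Ω) (hT : EqOn T T' Ω) : IsPushforward T' q p := by
  rw [IsPushforward, ← h]
  refine Measure.map_congr ?_
  filter_upwards [q.ae_mem hΩ] with x hx
  exact (hT hx).symm

/-- Identifies an arbitrary family of push-forwards with the explicitly constructed flow curve. -/
theorem IsPushforward.unique (hcompact : IsCompact Ω) (hconvex : Convex ℝ Ω)
    (hint : (interior Ω).Nonempty) {q p p' : SmoothDensity Ω}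
    {T : EuclideanSpace ℝ (Fin d) → EuclideanSpace ℝ (Fin d)} (h : IsPushforward T q p)
    (h' : IsPushforward T q p') : p = p' :=
  SmoothDensity.eq_of_measure_eq hcompact hconvex hint (h.symm.trans h')

theorem IsPushforward.of_ae_id {q : SmoothDensity Ω}
    {T : EuclideanSpace ℝ (Fin d) → EuclideanSpace ℝ (Fin d)} (hΩ : MeasurableSet Ω)
    (h : EqOn T id Ω) : IsPushforward T q q := by
  refine IsPushforward.congr (T := id) ?_ hΩ h.symm
  simp [IsPushforward]

end Basics

/-! ### Differentiation under the integral sign, including one-sided derivatives. -/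

section ParametricIntegral

/-- Dominated convergence of difference quotients: the joint derivative is bounded on the compact
convex set `[a, b] × K`, so the mean value inequality bounds all quotients by one constant. -/
theorem hasDerivWithinAt_setIntegral_of_contDiffOn {E : Type*} [NormedAddCommGroup E]
    [NormedSpace ℝ E] [MeasurableSpace E] [BorelSpace E] {μ : Measure E}
    [IsFiniteMeasureOnCompacts μ] {K : Set E} (hK : IsCompact K) (hconv : Convex ℝ K)
    (hu : UniqueDiffOn ℝ K) {a b t₀ : ℝ} (hab : a < b) (ht₀ : t₀ ∈ Icc a b) {g : ℝ → E → ℝ}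
    {g' : E → ℝ} (hg : ContDiffOn ℝ ∞ (fun z : ℝ × E => g z.1 z.2) (Icc a b ×ˢ K))
    (hg' : ∀ x ∈ K, HasDerivWithinAt (fun t => g t x) (g' x) (Icc a b) t₀) :
    HasDerivWithinAt (fun t => ∫ x in K, g t x ∂μ) (∫ x in K, g' x ∂μ) (Icc a b) t₀ := by
  have hu2 : UniqueDiffOn ℝ (Icc a b ×ˢ K) := (uniqueDiffOn_Icc hab).prod hu
  have hc : ContinuousOn (fderivWithin ℝ (fun z : ℝ × E => g z.1 z.2) (Icc a b ×ˢ K))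
      (Icc a b ×ˢ K) := hg.continuousOn_fderivWithin hu2 (by simp)
  obtain ⟨C, hC⟩ := (isCompact_Icc.prod hK).exists_bound_of_continuousOn hc
  have hlip : ∀ t ∈ Icc a b, ∀ x ∈ K, ‖g t x - g t₀ x‖ ≤ C * ‖t - t₀‖ := by
    intro t ht x hx
    have := Convex.norm_image_sub_le_of_norm_fderivWithin_le (𝕜 := ℝ)
      (f := fun z : ℝ × E => g z.1 z.2) (hg.differentiableOn (by simp)) hC
      ((convex_Icc a b).prod hconv) (x := (t₀, x)) (y := (t, x)) ⟨ht₀, hx⟩ ⟨ht, hx⟩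
    simpa [Prod.norm_def] using this
  have hcont : ∀ t ∈ Icc a b, ContinuousOn (g t) K := fun t ht =>
    hg.continuousOn.comp (f := fun x : E => (t, x)) (by fun_prop) (fun x hx => ⟨ht, hx⟩)
  have hint : ∀ t ∈ Icc a b, IntegrableOn (g t) K μ := fun t ht =>
    (hcont t ht).integrableOn_compact hK
  rw [hasDerivWithinAt_iff_tendsto_slope]
  have hev : ∀ᶠ t in 𝓝[Icc a b \ {t₀}] t₀, t ∈ Icc a b \ {t₀} := self_mem_nhdsWithin
  have key : Tendsto (fun t => ∫ x in K, slope (fun s => g s x) t₀ t ∂μ)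
      (𝓝[Icc a b \ {t₀}] t₀) (𝓝 (∫ x in K, g' x ∂μ)) := by
    refine tendsto_integral_filter_of_dominated_convergence (fun _ => C) ?_ ?_ ?_ ?_
    · filter_upwards [hev] with t ht
      simp only [slope_def_field]
      exact (((hcont t ht.1).sub (hcont t₀ ht₀)).div_const _).aestronglyMeasurable hK.measurableSet
    · filter_upwards [hev] with t ht
      filter_upwards [ae_restrict_mem hK.measurableSet] with x hx
      rw [slope_def_field, norm_div, div_le_iff₀ (norm_pos_iff.2 (sub_ne_zero.2 ht.2))]
      exact hlip t ht.1 x hx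
    · exact integrableOn_const hK.measure_lt_top.ne
    · filter_upwards [ae_restrict_mem hK.measurableSet] with x hx
      exact hasDerivWithinAt_iff_tendsto_slope.1 (hg' x hx)
  refine key.congr' ?_
  filter_upwards [hev] with t ht
  simp only [slope_def_field]
  rw [integral_div, integral_sub (hint t ht.1) (hint t₀ ht₀)]

theorem ContDiffOn.slice_right {E F : Type*} [NormedAddCommGroup E] [NormedSpace ℝ E]
    [NormedAddCommGroup F] [NormedSpace ℝ F] {s : Set ℝ} {K : Set E} {g : ℝ → E → F}
    (hg : ContDiffOn ℝ ∞ (fun z : ℝ × E => g z.1 z.2) (s ×ˢ K)) {t : ℝ} (ht : t ∈ s) :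
    ContDiffOn ℝ ∞ (g t) K :=
  hg.comp (f := fun x : E => (t, x)) (by fun_prop) (fun _ hx => ⟨ht, hx⟩)

theorem ContDiffOn.slice_left {E F : Type*} [NormedAddCommGroup E] [NormedSpace ℝ E]
    [NormedAddCommGroup F] [NormedSpace ℝ F] {s : Set ℝ} {K : Set E} {g : ℝ → E → F}
    (hg : ContDiffOn ℝ ∞ (fun z : ℝ × E => g z.1 z.2) (s ×ˢ K)) {x : E} (hx : x ∈ K) :
    ContDiffOn ℝ ∞ (fun t => g t x) s :=
  hg.comp (f := fun t : ℝ => (t, x)) (by fun_prop) (fun _ ht => ⟨ht, hx⟩)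

end ParametricIntegral

/-! ### Uniqueness and linearity of first variations. -/

section FirstVariation

variable {d : ℕ} {Ω : Set (EuclideanSpace ℝ (Fin d))}

/-- The density `(1 - s) q + s p`. -/
noncomputable def SmoothDensity.mix (q p : SmoothDensity Ω) (hΩ : IsCompact Ω) (s : Icc (0 : ℝ) 1) :
    SmoothDensity Ω where
  toFun x := (1 - s) * q x + s * p x
  smooth := (contDiffOn_const.mul q.smooth).add (contDiffOn_const.mul p.smooth)
  nonneg x := add_nonneg (mul_nonneg (by linarith [s.2.2]) (q.nonneg x))
    (mul_nonneg s.2.1 (p.nonneg x))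
  eq_zero x hx := by simp [q.eq_zero x hx, p.eq_zero x hx]
  integral_eq_one := by
    rw [integral_add ((q.integrable hΩ).const_mul _) ((p.integrable hΩ).const_mul _),
      integral_const_mul, integral_const_mul, q.integral_eq_one, p.integral_eq_one]
    ring

open Classical in
/-- The density proportional to a nonnegative smooth function with nonzero integral. -/
noncomputable def SmoothDensity.normalize (hΩ : MeasurableSet Ω)
    (f : EuclideanSpace ℝ (Fin d) → ℝ)
    (hf : ContDiffOn ℝ ∞ f Ω) (h0 : ∀ x ∈ Ω, 0 ≤ f x) (hI : ∫ x in Ω, f x ≠ 0) :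
    SmoothDensity Ω where
  toFun x := if x ∈ Ω then f x / ∫ x in Ω, f x else 0
  smooth := (hf.div_const (∫ x in Ω, f x)).congr fun x hx => by simp [hx]
  nonneg x := by
    split_ifs with hx
    · exact div_nonneg (h0 x hx) (setIntegral_nonneg hΩ h0)
    · exact le_rfl
  eq_zero x hx := by simp [hx]
  integral_eq_one := by
    have h : EqOn (fun x => if x ∈ Ω then f x / ∫ x in Ω, f x else 0)
        (fun x => f x / ∫ x in Ω, f x) Ω := fun x hx => by simp [hx]
    rw [setIntegral_congr_fun hΩ h, integral_div, div_self hI]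

theorem SmoothDensity.normalize_apply (hΩ : MeasurableSet Ω) {f : EuclideanSpace ℝ (Fin d) → ℝ}
    (hf : ContDiffOn ℝ ∞ f Ω) (h0 : ∀ x ∈ Ω, 0 ≤ f x) (hI : ∫ x in Ω, f x ≠ 0)
    {x : EuclideanSpace ℝ (Fin d)} (hx : x ∈ Ω) :
    SmoothDensity.normalize hΩ f hf h0 hI x = f x / ∫ x in Ω, f x := by
  exact if_pos hx

/-- Linear interpolations are the curves that test a first variation. Clamping with `projIcc` only
serves to define the curve for every real time. -/
theorem IsSmoothCurve.mix (q p : SmoothDensity Ω) (hΩ : IsCompact Ω) :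
    IsSmoothCurve (fun t => q.mix p hΩ (projIcc 0 1 zero_le_one t)) 1 := by
  refine ⟨one_pos, ?_⟩
  have hq : ContDiffOn ℝ ∞ (fun z : ℝ × EuclideanSpace ℝ (Fin d) => q z.2) (Icc 0 1 ×ˢ Ω) :=
    q.smooth.comp contDiffOn_snd fun z hz => hz.2
  have hp : ContDiffOn ℝ ∞ (fun z : ℝ × EuclideanSpace ℝ (Fin d) => p z.2) (Icc 0 1 ×ˢ Ω) :=
    p.smooth.comp contDiffOn_snd fun z hz => hz.2
  refine (((contDiffOn_const (c := (1 : ℝ))).sub contDiffOn_fst).mul hq |>.add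
    (contDiffOn_fst.mul hp)).congr ?_
  rintro ⟨t, x⟩ ⟨ht, hx⟩
  simp only [SmoothDensity.mix, projIcc_of_mem zero_le_one ht]

theorem IsFirstVariation.hasDerivWithinAt {F : SmoothDensity Ω → ℝ} {q : SmoothDensity Ω}
    {φ : EuclideanSpace ℝ (Fin d) → ℝ} (h : IsFirstVariation F q φ) (hΩ : MeasurableSet Ω)
    {c : ℝ → SmoothDensity Ω} {τ : ℝ} (hc : IsSmoothCurve c τ) (h0 : c 0 = q)
    {c' : EuclideanSpace ℝ (Fin d) → ℝ}
    (hc' : ∀ x ∈ Ω, HasDerivWithinAt (fun t => c t x) (c' x) (Icc 0 τ) 0) :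
    HasDerivWithinAt (fun t => F (c t)) (∫ x in Ω, φ x * c' x) (Icc 0 τ) 0 := by
  have := h.2 c τ hc h0
  convert this using 1
  refine setIntegral_congr_fun hΩ fun x hx => ?_
  simp only [(hc' x hx).derivWithin (uniqueDiffOn_Icc hc.1 0 ⟨le_rfl, hc.1.le⟩)]

theorem IsFirstVariation.hasDerivWithinAt_mix {F : SmoothDensity Ω → ℝ} {q : SmoothDensity Ω}
    {φ : EuclideanSpace ℝ (Fin d) → ℝ} (h : IsFirstVariation F q φ) (hΩ : IsCompact Ω)
    (p : SmoothDensity Ω) :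
    HasDerivWithinAt (fun t => F (q.mix p hΩ (projIcc 0 1 zero_le_one t)))
      (∫ x in Ω, φ x * (p x - q x)) (Icc 0 1) 0 := by
  refine h.hasDerivWithinAt hΩ.measurableSet (IsSmoothCurve.mix q p hΩ) ?_ fun x hx => ?_
  · refine SmoothDensity.ext' fun x hx => ?_
    simp [SmoothDensity.mix]
  · have h1 : HasDerivWithinAt (fun t => (1 - t) * q x + t * p x) (p x - q x) (Icc 0 1) 0 := by
      have := (((hasDerivAt_id (0 : ℝ)).const_sub 1).mul_const (q x)).add
        ((hasDerivAt_id (0 : ℝ)).mul_const (p x))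
      exact this.hasDerivWithinAt.congr_deriv (by ring)
    refine h1.congr (fun t ht => ?_) ?_
    · simp only [SmoothDensity.mix, projIcc_of_mem zero_le_one ht]
    · simp [SmoothDensity.mix]

/-- The first variation is unique up to an additive constant. -/
theorem IsFirstVariation.unique (hcompact : IsCompact Ω) (hconvex : Convex ℝ Ω)
    (hint : (interior Ω).Nonempty) {F : SmoothDensity Ω → ℝ} {q : SmoothDensity Ω}
    {φ ψ : EuclideanSpace ℝ (Fin d) → ℝ} (hφ : IsFirstVariation F q φ)
    (hψ : IsFirstVariation F q ψ) : ∃ m : ℝ, ∀ x ∈ Ω, φ x = ψ x + m := by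
  have hmeas := hcompact.measurableSet
  set χ := fun x => φ x - ψ x with hχdef
  have hχ : ContDiffOn ℝ ∞ χ Ω := hφ.1.sub hψ.1
  have hI : ∀ {f : EuclideanSpace ℝ (Fin d) → ℝ}, ContinuousOn f Ω → IntegrableOn f Ω :=
    fun hf => hf.integrableOn_compact hcompact
  -- Both first variations compute the same derivative along the segment from `q` to `p`, so `χ` has
  -- the same mean under every density.
  have key : ∀ p : SmoothDensity Ω, ∫ x in Ω, χ x * p x = ∫ x in Ω, χ x * q x := by
    intro p
    have h1 := (uniqueDiffOn_Icc (zero_lt_one' ℝ) 0 (by simp)).eq_deriv _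
      (hφ.hasDerivWithinAt_mix hcompact p) (hψ.hasDerivWithinAt_mix hcompact p)
    have hφc := hφ.1.continuousOn
    have hψc := hψ.1.continuousOn
    have hpc := p.continuousOn
    have hqc := q.continuousOn
    rw [← sub_eq_zero, ← integral_sub (hI (by fun_prop)) (hI (by fun_prop))] at h1 ⊢
    rw [← h1]
    congr 1 with x
    simp only [χ]
    ring
  set m := ∫ x in Ω, χ x * q x with hm
  have key2 : ∀ p : SmoothDensity Ω, ∫ x in Ω, (χ x - m) * p x = 0 := by
    intro p
    have hχc := hχ.continuousOn
    have hpc := p.continuousOn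
    have : ∫ x in Ω, (χ x - m) * p x = (∫ x in Ω, χ x * p x) - m * ∫ x in Ω, p x := by
      rw [← integral_const_mul, ← integral_sub (hI (by fun_prop)) (hI (by fun_prop))]
      congr 1 with x
      ring
    rw [this, key p, p.integral_eq_one]
    simp
  have hvol : 0 < volume.real Ω := by
    rw [measureReal_def, ENNReal.toReal_pos_iff]
    exact ⟨Measure.measure_pos_of_nonempty_interior _ hint, hcompact.measure_lt_top⟩
  have key3 : ∀ f : EuclideanSpace ℝ (Fin d) → ℝ, ContDiffOn ℝ ∞ f Ω → (∀ x ∈ Ω, 0 ≤ f x) →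
      0 < ∫ x in Ω, f x → ∫ x in Ω, (χ x - m) * f x = 0 := by
    intro f hf h0 hpos
    have := key2 (SmoothDensity.normalize hmeas f hf h0 hpos.ne')
    rw [setIntegral_congr_fun hmeas (g := fun x => ((χ x - m) * f x) / ∫ x in Ω, f x),
      integral_div, div_eq_zero_iff] at this
    · exact this.resolve_right hpos.ne'
    · intro x hx
      simp only [SmoothDensity.normalize_apply hmeas hf h0 hpos.ne' hx]
      ring
  have h1 : ∫ x in Ω, (χ x - m) = 0 := by
    simpa using key3 (fun _ => 1) contDiffOn_const (fun _ _ => zero_le_one) (by simpa using hvol)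
  obtain ⟨C, hC⟩ := hcompact.exists_bound_of_continuousOn (hχ.continuousOn.sub (continuousOn_const (c := m)))
  have hχc := hχ.continuousOn
  -- The test function is `χ - m` itself, shifted by a constant that makes it positive; by `h1` the
  -- shift does not contribute, and `∫ (χ - m)² = 0` remains.
  have h2 : ∫ x in Ω, (χ x - m) * (|C| + 1 + (χ x - m)) = 0 := by
    refine key3 _ (contDiffOn_const.add (hχ.sub contDiffOn_const)) (fun x hx => ?_) ?_
    · have := (abs_le.1 ((hC x hx).trans (le_abs_self C))).1
      simp at this
      linarith
    · rw [integral_add (hI (by fun_prop)) (hI (by fun_prop)), h1]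
      simp
      positivity
  have hsq : IntegrableOn (fun x => (χ x - m) ^ 2) Ω := hI ((hχc.sub continuousOn_const).pow 2)
  have h3 : ∫ x in Ω, (χ x - m) ^ 2 = 0 := by
    have : ∫ x in Ω, (χ x - m) * (|C| + 1 + (χ x - m)) =
        (|C| + 1) * (∫ x in Ω, (χ x - m)) + ∫ x in Ω, (χ x - m) ^ 2 := by
      rw [← integral_const_mul, ← integral_add (hI (by fun_prop)) hsq]
      congr 1 with x
      ring
    rw [this, h1] at h2
    simpa using h2
  rw [integral_eq_zero_iff_of_nonneg (fun x => sq_nonneg _) hsq] at h3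
  refine ⟨m, ?_⟩
  have h4 : EqOn φ (fun x => ψ x + m) Ω := by
    refine eqOn_of_ae_eq_convex hconvex hint ?_ hφ.1.continuousOn
      (hψ.1.continuousOn.add continuousOn_const)
    filter_upwards [h3] with x hx
    have : χ x - m = 0 := by simpa using hx
    simp only [χ] at this
    linarith
  exact h4

theorem gradientWithin_congr_add_const {φ ψ : EuclideanSpace ℝ (Fin d) → ℝ} {m : ℝ}
    (h : ∀ x ∈ Ω, φ x = ψ x + m) : EqOn (gradientWithin φ Ω) (gradientWithin ψ Ω) Ω := by
  intro x hx
  simp only [gradientWithin]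
  rw [fderivWithin_congr h (h x hx), fderivWithin_add_const]

theorem IsFirstVariation.gradientWithin_eqOn (hcompact : IsCompact Ω) (hconvex : Convex ℝ Ω)
    (hint : (interior Ω).Nonempty) {F : SmoothDensity Ω → ℝ} {q : SmoothDensity Ω}
    {φ ψ : EuclideanSpace ℝ (Fin d) → ℝ} (hφ : IsFirstVariation F q φ)
    (hψ : IsFirstVariation F q ψ) : EqOn (gradientWithin φ Ω) (gradientWithin ψ Ω) Ω := by
  obtain ⟨m, hm⟩ := hφ.unique hcompact hconvex hint hψ
  exact gradientWithin_congr_add_const hm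

theorem HasFirstVariation.isFirstVariation {F : SmoothDensity Ω → ℝ} {q : SmoothDensity Ω}
    (h : HasFirstVariation F q) : IsFirstVariation F q (firstVariation F q) := by
  rw [firstVariation, dif_pos h]
  exact h.choose_spec

theorem HasTransportPotential.isTransportPotential {q p : SmoothDensity Ω}
    (h : HasTransportPotential q p) : IsTransportPotential q p (transportPotential q p) := by
  rw [transportPotential, dif_pos h]
  exact h.choose_spec

theorem IsFirstVariation.add_const_mul {F G : SmoothDensity Ω → ℝ} {q : SmoothDensity Ω}
    {φ ψ : EuclideanSpace ℝ (Fin d) → ℝ} (hcompact : IsCompact Ω) (hconvex : Convex ℝ Ω)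
    (hint : (interior Ω).Nonempty) (hφ : IsFirstVariation F q φ)
    (hψ : IsFirstVariation G q ψ) (a : ℝ) :
    IsFirstVariation (fun r => F r + a * G r) q (fun x => φ x + a * ψ x) := by
  refine ⟨hφ.1.add (contDiffOn_const.mul hψ.1), fun c τ hc h0 => ?_⟩
  refine ((hφ.2 c τ hc h0).add ((hψ.2 c τ hc h0).const_mul a)).congr_deriv ?_
  -- The time derivative is a partial derivative of a jointly smooth function, hence continuous in
  -- `x`; this gives the integrability needed to split the integral.
  have hd : ContinuousOn (fun x => derivWithin (fun t => c t x) (Icc 0 τ) 0) Ω := by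
    have hu : UniqueDiffOn ℝ (Icc 0 τ ×ˢ Ω) :=
      (uniqueDiffOn_Icc hc.1).prod (uniqueDiffOn_convex hconvex hint)
    have h1 := hc.2.continuousOn_fderivWithin hu (by simp)
    have hm : MapsTo (fun x : EuclideanSpace ℝ (Fin d) => ((0 : ℝ), x)) Ω (Icc 0 τ ×ˢ Ω) :=
      fun x hx => ⟨⟨le_rfl, hc.1.le⟩, hx⟩
    have h2 : ContinuousOn (fun x => fderivWithin ℝ
        (fun z : ℝ × EuclideanSpace ℝ (Fin d) => c z.1 z.2) (Icc 0 τ ×ˢ Ω) (0, x) (1, 0)) Ω :=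
      (h1.comp (f := fun x : EuclideanSpace ℝ (Fin d) => ((0 : ℝ), x)) (by fun_prop)
        hm).clm_apply continuousOn_const
    refine h2.congr fun x hx => ?_
    have h3 := (hc.2.differentiableOn (by simp) (0, x) (hm hx)).hasFDerivWithinAt
    have h4 : HasDerivWithinAt (fun t : ℝ => (t, x)) ((1 : ℝ), (0 : EuclideanSpace ℝ (Fin d)))
        (Icc 0 τ) 0 := ((hasDerivAt_id (0 : ℝ)).prodMk (hasDerivAt_const _ _)).hasDerivWithinAt
    exact (h3.comp_hasDerivWithinAt (0 : ℝ) h4 (t := Icc 0 τ ×ˢ Ω)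
      (fun t ht => mk_mem_prod ht hx)).derivWithin
      (uniqueDiffOn_Icc hc.1 0 ⟨le_rfl, hc.1.le⟩)
  have hφc := hφ.1.continuousOn
  have hψc := hψ.1.continuousOn
  rw [← integral_const_mul, ← integral_add]
  · congr 1 with x
    ring
  · exact (hφc.mul hd).integrableOn_compact hcompact
  · exact (continuousOn_const.mul (hψc.mul hd)).integrableOn_compact hcompact

theorem gradientWithin_add_const_mul (hΩ : UniqueDiffOn ℝ Ω) {φ ψ : EuclideanSpace ℝ (Fin d) → ℝ}
    (hφ : ContDiffOn ℝ ∞ φ Ω) (hψ : ContDiffOn ℝ ∞ ψ Ω) (a : ℝ)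
    {x : EuclideanSpace ℝ (Fin d)} (hx : x ∈ Ω) :
    gradientWithin (fun x => φ x + a * ψ x) Ω x =
      gradientWithin φ Ω x + a • gradientWithin ψ Ω x := by
  refine HasGradientWithinAt.gradientWithin_eq ?_ hΩ hx
  rw [hasGradientWithinAt_iff_hasFDerivWithinAt]
  have h1 := hasGradientWithinAt_iff_hasFDerivWithinAt.1 (hφ.hasGradientWithinAt hx)
  have h2 := hasGradientWithinAt_iff_hasFDerivWithinAt.1 (hψ.hasGradientWithinAt hx)
  exact (h1.add (h2.const_mul a)).congr_fderiv (by simp)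

/-- The transport Bregman divergence depends linearly on the functional. -/
theorem transportBregman_add_const_mul (hcompact : IsCompact Ω) (hconvex : Convex ℝ Ω)
    (hint : (interior Ω).Nonempty) {F G : SmoothDensity Ω → ℝ} {p q : SmoothDensity Ω} (a : ℝ)
    (hqp : HasTransportPotential q p) (hF : HasFirstVariation F q) (hG : HasFirstVariation G q) :
    HasFirstVariation (fun r => F r + a * G r) q ∧
      transportBregman (fun r => F r + a * G r) p q =
        transportBregman F p q + a * transportBregman G p q := by
  have hu := uniqueDiffOn_convex hconvex hint
  have hsum := hF.isFirstVariation.add_const_mul hcompact hconvex hint hG.isFirstVariation a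
  have hFG : HasFirstVariation (fun r => F r + a * G r) q := ⟨_, hsum⟩
  refine ⟨hFG, ?_⟩
  have hT : ContinuousOn (transportMap q p) Ω :=
    (hqp.isTransportPotential.smooth.gradientWithin hu).continuousOn
  have hcF := (hF.isFirstVariation.1.gradientWithin hu).continuousOn
  have hcG := (hG.isFirstVariation.1.gradientWithin hu).continuousOn
  have hq := q.continuousOn
  simp only [transportBregman]
  rw [setIntegral_congr_fun hcompact.measurableSet (g := fun x =>
    inner ℝ (gradientWithin (firstVariation F q) Ω x) (transportMap q p x - x) * q x +
    a * (inner ℝ (gradientWithin (firstVariation G q) Ω x) (transportMap q p x - x) * q x)),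
    integral_add, integral_const_mul]
  · ring
  · exact ContinuousOn.integrableOn_compact hcompact (by fun_prop)
  · exact ContinuousOn.integrableOn_compact hcompact (by fun_prop)
  · intro x hx
    change inner ℝ (gradientWithin (firstVariation _ q) Ω x) _ * _ = _
    -- The chosen first variation of the sum need not be the sum of the chosen ones, but the two
    -- differ by a constant, so their gradients agree.
    rw [hFG.isFirstVariation.gradientWithin_eqOn hcompact hconvex hint hsum hx,
      gradientWithin_add_const_mul hu hF.isFirstVariation.1 hG.isFirstVariation.1 a hx,
      inner_add_left, inner_smul_left]
    simp
    ring

end FirstVariation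

/-! ### Smoothness up to the boundary of inverse maps. -/

section InverseFunction

/-- A continuous inverse of a smooth map with invertible derivatives is smooth, up to the
boundary. -/
theorem ContDiffOn.of_rightInvOn {E F : Type*} [NormedAddCommGroup E] [NormedSpace ℝ E]
    [CompleteSpace E] [NormedAddCommGroup F] [NormedSpace ℝ F] {s : Set E} {t : Set F}
    {T : E → F} {S : F → E} (hs : UniqueDiffOn ℝ s) (ht : UniqueDiffOn ℝ t)
    (hT : ContDiffOn ℝ ∞ T s) (hS : ContinuousOn S t) (hSm : MapsTo S t s)
    (hTS : RightInvOn S T t) (hinv : ∀ x ∈ s, (fderivWithin ℝ T s x).IsInvertible) :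
    ContDiffOn ℝ ∞ S t := by
  have hd : ∀ y ∈ t, HasFDerivWithinAt S (fderivWithin ℝ T s (S y)).inverse t y := by
    intro y hy
    obtain ⟨e, he⟩ := hinv (S y) (hSm hy)
    rw [← he, ContinuousLinearMap.inverse_equiv]
    refine HasFDerivWithinAt.of_local_left_inverse (f := T) (t := s)
      ((hS y hy).tendsto_nhdsWithin hSm) ?_ hy ?_
    · rw [he]
      exact (hT.differentiableOn (by simp) _ (hSm hy)).hasFDerivWithinAt
    · filter_upwards [self_mem_nhdsWithin] with z hz using hTS hz
  have hdT : ContDiffOn ℝ ∞ (fderivWithin ℝ T s) s := hT.fderivWithin hs (by simp)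
  rw [contDiffOn_infty]
  intro n
  -- Bootstrap: `DS = (DT ∘ S)⁻¹`, and inversion of operators is smooth, so `S` of class `C^n` has a
  -- derivative of class `C^n`.
  induction n with
  | zero => exact contDiffOn_zero.2 hS
  | succ n ih =>
    have := (contDiffOn_succ_iff_fderivWithin (n := (n : WithTop ℕ∞)) (f := S) ht).2
      ⟨fun y hy => (hd y hy).differentiableWithinAt, by simp, ?_⟩
    · exact_mod_cast this
    · refine ContDiffOn.congr (f := fun y => (fderivWithin ℝ T s (S y)).inverse) ?_
        fun y hy => (hd y hy).fderivWithin (ht y hy)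
      have h1 : ContDiffOn ℝ n (fun y => fderivWithin ℝ T s (S y)) t :=
        (hdT.of_le (by exact_mod_cast le_top)).comp ih hSm
      intro y hy
      exact ((hinv (S y) (hSm hy)).contDiffAt_map_inverse).comp_contDiffWithinAt y (h1 y hy)

/-- On `t`, the preimage of a closed set `C` under `S` is the image `T(s ∩ C)`, which is compact and
therefore closed. -/
theorem ContinuousOn.invFunOn_of_isCompact {E F : Type*} [TopologicalSpace E] [TopologicalSpace F]
    [T2Space F] {s : Set E} {t : Set F} {T : E → F} {S : F → E} (hs : IsCompact s)
    (hT : ContinuousOn T s) (hSm : MapsTo S t s) (hTS : RightInvOn S T t)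
    (hST : LeftInvOn S T s) : ContinuousOn S t := by
  rw [continuousOn_iff_isClosed]
  intro C hC
  refine ⟨T '' (s ∩ C), ?_, ?_⟩
  · exact ((hs.inter_right hC).image_of_continuousOn (hT.mono inter_subset_left)).isClosed
  · ext y
    constructor
    · rintro ⟨hy1, hy2⟩
      exact ⟨⟨S y, ⟨hSm hy2, hy1⟩, hTS hy2⟩, hy2⟩
    · rintro ⟨⟨x, ⟨hx, hxC⟩, rfl⟩, hy⟩
      refine ⟨?_, hy⟩
      rw [mem_preimage, hST hx]
      exact hxC

theorem ContinuousLinearMap.isInvertible_of_injective {E : Type*} [NormedAddCommGroup E]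
    [NormedSpace ℝ E] [FiniteDimensional ℝ E] {A : E →L[ℝ] E} (hA : Function.Injective A) :
    A.IsInvertible :=
  ⟨(LinearEquiv.ofInjectiveEndo (A : E →ₗ[ℝ] E) hA).toContinuousLinearEquiv, by ext; rfl⟩

theorem injective_one_add_of_norm_lt_one {E : Type*} [NormedAddCommGroup E] [NormedSpace ℝ E]
    {A : E →L[ℝ] E} (hA : ‖A‖ < 1) : Function.Injective (1 + A : E →L[ℝ] E) := by
  rw [injective_iff_map_eq_zero]
  intro v hv
  have h1 : v = -A v := by
    rw [eq_neg_iff_add_eq_zero]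
    simpa using hv
  by_contra h
  have h2 : ‖v‖ ≤ ‖A‖ * ‖v‖ := by
    calc ‖v‖ = ‖A v‖ := by conv_lhs => rw [h1, norm_neg]
      _ ≤ _ := A.le_opNorm v
  have h3 : 0 < ‖v‖ := norm_pos_iff.2 h
  nlinarith

end InverseFunction

/-! ### The determinant near the identity. -/

section Determinant

variable {d : ℕ}

theorem euclidean_det_eq (A : EuclideanSpace ℝ (Fin d) →L[ℝ] EuclideanSpace ℝ (Fin d)) :
    A.det = (Matrix.of fun i j => A (EuclideanSpace.single j 1) i).det := by
  rw [ContinuousLinearMap.det, ← LinearMap.det_toMatrix (EuclideanSpace.basisFun (Fin d) ℝ).toBasis]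
  congr 1

theorem contDiff_euclidean_det : ContDiff ℝ ∞
    (fun A : EuclideanSpace ℝ (Fin d) →L[ℝ] EuclideanSpace ℝ (Fin d) => A.det) := by
  simp only [euclidean_det_eq, Matrix.det_apply, Matrix.of_apply]
  refine ContDiff.sum fun σ _ => ContDiff.const_smul _ (contDiff_prod fun i _ => ?_)
  have h : (fun A : EuclideanSpace ℝ (Fin d) →L[ℝ] EuclideanSpace ℝ (Fin d) =>
      A (EuclideanSpace.single i 1) (σ i)) =
      fun A => EuclideanSpace.proj (𝕜 := ℝ) (σ i) (A (EuclideanSpace.single i 1)) := rfl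
  rw [h]
  fun_prop

theorem euclidean_trace_eq (A : EuclideanSpace ℝ (Fin d) →L[ℝ] EuclideanSpace ℝ (Fin d)) :
    LinearMap.trace ℝ _ (A : EuclideanSpace ℝ (Fin d) →ₗ[ℝ] EuclideanSpace ℝ (Fin d)) =
      (Matrix.of fun i j => A (EuclideanSpace.single j 1) i).trace := by
  rw [LinearMap.trace_eq_matrix_trace ℝ (EuclideanSpace.basisFun (Fin d) ℝ).toBasis]
  congr 1

theorem euclidean_det_one : (1 : EuclideanSpace ℝ (Fin d) →L[ℝ] EuclideanSpace ℝ (Fin d)).det = 1 :=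
  LinearMap.det_id

theorem one_add_zero_smul (A : EuclideanSpace ℝ (Fin d) →L[ℝ] EuclideanSpace ℝ (Fin d)) :
    1 + (0 : ℝ) • A = 1 := by
  ext x
  simp

/-- Along the line `1 + rA` the determinant is a polynomial in `r` whose linear coefficient is the
trace (`Matrix.det_one_add_smul`); the chain rule computes the same derivative through `fderiv`. -/
theorem fderiv_euclidean_det_one (A : EuclideanSpace ℝ (Fin d) →L[ℝ] EuclideanSpace ℝ (Fin d)) :
    fderiv ℝ (fun A : EuclideanSpace ℝ (Fin d) →L[ℝ] EuclideanSpace ℝ (Fin d) => A.det) 1 A =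
      LinearMap.trace ℝ _ (A : EuclideanSpace ℝ (Fin d) →ₗ[ℝ] EuclideanSpace ℝ (Fin d)) := by
  have h1 : HasDerivAt (fun r : ℝ => (1 : EuclideanSpace ℝ (Fin d) →L[ℝ] _) + r • A) A 0 := by
    simpa using ((hasDerivAt_id (0 : ℝ)).smul_const A).const_add (1 : _ →L[ℝ] _)
  have h2 : HasFDerivAt (fun A : EuclideanSpace ℝ (Fin d) →L[ℝ] EuclideanSpace ℝ (Fin d) => A.det)
      (fderiv ℝ (fun A : EuclideanSpace ℝ (Fin d) →L[ℝ] EuclideanSpace ℝ (Fin d) => A.det) 1)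
      ((1 : EuclideanSpace ℝ (Fin d) →L[ℝ] _) + (0 : ℝ) • A) := by
    rw [one_add_zero_smul]
    exact (contDiff_euclidean_det.differentiable (by simp) 1).hasFDerivAt
  refine (h2.comp_hasDerivAt (0 : ℝ) h1).unique ?_
  set M := Matrix.of fun i j => A (EuclideanSpace.single j 1) i with hM
  have h3 : ((fun A : EuclideanSpace ℝ (Fin d) →L[ℝ] EuclideanSpace ℝ (Fin d) => A.det) ∘
      fun r : ℝ => (1 : EuclideanSpace ℝ (Fin d) →L[ℝ] _) + r • A) =
      fun r : ℝ => 1 + M.trace * r +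
        (((1 + (Polynomial.X : Polynomial ℝ) • M.map Polynomial.C).det).divX.divX).eval r * r ^ 2 := by
    funext r
    rw [← Matrix.det_one_add_smul, Function.comp_apply, euclidean_det_eq]
    congr 1
    ext i j
    simp [hM, Matrix.one_apply]
  rw [h3, euclidean_trace_eq, ← hM]
  have h4 := ((((hasDerivAt_id (0 : ℝ)).const_mul M.trace).const_add 1).add
    ((((1 + (Polynomial.X : Polynomial ℝ) • M.map Polynomial.C).det).divX.divX).hasDerivAt 0 |>.mul
      (hasDerivAt_pow 2 (0 : ℝ))))
  refine h4.congr_deriv ?_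
  simp

/-- The path `det(1 + sA)`, `0 ≤ s ≤ 1`, starts at 1 and cannot vanish, since `1 + sA` stays
injective; the intermediate value theorem concludes. -/
theorem det_one_add_pos_of_norm_lt_one
    {A : EuclideanSpace ℝ (Fin d) →L[ℝ] EuclideanSpace ℝ (Fin d)} (hA : ‖A‖ < 1) :
    0 < (1 + A).det := by
  by_contra! h
  have hc : ContinuousOn (fun s : ℝ => (1 + s • A).det) (Icc 0 1) :=
    (contDiff_euclidean_det.continuous.comp (by fun_prop : Continuous fun s : ℝ =>
      (1 + s • A : EuclideanSpace ℝ (Fin d) →L[ℝ] EuclideanSpace ℝ (Fin d)))).continuousOn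
  obtain ⟨s, hs, h0⟩ := intermediate_value_Icc' zero_le_one hc
    (show (0 : ℝ) ∈ Icc _ _ by simp [one_add_zero_smul, euclidean_det_one, h])
  have hn : ‖s • A‖ < 1 := by
    rw [norm_smul, Real.norm_of_nonneg hs.1]
    nlinarith [hs.2, norm_nonneg A]
  have hinj := injective_one_add_of_norm_lt_one hn
  have hdet : LinearMap.det ((1 + s • A : EuclideanSpace ℝ (Fin d) →L[ℝ] EuclideanSpace ℝ (Fin d)) :
    EuclideanSpace ℝ (Fin d) →ₗ[ℝ] EuclideanSpace ℝ (Fin d)) = 0 := h0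
  have := LinearMap.bot_lt_ker_of_det_eq_zero hdet
  rw [LinearMap.ker_eq_bot.2 hinj] at this
  exact lt_irrefl _ this

end Determinant

/-! ### Push-forward of densities through the Jacobian equation. -/

section ChangeOfVariables

variable {d : ℕ} {Ω : Set (EuclideanSpace ℝ (Fin d))}

/-- The Monge-Ampère (Jacobian) equation implies that `T` pushes `q dx` forward to `p dx`. -/
theorem map_withDensity_of_det_eq (hΩ : MeasurableSet Ω)
    {T : EuclideanSpace ℝ (Fin d) → EuclideanSpace ℝ (Fin d)}
    {T' : EuclideanSpace ℝ (Fin d) → EuclideanSpace ℝ (Fin d) →L[ℝ] EuclideanSpace ℝ (Fin d)}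
    (hT : ∀ x ∈ Ω, HasFDerivWithinAt T (T' x) Ω x) (hbij : BijOn T Ω Ω)
    {p q : EuclideanSpace ℝ (Fin d) → ℝ} (h : ∀ x ∈ Ω, |(T' x).det| * p (T x) = q x) :
    Measure.map T ((volume.restrict Ω).withDensity fun x => ENNReal.ofReal (q x)) =
      (volume.restrict Ω).withDensity fun x => ENNReal.ofReal (p x) := by
  have hTm : AEMeasurable T (volume.restrict Ω) :=
    ContinuousOn.aemeasurable (fun x hx => (hT x hx).continuousWithinAt) hΩ
  ext s hs
  rw [Measure.map_apply_of_aemeasurable (hTm.mono_ac (withDensity_absolutelyContinuous _ _)) hs,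
    withDensity_apply' _ _, withDensity_apply' _ _,
    ← lintegral_indicator₀ (hTm.nullMeasurable hs), ← lintegral_indicator hs]
  -- Writing Ω as `T(Ω)` on the target side puts the integral in the form of the area formula.
  conv_rhs => rw [← hbij.image_eq]
  rw [lintegral_image_eq_lintegral_abs_det_fderiv_mul volume hΩ hT hbij.injOn]
  refine setLIntegral_congr_fun hΩ fun x hx => ?_
  by_cases hxs : T x ∈ s
  · rw [indicator_of_mem hxs, indicator_of_mem (show x ∈ T ⁻¹' s from hxs), ← h x hx,
      ENNReal.ofReal_mul (abs_nonneg _)]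
  · rw [indicator_of_notMem hxs, indicator_of_notMem (show x ∉ T ⁻¹' s from hxs), mul_zero]

theorem IsPushforward.of_det_eq (hΩ : MeasurableSet Ω)
    {T : EuclideanSpace ℝ (Fin d) → EuclideanSpace ℝ (Fin d)}
    {T' : EuclideanSpace ℝ (Fin d) → EuclideanSpace ℝ (Fin d) →L[ℝ] EuclideanSpace ℝ (Fin d)}
    (hT : ∀ x ∈ Ω, HasFDerivWithinAt T (T' x) Ω x) (hbij : BijOn T Ω Ω)
    {p q : SmoothDensity Ω} (h : ∀ x ∈ Ω, |(T' x).det| * p (T x) = q x) : IsPushforward T q p :=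
  map_withDensity_of_det_eq hΩ hT hbij h

end ChangeOfVariables

/-! ### Straight flows and the curves of densities they generate. -/

section Flow

variable {d : ℕ} {Ω : Set (EuclideanSpace ℝ (Fin d))}
  {V : EuclideanSpace ℝ (Fin d) → EuclideanSpace ℝ (Fin d)} {τ : ℝ}

/-- The straight flow `x + t V(x)`, `0 ≤ t ≤ τ`, of a smooth vector field consists of bijections of
`Ω` with derivatives close to the identity. -/
structure IsStraightFlow (Ω : Set (EuclideanSpace ℝ (Fin d)))
    (V : EuclideanSpace ℝ (Fin d) → EuclideanSpace ℝ (Fin d)) (τ : ℝ) : Prop where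
  smooth : ContDiffOn ℝ ∞ V Ω
  pos : 0 < τ
  bijOn : ∀ t ∈ Icc 0 τ, BijOn (fun x => x + t • V x) Ω Ω
  norm_le : ∀ t ∈ Icc 0 τ, ∀ x ∈ Ω, ‖t • fderivWithin ℝ V Ω x‖ ≤ 1 / 2

theorem IsStraightFlow.norm_lt (h : IsStraightFlow Ω V τ) {t : ℝ} (ht : t ∈ Icc 0 τ)
    {x : EuclideanSpace ℝ (Fin d)} (hx : x ∈ Ω) : ‖t • fderivWithin ℝ V Ω x‖ < 1 :=
  (h.norm_le t ht x hx).trans_lt (by norm_num)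

/-- The inverse of `x + t V(x)` on `Ω`. -/
noncomputable def flowInv (Ω : Set (EuclideanSpace ℝ (Fin d)))
    (V : EuclideanSpace ℝ (Fin d) → EuclideanSpace ℝ (Fin d)) (t : ℝ) :
    EuclideanSpace ℝ (Fin d) → EuclideanSpace ℝ (Fin d) :=
  Function.invFunOn (fun x => x + t • V x) Ω

theorem IsStraightFlow.flowInv_mem (h : IsStraightFlow Ω V τ) {t : ℝ} (ht : t ∈ Icc 0 τ)
    {y : EuclideanSpace ℝ (Fin d)} (hy : y ∈ Ω) : flowInv Ω V t y ∈ Ω :=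
  (h.bijOn t ht).surjOn.mapsTo_invFunOn hy

theorem IsStraightFlow.flowInv_spec (h : IsStraightFlow Ω V τ) {t : ℝ} (ht : t ∈ Icc 0 τ)
    {y : EuclideanSpace ℝ (Fin d)} (hy : y ∈ Ω) :
    flowInv Ω V t y + t • V (flowInv Ω V t y) = y :=
  (h.bijOn t ht).surjOn.rightInvOn_invFunOn hy

theorem IsStraightFlow.flowInv_apply (h : IsStraightFlow Ω V τ) {t : ℝ} (ht : t ∈ Icc 0 τ)
    {x : EuclideanSpace ℝ (Fin d)} (hx : x ∈ Ω) : flowInv Ω V t (x + t • V x) = x :=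
  (h.bijOn t ht).injOn.leftInvOn_invFunOn hx

theorem IsStraightFlow.contDiffOn_flow (h : IsStraightFlow Ω V τ) :
    ContDiffOn ℝ ∞ (fun z : ℝ × EuclideanSpace ℝ (Fin d) => z.2 + z.1 • V z.2) (Icc 0 τ ×ˢ Ω) :=
  contDiffOn_snd.add (contDiffOn_fst.smul (h.smooth.comp contDiffOn_snd fun _ hz => hz.2))

theorem IsStraightFlow.hasFDerivWithinAt (h : IsStraightFlow Ω V τ) (t : ℝ)
    {x : EuclideanSpace ℝ (Fin d)} (hx : x ∈ Ω) :
    HasFDerivWithinAt (fun x => x + t • V x) (1 + t • fderivWithin ℝ V Ω x) Ω x :=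
  (hasFDerivWithinAt_id x Ω).add
    ((h.smooth.differentiableOn (by simp) x hx).hasFDerivWithinAt.const_smul t)

/-- Joint smoothness in time and space comes from inverting the space-time map `(t, x) ↦ (t, x +
tV(x))`. Its derivative is block triangular with diagonal blocks 1 and `1 + t DV`, hence injective.
-/
theorem IsStraightFlow.contDiffOn_flowInv (h : IsStraightFlow Ω V τ) (hcompact : IsCompact Ω)
    (hu : UniqueDiffOn ℝ Ω) :
    ContDiffOn ℝ ∞ (fun z : ℝ × EuclideanSpace ℝ (Fin d) => flowInv Ω V z.1 z.2)
      (Icc 0 τ ×ˢ Ω) := by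
  set s := Icc 0 τ ×ˢ Ω
  have hus : UniqueDiffOn ℝ s := (uniqueDiffOn_Icc h.pos).prod hu
  set T : ℝ × EuclideanSpace ℝ (Fin d) → ℝ × EuclideanSpace ℝ (Fin d) :=
    fun z => (z.1, z.2 + z.1 • V z.2) with hTdef
  set S : ℝ × EuclideanSpace ℝ (Fin d) → ℝ × EuclideanSpace ℝ (Fin d) :=
    fun z => (z.1, flowInv Ω V z.1 z.2) with hSdef
  have hT : ContDiffOn ℝ ∞ T s := contDiffOn_fst.prodMk h.contDiffOn_flow
  have hSm : MapsTo S s s := fun z hz => ⟨hz.1, h.flowInv_mem hz.1 hz.2⟩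
  have hTS : RightInvOn S T s := fun z hz => Prod.ext rfl (h.flowInv_spec hz.1 hz.2)
  have hST : LeftInvOn S T s := fun z hz => Prod.ext rfl (h.flowInv_apply hz.1 hz.2)
  have hS : ContinuousOn S s :=
    ContinuousOn.invFunOn_of_isCompact (isCompact_Icc.prod hcompact) hT.continuousOn hSm hTS hST
  have key : ContDiffOn ℝ ∞ S s := by
    refine ContDiffOn.of_rightInvOn hus hus hT hS hSm hTS fun z hz => ?_
    refine ContinuousLinearMap.isInvertible_of_injective ?_
    have hV : HasFDerivWithinAt (fun z : ℝ × EuclideanSpace ℝ (Fin d) => V z.2)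
        ((fderivWithin ℝ V Ω z.2).comp (ContinuousLinearMap.snd ℝ ℝ _)) s z :=
      ((h.smooth.differentiableOn (by simp) z.2 hz.2).hasFDerivWithinAt).comp z
        hasFDerivWithinAt_snd fun w hw => hw.2
    have hd := (hasFDerivWithinAt_fst (𝕜 := ℝ) (p := z) (s := s)).prodMk
      (hasFDerivWithinAt_snd.add (hasFDerivWithinAt_fst.smul hV))
    have hd' := hd.fderivWithin (hus z hz)
    change Function.Injective (fderivWithin ℝ (fun z => (z.1, z.2 + z.1 • V z.2)) s z)
    rw [show fderivWithin ℝ (fun z : ℝ × EuclideanSpace ℝ (Fin d) =>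
      (z.1, z.2 + z.1 • V z.2)) s z = _ from hd', injective_iff_map_eq_zero]
    rintro ⟨a, v⟩ hav
    simp only [Prod.ext_iff, ContinuousLinearMap.prod_apply, ContinuousLinearMap.coe_fst',
      Prod.fst_zero, Prod.snd_zero] at hav
    obtain ⟨rfl, hv⟩ := hav
    have hv2 : (1 + z.1 • fderivWithin ℝ V Ω z.2) v = 0 := by simpa using hv
    have := injective_one_add_of_norm_lt_one (h.norm_lt hz.1 hz.2)
    rw [injective_iff_map_eq_zero] at this
    rw [this v hv2]
    rfl
  exact contDiff_snd.comp_contDiffOn key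

/-- The Jacobian determinant of `x + t V(x)`. -/
noncomputable def flowDet (Ω : Set (EuclideanSpace ℝ (Fin d)))
    (V : EuclideanSpace ℝ (Fin d) → EuclideanSpace ℝ (Fin d)) (t : ℝ)
    (x : EuclideanSpace ℝ (Fin d)) : ℝ :=
  (1 + t • fderivWithin ℝ V Ω x).det

theorem IsStraightFlow.flowDet_pos (h : IsStraightFlow Ω V τ) {t : ℝ} (ht : t ∈ Icc 0 τ)
    {x : EuclideanSpace ℝ (Fin d)} (hx : x ∈ Ω) : 0 < flowDet Ω V t x :=
  det_one_add_pos_of_norm_lt_one (h.norm_lt ht hx)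

open Classical in
/-- The density of the push-forward of `q` under `x + t V(x)`. -/
noncomputable def flowDensityFun (q : SmoothDensity Ω)
    (V : EuclideanSpace ℝ (Fin d) → EuclideanSpace ℝ (Fin d)) (t : ℝ)
    (y : EuclideanSpace ℝ (Fin d)) : ℝ :=
  if y ∈ Ω then q (flowInv Ω V t y) / flowDet Ω V t (flowInv Ω V t y) else 0

theorem flowDensityFun_of_mem (q : SmoothDensity Ω) (t : ℝ) {y : EuclideanSpace ℝ (Fin d)}
    (hy : y ∈ Ω) :
    flowDensityFun q V t y = q (flowInv Ω V t y) / flowDet Ω V t (flowInv Ω V t y) :=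
  if_pos hy

theorem flowDensityFun_of_notMem (q : SmoothDensity Ω) (t : ℝ) {y : EuclideanSpace ℝ (Fin d)}
    (hy : y ∉ Ω) : flowDensityFun q V t y = 0 :=
  if_neg hy

theorem IsStraightFlow.contDiffOn_density (h : IsStraightFlow Ω V τ) (hcompact : IsCompact Ω)
    (hu : UniqueDiffOn ℝ Ω) (q : SmoothDensity Ω) :
    ContDiffOn ℝ ∞ (fun z : ℝ × EuclideanSpace ℝ (Fin d) => flowDensityFun q V z.1 z.2)
      (Icc 0 τ ×ˢ Ω) := by
  have hinv := h.contDiffOn_flowInv hcompact hu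
  have hm : MapsTo (fun z : ℝ × EuclideanSpace ℝ (Fin d) => flowInv Ω V z.1 z.2)
      (Icc 0 τ ×ˢ Ω) Ω := fun z hz => h.flowInv_mem hz.1 hz.2
  have hDV : ContDiffOn ℝ ∞ (fun z : ℝ × EuclideanSpace ℝ (Fin d) =>
      fderivWithin ℝ V Ω (flowInv Ω V z.1 z.2)) (Icc 0 τ ×ˢ Ω) :=
    (h.smooth.fderivWithin hu (m := ∞) (by simp)).comp hinv hm
  have hdet : ContDiffOn ℝ ∞ (fun z : ℝ × EuclideanSpace ℝ (Fin d) =>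
      flowDet Ω V z.1 (flowInv Ω V z.1 z.2)) (Icc 0 τ ×ˢ Ω) :=
    contDiff_euclidean_det.comp_contDiffOn (contDiffOn_const.add (contDiffOn_fst.smul hDV))
  refine ((q.smooth.comp hinv hm).div hdet fun z hz =>
    (h.flowDet_pos hz.1 (hm hz)).ne').congr fun z hz => ?_
  exact flowDensityFun_of_mem q z.1 hz.2

theorem IsStraightFlow.contDiffOn_density_slice (h : IsStraightFlow Ω V τ) (hcompact : IsCompact Ω)
    (hu : UniqueDiffOn ℝ Ω) (q : SmoothDensity Ω) {t : ℝ} (ht : t ∈ Icc 0 τ) :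
    ContDiffOn ℝ ∞ (flowDensityFun q V t) Ω :=
  (h.contDiffOn_density hcompact hu q).slice_right ht

theorem IsStraightFlow.flowDensityFun_nonneg (h : IsStraightFlow Ω V τ) (q : SmoothDensity Ω)
    {t : ℝ} (ht : t ∈ Icc 0 τ) (y : EuclideanSpace ℝ (Fin d)) : 0 ≤ flowDensityFun q V t y := by
  by_cases hy : y ∈ Ω
  · rw [flowDensityFun_of_mem q t hy]
    exact div_nonneg (q.nonneg _) (h.flowDet_pos ht (h.flowInv_mem ht hy)).le
  · rw [flowDensityFun_of_notMem q t hy]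

theorem IsStraightFlow.map_measure (h : IsStraightFlow Ω V τ) (hcompact : IsCompact Ω)
    (q : SmoothDensity Ω) {t : ℝ} (ht : t ∈ Icc 0 τ) :
    Measure.map (fun x => x + t • V x) q.measure = (volume.restrict Ω).withDensity
      fun y => ENNReal.ofReal (flowDensityFun q V t y) := by
  refine map_withDensity_of_det_eq hcompact.measurableSet (fun x hx => h.hasFDerivWithinAt t hx)
    (h.bijOn t ht) fun x hx => ?_
  have hpos := h.flowDet_pos ht hx
  rw [flowDensityFun_of_mem q t ((h.bijOn t ht).mapsTo hx), h.flowInv_apply ht hx]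
  change |flowDet Ω V t x| * _ = _
  rw [abs_of_pos hpos]
  field_simp

/-- The total mass is read off from the push-forward of a probability measure, with no computation
of Jacobians. -/
theorem IsStraightFlow.setIntegral_flowDensityFun (h : IsStraightFlow Ω V τ)
    (hcompact : IsCompact Ω) (hu : UniqueDiffOn ℝ Ω) (q : SmoothDensity Ω) {t : ℝ}
    (ht : t ∈ Icc 0 τ) : ∫ x in Ω, flowDensityFun q V t x = 1 := by
  have hc := (h.contDiffOn_density_slice hcompact hu q ht).continuousOn
  have := q.isProbabilityMeasure hcompact
  have hT : AEMeasurable (fun x => x + t • V x) q.measure := by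
    have hVc := h.smooth.continuousOn
    exact ContinuousOn.aemeasurable_measure hcompact.measurableSet (by fun_prop)
  have h1 := (Measure.isProbabilityMeasure_map hT).measure_univ
  rw [h.map_measure hcompact q ht, withDensity_apply' _ univ,
    Measure.restrict_univ] at h1
  rw [integral_eq_lintegral_of_nonneg_ae (Eventually.of_forall (h.flowDensityFun_nonneg q ht))
    (hc.aestronglyMeasurable hcompact.measurableSet), h1, ENNReal.toReal_one]

/-- The push-forward of `q` under `x + t V(x)`. -/
noncomputable def IsStraightFlow.density (h : IsStraightFlow Ω V τ) (hcompact : IsCompact Ω)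
    (hu : UniqueDiffOn ℝ Ω) (q : SmoothDensity Ω) (t : Icc 0 τ) : SmoothDensity Ω where
  toFun := flowDensityFun q V t
  smooth := h.contDiffOn_density_slice hcompact hu q t.2
  nonneg := h.flowDensityFun_nonneg q t.2
  eq_zero _ hy := flowDensityFun_of_notMem q t hy
  integral_eq_one := h.setIntegral_flowDensityFun hcompact hu q t.2

/-- The curve of push-forwards of `q` under `x + t V(x)`. -/
noncomputable def IsStraightFlow.curve (h : IsStraightFlow Ω V τ) (hcompact : IsCompact Ω)
    (hu : UniqueDiffOn ℝ Ω) (q : SmoothDensity Ω) (t : ℝ) : SmoothDensity Ω :=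
  h.density hcompact hu q (projIcc 0 τ h.pos.le t)

theorem IsStraightFlow.curve_apply (h : IsStraightFlow Ω V τ) (hcompact : IsCompact Ω)
    (hu : UniqueDiffOn ℝ Ω) (q : SmoothDensity Ω) {t : ℝ} (ht : t ∈ Icc 0 τ)
    (x : EuclideanSpace ℝ (Fin d)) : h.curve hcompact hu q t x = flowDensityFun q V t x := by
  simp only [IsStraightFlow.curve, projIcc_of_mem h.pos.le ht]
  rfl

theorem IsStraightFlow.isSmoothCurve (h : IsStraightFlow Ω V τ) (hcompact : IsCompact Ω)
    (hu : UniqueDiffOn ℝ Ω) (q : SmoothDensity Ω) : IsSmoothCurve (h.curve hcompact hu q) τ :=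
  ⟨h.pos, (h.contDiffOn_density hcompact hu q).congr fun z hz =>
    h.curve_apply hcompact hu q hz.1 z.2⟩

theorem IsStraightFlow.isPushforward (h : IsStraightFlow Ω V τ) (hcompact : IsCompact Ω)
    (hu : UniqueDiffOn ℝ Ω) (q : SmoothDensity Ω) {t : ℝ} (ht : t ∈ Icc 0 τ) :
    IsPushforward (fun x => x + t • V x) q (h.curve hcompact hu q t) := by
  rw [IsPushforward, h.map_measure hcompact q ht, SmoothDensity.measure]
  simp only [h.curve_apply hcompact hu q ht]

theorem IsStraightFlow.curve_zero (h : IsStraightFlow Ω V τ) (hcompact : IsCompact Ω)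
    (hconvex : Convex ℝ Ω) (hint : (interior Ω).Nonempty) (q : SmoothDensity Ω) :
    h.curve hcompact (uniqueDiffOn_convex hconvex hint) q 0 = q := by
  refine IsPushforward.unique hcompact hconvex hint
    (h.isPushforward hcompact _ q ⟨le_rfl, h.pos.le⟩) ?_
  exact IsPushforward.of_ae_id hcompact.measurableSet fun x _ => by simp

theorem divergenceWithin_smul (hu : UniqueDiffOn ℝ Ω) {f : EuclideanSpace ℝ (Fin d) → ℝ}
    (hf : ContDiffOn ℝ ∞ f Ω) (hV : ContDiffOn ℝ ∞ V Ω) {x : EuclideanSpace ℝ (Fin d)}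
    (hx : x ∈ Ω) :
    divergenceWithin (fun y => f y • V y) Ω x =
      f x * divergenceWithin V Ω x + fderivWithin ℝ f Ω x (V x) := by
  have h1 := (hf.differentiableOn (by simp) x hx).hasFDerivWithinAt.smul
    (hV.differentiableOn (by simp) x hx).hasFDerivWithinAt
  have h2 := h1.fderivWithin (hu x hx)
  rw [divergenceWithin, show fderivWithin ℝ (fun y => f y • V y) Ω x = _ from h2,
    ContinuousLinearMap.toLinearMap_add, map_add, ContinuousLinearMap.toLinearMap_smul, map_smul]
  congr 1
  -- The remaining term is the trace of the rank-one map `v ↦ Df(v) V(x)`.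
  exact LinearMap.trace_smulRight _ _

/-- The continuity equation at time `0` for the push-forwards of `q` under `x + t V(x)`. -/
theorem IsStraightFlow.hasDerivWithinAt_curve (h : IsStraightFlow Ω V τ) (hcompact : IsCompact Ω)
    (hu : UniqueDiffOn ℝ Ω) (q : SmoothDensity Ω) {y : EuclideanSpace ℝ (Fin d)} (hy : y ∈ Ω) :
    HasDerivWithinAt (fun t => h.curve hcompact hu q t y)
      (-divergenceWithin (fun x => q x • V x) Ω y) (Icc 0 τ) 0 := by
  have hI0 : (0 : ℝ) ∈ Icc 0 τ := ⟨le_rfl, h.pos.le⟩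
  have hγ0 : flowInv Ω V 0 y = y := by simpa using h.flowInv_spec hI0 hy
  have hγm : MapsTo (fun t => flowInv Ω V t y) (Icc 0 τ) Ω := fun t ht => h.flowInv_mem ht hy
  have hγd : DifferentiableWithinAt ℝ (fun t => flowInv Ω V t y) (Icc 0 τ) 0 :=
    (ContDiffOn.slice_left (g := fun t => flowInv Ω V t) (h.contDiffOn_flowInv hcompact hu)
      hy).differentiableOn (by simp) 0 hI0
  have hcomp : ∀ {Y : Type} [NormedAddCommGroup Y] [NormedSpace ℝ Y]
      {f : EuclideanSpace ℝ (Fin d) → Y}, ContDiffOn ℝ ∞ f Ω →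
      DifferentiableWithinAt ℝ (fun t => f (flowInv Ω V t y)) (Icc 0 τ) 0 := by
    intro Y _ _ f hf
    exact (hf.differentiableOn (by simp) _ (hγm hI0)).comp 0 hγd hγm
  -- The inverse flow satisfies `γ(t) = y - t V(γ(t))`; at `t = 0` the product rule leaves only
  -- `-V(y)`.
  have hγ' : HasDerivWithinAt (fun t => flowInv Ω V t y) (-V y) (Icc 0 τ) 0 := by
    have h1 := ((hasDerivWithinAt_id (0 : ℝ) (Icc 0 τ)).smul
      (hcomp h.smooth).hasDerivWithinAt).const_sub y
    refine (h1.congr (fun t ht => ?_) ?_).congr_deriv ?_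
    · exact eq_sub_of_add_eq (h.flowInv_spec ht hy)
    · exact eq_sub_of_add_eq (h.flowInv_spec hI0 hy)
    · simp [hγ0]
  have hq' : HasDerivWithinAt (fun t => q (flowInv Ω V t y)) (fderivWithin ℝ q Ω y (-V y))
      (Icc 0 τ) 0 := by
    have h1 := (q.smooth.differentiableOn (by simp) _ (hγm hI0)).hasFDerivWithinAt
    have h2 := h1.comp_hasDerivWithinAt (0 : ℝ) hγ' hγm
    simp only [hγ0] at h2
    exact h2
  have hA' : HasDerivWithinAt (fun t => (1 : EuclideanSpace ℝ (Fin d) →L[ℝ] _) +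
      t • fderivWithin ℝ V Ω (flowInv Ω V t y)) (fderivWithin ℝ V Ω y) (Icc 0 τ) 0 := by
    have h1 := ((hasDerivWithinAt_id (0 : ℝ) (Icc 0 τ)).smul
      (hcomp (h.smooth.fderivWithin hu (m := ∞) (by simp))).hasDerivWithinAt).const_add
        (1 : EuclideanSpace ℝ (Fin d) →L[ℝ] _)
    refine h1.congr_deriv ?_
    simp [hγ0]
  have hdet' : HasDerivWithinAt (fun t => flowDet Ω V t (flowInv Ω V t y))
      (divergenceWithin V Ω y) (Icc 0 τ) 0 := by
    have h1 := (contDiff_euclidean_det (d := d)).differentiable (by simp)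
      (1 + (0 : ℝ) • fderivWithin ℝ V Ω (flowInv Ω V 0 y))
    have h2 := h1.hasFDerivAt.comp_hasDerivWithinAt (0 : ℝ) hA'
    refine h2.congr_deriv ?_
    rw [one_add_zero_smul, fderiv_euclidean_det_one]
    rfl
  have hdet0 : flowDet Ω V 0 (flowInv Ω V 0 y) = 1 := by
    rw [flowDet, one_add_zero_smul, euclidean_det_one]
  -- The quotient rule at determinant 1 gives `-Dq(V) - q ∇·V`, which is `-∇·(qV)`.
  have h1 := hq'.div hdet' (by rw [hdet0]; exact one_ne_zero)
  refine (h1.congr (fun t ht => ?_) ?_).congr_deriv ?_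
  · rw [h.curve_apply hcompact hu q ht, flowDensityFun_of_mem q t hy]; rfl
  · rw [h.curve_apply hcompact hu q hI0, flowDensityFun_of_mem q 0 hy]; rfl
  · rw [divergenceWithin_smul hu q.smooth h.smooth hy, hdet0, hγ0, map_neg]
    ring

end Flow

/-! ### Comparison of a one-sided derivative with a chord. -/

section OneSided

theorem HasDerivWithinAt.le_of_le_add_mul {f : ℝ → ℝ} {f' τ C : ℝ} (hτ : 0 < τ)
    (h : HasDerivWithinAt f f' (Icc 0 τ) 0) (hle : ∀ t ∈ Icc 0 τ, f t ≤ f 0 + t * C) : f' ≤ C := by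
  have h1 := hasDerivWithinAt_iff_tendsto_slope.1 h
  rw [Icc_sdiff_left] at h1
  have : (𝓝[Ioc 0 τ] (0 : ℝ)).NeBot := by
    rw [nhdsWithin_Ioc_eq_nhdsGT hτ]
    infer_instance
  refine le_of_tendsto h1 ?_
  filter_upwards [self_mem_nhdsWithin] with t ht
  rw [slope_def_field, sub_zero, div_le_iff₀ ht.1]
  linarith [hle t ⟨ht.1.le, ht.2⟩]

end OneSided

/-! ### Kantorovich duality and uniqueness of the optimal map. -/

section OptimalTransport

variable {d : ℕ} {Ω : Set (EuclideanSpace ℝ (Fin d))}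

theorem hasDerivWithinAt_segment (hconvex : Convex ℝ Ω) {Φ : EuclideanSpace ℝ (Fin d) → ℝ}
    (hΦ : ContDiffOn ℝ ∞ Φ Ω) {x z : EuclideanSpace ℝ (Fin d)} (hx : x ∈ Ω) (hz : z ∈ Ω) {s : ℝ}
    (hs : s ∈ Icc (0 : ℝ) 1) :
    HasDerivWithinAt (fun s => Φ (x + s • (z - x)))
      (inner ℝ (gradientWithin Φ Ω (x + s • (z - x))) (z - x)) (Icc 0 1) s := by
  have hm : MapsTo (fun s : ℝ => x + s • (z - x)) (Icc 0 1) Ω :=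
    fun s hs => hconvex.add_smul_sub_mem hx hz hs
  have h1 := hΦ.hasFDerivWithinAt_inner (hm hs)
  have h2 : HasDerivWithinAt (fun s : ℝ => x + s • (z - x)) (z - x) (Icc 0 1) s := by
    simpa using (((hasDerivAt_id s).smul_const (z - x)).const_add x).hasDerivWithinAt
  exact h1.comp_hasDerivWithinAt s h2 hm

/-- The first order condition for convexity. -/
theorem ConvexOn.add_inner_gradientWithin_le {Φ : EuclideanSpace ℝ (Fin d) → ℝ}
    (hc : ConvexOn ℝ Ω Φ) (hΦ : ContDiffOn ℝ ∞ Φ Ω) {x z : EuclideanSpace ℝ (Fin d)}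
    (hx : x ∈ Ω) (hz : z ∈ Ω) : Φ x + inner ℝ (gradientWithin Φ Ω x) (z - x) ≤ Φ z := by
  have h1 := hasDerivWithinAt_segment hc.1 hΦ hx hz (s := 0) (by simp)
  rw [zero_smul, add_zero] at h1
  have := h1.le_of_le_add_mul one_pos (C := Φ z - Φ x) fun t ht => ?_
  · linarith
  · have h2 := hc.2 hx hz (sub_nonneg.2 ht.2) ht.1 (by ring)
    have h3 : (1 - t) • x + t • z = x + t • (z - x) := by module
    rw [h3] at h2
    simp only [smul_eq_mul] at h2
    simp only [zero_smul, add_zero]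
    linarith

/-- The Legendre transform of a function on `Ω`. -/
noncomputable def legendreOn (Ω : Set (EuclideanSpace ℝ (Fin d)))
    (Φ : EuclideanSpace ℝ (Fin d) → ℝ) (y : EuclideanSpace ℝ (Fin d)) : ℝ :=
  sSup ((fun x : Ω => inner ℝ (x : EuclideanSpace ℝ (Fin d)) y - Φ x) '' univ)

theorem continuous_legendreOn (hcompact : IsCompact Ω) {Φ : EuclideanSpace ℝ (Fin d) → ℝ}
    (hΦ : ContinuousOn Φ Ω) : Continuous (legendreOn Ω Φ) := by
  have : CompactSpace Ω := isCompact_iff_compactSpace.1 hcompact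
  have hΦ' : Continuous fun x : Ω => Φ x := continuousOn_iff_continuous_domRestrict.1 hΦ
  refine IsCompact.continuous_sSup (f := fun (y : EuclideanSpace ℝ (Fin d)) (x : Ω) =>
    inner ℝ (x : EuclideanSpace ℝ (Fin d)) y - Φ x) isCompact_univ ?_
  exact Continuous.sub (by fun_prop) (hΦ'.comp continuous_snd)

theorem inner_le_add_legendreOn (hcompact : IsCompact Ω) {Φ : EuclideanSpace ℝ (Fin d) → ℝ}
    (hΦ : ContinuousOn Φ Ω) {x : EuclideanSpace ℝ (Fin d)} (hx : x ∈ Ω)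
    (y : EuclideanSpace ℝ (Fin d)) : inner ℝ x y ≤ Φ x + legendreOn Ω Φ y := by
  have : CompactSpace Ω := isCompact_iff_compactSpace.1 hcompact
  have hΦ' : Continuous fun x : Ω => Φ x := continuousOn_iff_continuous_domRestrict.1 hΦ
  have hbdd : BddAbove ((fun x : Ω => inner ℝ (x : EuclideanSpace ℝ (Fin d)) y - Φ x) '' univ) :=
    (isCompact_univ.image (Continuous.sub (by fun_prop) hΦ')).bddAbove
  have := le_csSup hbdd (mem_image_of_mem _ (mem_univ (⟨x, hx⟩ : Ω)))
  simp only [legendreOn]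
  linarith

/-- The supremum defining the transform is attained at `x` itself: this is the supporting hyperplane
inequality, valid up to the boundary. -/
theorem legendreOn_gradientWithin {Φ : EuclideanSpace ℝ (Fin d) → ℝ}
    (hc : ConvexOn ℝ Ω Φ) (hΦ : ContDiffOn ℝ ∞ Φ Ω) {x : EuclideanSpace ℝ (Fin d)} (hx : x ∈ Ω) :
    legendreOn Ω Φ (gradientWithin Φ Ω x) = inner ℝ x (gradientWithin Φ Ω x) - Φ x := by
  refine IsGreatest.csSup_eq ⟨⟨⟨x, hx⟩, mem_univ _, rfl⟩, ?_⟩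
  rintro _ ⟨z, -, rfl⟩
  have := hc.add_inner_gradientWithin_le hΦ hx z.2
  rw [inner_sub_right, real_inner_comm, real_inner_comm x] at this
  simp only []
  linarith

/-- Equality in Young's inequality makes `x` a minimum of `Φ - (y, ·)`; at an interior point the
gradient of this function vanishes. -/
theorem gradientWithin_eq_of_inner_eq (hcompact : IsCompact Ω) {Φ : EuclideanSpace ℝ (Fin d) → ℝ}
    (hΦ : ContDiffOn ℝ ∞ Φ Ω) {x y : EuclideanSpace ℝ (Fin d)}
    (hx : x ∈ interior Ω) (h : inner ℝ x y = Φ x + legendreOn Ω Φ y) :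
    gradientWithin Φ Ω x = y := by
  have hxΩ := interior_subset hx
  have hd : HasFDerivAt Φ (innerSL ℝ (gradientWithin Φ Ω x)) x :=
    (hΦ.hasFDerivWithinAt_inner hxΩ).hasFDerivAt (mem_interior_iff_mem_nhds.1 hx)
  have hd2 := hd.sub (innerSL ℝ y).hasFDerivAt
  have hmin : IsLocalMin (Φ - ⇑(innerSL ℝ y)) x := by
    filter_upwards [mem_interior_iff_mem_nhds.1 hx] with z hz
    have := inner_le_add_legendreOn hcompact hΦ.continuousOn hz y
    simp only [Pi.sub_apply, innerSL_apply_apply]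
    rw [real_inner_comm, real_inner_comm z]
    linarith
  have := hmin.hasFDerivAt_eq_zero hd2
  rw [← map_sub] at this
  have h2 : inner ℝ (gradientWithin Φ Ω x - y) (gradientWithin Φ Ω x - y) = (0 : ℝ) := by
    rw [← innerSL_apply_apply ℝ, this]
    rfl
  exact sub_eq_zero.1 (inner_self_eq_zero.1 h2)

theorem ContinuousOn.integrable_measure (hcompact : IsCompact Ω) (q : SmoothDensity Ω)
    {f : EuclideanSpace ℝ (Fin d) → ℝ} (hf : ContinuousOn f Ω) : Integrable f q.measure := by
  have := q.isProbabilityMeasure hcompact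
  obtain ⟨C, hC⟩ := hcompact.exists_bound_of_continuousOn hf
  refine Integrable.of_bound
    (hf.aemeasurable_measure hcompact.measurableSet).aestronglyMeasurable C ?_
  filter_upwards [q.ae_mem hcompact.measurableSet] with x hx using hC x hx

/-- A transport map given by a potential maximizes the correlation `∫ (x, T x) q(x) dx`, and a
transport map which does so coincides with it. -/
theorem IsTransportPotential.integral_sub_eq (hcompact : IsCompact Ω) (hconvex : Convex ℝ Ω)
    (hint : (interior Ω).Nonempty) {q p : SmoothDensity Ω} {Φ : EuclideanSpace ℝ (Fin d) → ℝ}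
    (hΦ : IsTransportPotential q p Φ) {T : EuclideanSpace ℝ (Fin d) → EuclideanSpace ℝ (Fin d)}
    (hTc : ContinuousOn T Ω) (hT : IsPushforward T q p) :
    ∫ x, (Φ x + legendreOn Ω Φ (T x) - inner ℝ x (T x)) ∂q.measure =
      ∫ x, inner ℝ x (gradientWithin Φ Ω x) ∂q.measure - ∫ x, inner ℝ x (T x) ∂q.measure := by
  have hu := uniqueDiffOn_convex hconvex hint
  have hcL := continuous_legendreOn hcompact hΦ.smooth.continuousOn
  have hcG := (hΦ.smooth.gradientWithin hu).continuousOn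
  have hcΦ := hΦ.smooth.continuousOn
  have hI := fun {f} (hf : ContinuousOn f Ω) => ContinuousOn.integrable_measure hcompact q hf
  have hmeas := hcompact.measurableSet
  -- The dual term depends on the map only through its push-forward, which is `p` for both maps.
  have h1 : ∫ x, legendreOn Ω Φ (T x) ∂q.measure =
      ∫ x, legendreOn Ω Φ (gradientWithin Φ Ω x) ∂q.measure := by
    rw [← integral_map (hTc.aemeasurable_measure hmeas) hcL.aestronglyMeasurable,
      ← integral_map (hcG.aemeasurable_measure hmeas) hcL.aestronglyMeasurable, hT,
      hΦ.pushforward]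
  have hcT : ContinuousOn (fun x => legendreOn Ω Φ (T x)) Ω := hcL.comp_continuousOn hTc
  have hcGL : ContinuousOn (fun x => legendreOn Ω Φ (gradientWithin Φ Ω x)) Ω :=
    hcL.comp_continuousOn hcG
  have h2 : ∫ x, inner ℝ x (gradientWithin Φ Ω x) ∂q.measure =
      ∫ x, (Φ x + legendreOn Ω Φ (gradientWithin Φ Ω x)) ∂q.measure := by
    refine integral_congr_ae ?_
    filter_upwards [q.ae_mem hmeas] with x hx
    rw [legendreOn_gradientWithin hΦ.strictConvex.convexOn hΦ.smooth hx]
    ring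
  have hcΦT : ContinuousOn (fun x => Φ x + legendreOn Ω Φ (T x)) Ω := hcΦ.add hcT
  rw [integral_sub (hI hcΦT) (hI (by fun_prop)), integral_add (hI hcΦ) (hI hcT), h1, h2,
    integral_add (hI hcΦ) (hI hcGL)]

/-- Optimal transport maps between smooth densities are unique. -/
theorem IsTransportPotential.ae_eq (hcompact : IsCompact Ω) (hconvex : Convex ℝ Ω)
    (hint : (interior Ω).Nonempty) {q p : SmoothDensity Ω} {Φ Ψ : EuclideanSpace ℝ (Fin d) → ℝ}
    (hΦ : IsTransportPotential q p Φ) (hΨ : IsTransportPotential q p Ψ) :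
    gradientWithin Φ Ω =ᵐ[q.measure] gradientWithin Ψ Ω := by
  have hu := uniqueDiffOn_convex hconvex hint
  have hmeas := hcompact.measurableSet
  have hcΦ := (hΦ.smooth.gradientWithin hu).continuousOn
  have hcΨ := (hΨ.smooth.gradientWithin hu).continuousOn
  have key : ∀ {Φ Ψ : EuclideanSpace ℝ (Fin d) → ℝ}, IsTransportPotential q p Φ → ∀ x ∈ Ω,
      0 ≤ Φ x + legendreOn Ω Φ (gradientWithin Ψ Ω x) - inner ℝ x (gradientWithin Ψ Ω x) :=
    fun {_ Ψ} hΦ x hx => sub_nonneg.2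
      (inner_le_add_legendreOn hcompact hΦ.smooth.continuousOn hx (gradientWithin Ψ Ω x))
  have h1 := hΦ.integral_sub_eq hcompact hconvex hint hcΨ hΨ.pushforward
  have h2 := hΨ.integral_sub_eq hcompact hconvex hint hcΦ hΦ.pushforward
  have h3 : 0 ≤ᵐ[q.measure] fun x => Φ x + legendreOn Ω Φ (gradientWithin Ψ Ω x) -
      inner ℝ x (gradientWithin Ψ Ω x) := by
    filter_upwards [q.ae_mem hmeas] with x hx using key hΦ x hx
  have h4 : 0 ≤ᵐ[q.measure] fun x => Ψ x + legendreOn Ω Ψ (gradientWithin Φ Ω x) -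
      inner ℝ x (gradientWithin Φ Ω x) := by
    filter_upwards [q.ae_mem hmeas] with x hx using key hΨ x hx
  -- The two duality gaps have opposite integrals by `h1` and `h2`, and both are nonnegative, so
  -- both vanish.
  have h5 : ∫ x, (Φ x + legendreOn Ω Φ (gradientWithin Ψ Ω x) -
      inner ℝ x (gradientWithin Ψ Ω x)) ∂q.measure = 0 := by
    have := integral_nonneg_of_ae h3
    have := integral_nonneg_of_ae h4
    linarith
  have hcL := continuous_legendreOn hcompact hΦ.smooth.continuousOn
  have hcLΨ : ContinuousOn (fun x => legendreOn Ω Φ (gradientWithin Ψ Ω x)) Ω :=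
    hcL.comp_continuousOn hcΨ
  have hcont : ContinuousOn (fun x => Φ x + legendreOn Ω Φ (gradientWithin Ψ Ω x) -
      inner ℝ x (gradientWithin Ψ Ω x)) Ω :=
    (hΦ.smooth.continuousOn.add hcLΨ).sub (by fun_prop)
  rw [integral_eq_zero_iff_of_nonneg_ae h3 (ContinuousOn.integrable_measure hcompact q hcont)] at h5
  filter_upwards [h5, q.measure_ac.ae_le (ae_mem_interior hconvex hmeas)] with x hx hxi
  refine gradientWithin_eq_of_inner_eq hcompact hΦ.smooth hxi ?_
  simp only [Pi.zero_apply] at hx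
  linarith

theorem IsTransportPotential.transportMap_ae_eq (hcompact : IsCompact Ω) (hconvex : Convex ℝ Ω)
    (hint : (interior Ω).Nonempty) {q p : SmoothDensity Ω} {Φ : EuclideanSpace ℝ (Fin d) → ℝ}
    (hΦ : IsTransportPotential q p Φ) :
    transportMap q p =ᵐ[q.measure] gradientWithin Φ Ω :=
  (HasTransportPotential.isTransportPotential ⟨Φ, hΦ⟩).ae_eq hcompact hconvex hint hΦ

/-- The transport Bregman divergence computed with any transport coordinate and any representative
of the first variation. -/
theorem transportBregman_eq (hcompact : IsCompact Ω) (hconvex : Convex ℝ Ω)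
    (hint : (interior Ω).Nonempty) {F : SmoothDensity Ω → ℝ} {q p : SmoothDensity Ω}
    {φ : EuclideanSpace ℝ (Fin d) → ℝ} (hφ : IsFirstVariation F q φ)
    {Φ : EuclideanSpace ℝ (Fin d) → ℝ} (hΦ : IsTransportPotential q p Φ) :
    transportBregman F p q = F p - F q -
      ∫ x in Ω, inner ℝ (gradientWithin φ Ω x) (gradientWithin Φ Ω x - x) * q x := by
  rw [transportBregman, ← q.integral_measure hcompact.measurableSet,
    ← q.integral_measure hcompact.measurableSet]
  congr 1
  refine integral_congr_ae ?_
  filter_upwards [hΦ.transportMap_ae_eq hcompact hconvex hint,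
    q.ae_mem hcompact.measurableSet] with x hx hxΩ
  rw [hx, (HasFirstVariation.isFirstVariation ⟨φ, hφ⟩).gradientWithin_eqOn hcompact hconvex hint
    hφ hxΩ]

end OptimalTransport

/-! ### Existence of straight flows for short times. -/

section StraightFlow

variable {d : ℕ} {Ω : Set (EuclideanSpace ℝ (Fin d))}
  {V : EuclideanSpace ℝ (Fin d) → EuclideanSpace ℝ (Fin d)} {τ : ℝ}

theorem norm_smul_sub_le_of_fderivWithin_le (hconvex : Convex ℝ Ω) (hV : ContDiffOn ℝ ∞ V Ω)
    (hu : UniqueDiffOn ℝ Ω) {t : ℝ} (h : ∀ x ∈ Ω, ‖t • fderivWithin ℝ V Ω x‖ ≤ 1 / 2)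
    {x y : EuclideanSpace ℝ (Fin d)} (hx : x ∈ Ω) (hy : y ∈ Ω) :
    ‖t • V x - t • V y‖ ≤ 1 / 2 * ‖x - y‖ := by
  have hd : DifferentiableOn ℝ (fun x => t • V x) Ω :=
    (hV.differentiableOn (by simp)).const_smul t
  refine Convex.norm_image_sub_le_of_norm_fderivWithin_le (𝕜 := ℝ) (f := fun x => t • V x) hd
    (fun z hz => ?_) hconvex hy hx
  have h1 := (hV.differentiableOn (by simp) z hz).hasFDerivWithinAt.const_smul t
  rw [show fderivWithin ℝ (fun x => t • V x) Ω z = _ from h1.fderivWithin (hu z hz)]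
  exact h z hz

theorem injOn_add_smul (hconvex : Convex ℝ Ω) (hV : ContDiffOn ℝ ∞ V Ω)
    (hu : UniqueDiffOn ℝ Ω) {t : ℝ} (h : ∀ x ∈ Ω, ‖t • fderivWithin ℝ V Ω x‖ ≤ 1 / 2) :
    InjOn (fun x => x + t • V x) Ω := by
  intro x hx y hy hxy
  have h1 := norm_smul_sub_le_of_fderivWithin_le hconvex hV hu h hx hy
  have h2 : t • V x - t • V y = -(x - y) := by
    have h3 : t • V x - t • V y = x + t • V x - (y + t • V y) - (x - y) := by abel
    rw [h3, show x + t • V x = y + t • V y from hxy]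
    simp
  rw [h2, norm_neg] at h1
  have h3 : ‖x - y‖ = 0 := by linarith [norm_nonneg (x - y)]
  exact sub_eq_zero.1 (norm_eq_zero.1 h3)

/-- If `x ± t V(x)` map `Ω` into itself, then boundary points stay on the boundary, and the map
`x + t V(x)` with small `t` is onto. -/
theorem surjOn_add_smul (hcompact : IsCompact Ω) (hconvex : Convex ℝ Ω)
    (hint : (interior Ω).Nonempty) (hV : ContDiffOn ℝ ∞ V Ω) {t : ℝ}
    (h : ∀ x ∈ Ω, ‖t • fderivWithin ℝ V Ω x‖ ≤ 1 / 2) (hp : MapsTo (fun x => x + t • V x) Ω Ω)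
    (hm : MapsTo (fun x => x - t • V x) Ω Ω) : SurjOn (fun x => x + t • V x) Ω Ω := by
  have hu := uniqueDiffOn_convex hconvex hint
  set T := fun x => x + t • V x with hT
  have hTc : ContinuousOn T Ω := by
    have := hV.continuousOn
    fun_prop
  -- The point `x` is the midpoint of `x + tV(x)` and `x - tV(x)`. If the first is interior and the
  -- second lies in Ω, convexity makes `x` interior.
  have hbd : ∀ x ∈ Ω, T x ∈ interior Ω → x ∈ interior Ω := by
    intro x hx hTx
    have := hconvex.combo_interior_self_mem_interior hTx (hm hx) (a := 1 / 2) (b := 1 / 2)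
      (by norm_num) (by norm_num) (by norm_num)
    convert this using 1
    simp only [hT]
    module
  -- `T` is a perturbation of the identity with Lipschitz constant `1/2`, so it is open on the
  -- interior.
  have happ : ApproximatesLinearOn T (ContinuousLinearMap.id ℝ _) (interior Ω) (1 / 2) := by
    intro x hx y hy
    have := norm_smul_sub_le_of_fderivWithin_le hconvex hV hu h (interior_subset hx)
      (interior_subset hy)
    have h2 : T x - T y - ContinuousLinearMap.id ℝ _ (x - y) = t • V x - t • V y := by
      simp only [hT, ContinuousLinearMap.id_apply]
      abel
    rw [h2]
    simpa using this
  have hopen : IsOpen (T '' interior Ω) := by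
    refine happ.open_image ⟨id, 1, fun y => by simp, fun y => rfl⟩ isOpen_interior (Or.inr ?_)
    simp only [inv_one]
    rw [← NNReal.coe_lt_coe]
    norm_num
  have hsub : T '' interior Ω ⊆ interior Ω :=
    interior_maximal ((image_mono interior_subset).trans hp.image_subset) hopen
  have hclosed : IsClosed (T '' Ω) := (hcompact.image_of_continuousOn hTc).isClosed
  -- The connected interior is covered by two disjoint open sets and meets the first, so it lies in
  -- it; taking closures, `T` reaches all of Ω.
  have hcover : interior Ω ⊆ T '' interior Ω ∪ (T '' Ω)ᶜ := by
    intro y hy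
    by_cases hyT : y ∈ T '' Ω
    · obtain ⟨x, hx, rfl⟩ := hyT
      exact Or.inl ⟨x, hbd x hx hy, rfl⟩
    · exact Or.inr hyT
  have hdisj : Disjoint (T '' interior Ω) (T '' Ω)ᶜ :=
    (disjoint_compl_right (a := T '' Ω)).mono_left (image_mono interior_subset)
  have h1 : interior Ω ⊆ T '' interior Ω := by
    refine IsPreconnected.subset_left_of_subset_union hopen hclosed.isOpen_compl hdisj hcover ?_
      hconvex.interior.isPreconnected
    obtain ⟨x, hx⟩ := hint
    exact ⟨T x, hsub ⟨x, hx, rfl⟩, x, hx, rfl⟩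
  exact (subset_closure_interior_of_convex hconvex hint).trans
    (hclosed.closure_subset_iff.2 (h1.trans (image_mono interior_subset)))

theorem exists_norm_smul_fderivWithin_le (hcompact : IsCompact Ω) (hu : UniqueDiffOn ℝ Ω)
    (hV : ContDiffOn ℝ ∞ V Ω) {τ₀ : ℝ} (hτ₀ : 0 < τ₀) :
    ∃ τ, 0 < τ ∧ τ < τ₀ ∧ ∀ t, |t| ≤ τ → ∀ x ∈ Ω, ‖t • fderivWithin ℝ V Ω x‖ ≤ 1 / 2 := by
  obtain ⟨C, hC⟩ := hcompact.exists_bound_of_continuousOn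
    (hV.continuousOn_fderivWithin hu (by simp))
  have hC' : 0 < |C| + 1 := by positivity
  -- The first bound keeps `τ < τ₀` strict; the second makes `|t| ‖DV‖ ≤ 1/2`, with `|C| + 1`
  -- avoiding division by zero.
  refine ⟨min (τ₀ / 2) (1 / (2 * (|C| + 1))), by positivity,
    (min_le_left _ _).trans_lt (by linarith), fun t ht x hx => ?_⟩
  rw [norm_smul, Real.norm_eq_abs]
  calc |t| * ‖fderivWithin ℝ V Ω x‖ ≤ 1 / (2 * (|C| + 1)) * (|C| + 1) := by
        gcongr
        · exact ht.trans (min_le_right _ _)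
        · linarith [hC x hx, le_abs_self C]
    _ = 1 / 2 := by field_simp

theorem exists_isStraightFlow_of_bijOn (hcompact : IsCompact Ω) (hu : UniqueDiffOn ℝ Ω)
    (hV : ContDiffOn ℝ ∞ V Ω) {τ₀ : ℝ} (hτ₀ : 0 < τ₀)
    (hbij : ∀ t ∈ Icc 0 τ₀, BijOn (fun x => x + t • V x) Ω Ω) :
    ∃ τ, τ < τ₀ ∧ IsStraightFlow Ω V τ := by
  obtain ⟨τ, h0, h1, h2⟩ := exists_norm_smul_fderivWithin_le hcompact hu hV hτ₀
  exact ⟨τ, h1, hV, h0, fun t ht => hbij t ⟨ht.1, ht.2.trans h1.le⟩,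
    fun t ht => h2 t (by rw [abs_of_nonneg ht.1]; exact ht.2)⟩

/-- Having both signs of ε in the hypothesis is what yields surjectivity: `x - tV` must map Ω into Ω
as well. -/
theorem exists_isStraightFlow_of_mapsTo (hcompact : IsCompact Ω) (hconvex : Convex ℝ Ω)
    (hint : (interior Ω).Nonempty) (hV : ContDiffOn ℝ ∞ V Ω)
    (hmaps : ∀ᶠ ε : ℝ in 𝓝 0, MapsTo (fun x => x + ε • V x) Ω Ω) :
    ∃ τ, IsStraightFlow Ω V τ := by
  have hu := uniqueDiffOn_convex hconvex hint
  obtain ⟨δ, hδ, hδm⟩ := Metric.eventually_nhds_iff.1 hmaps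
  obtain ⟨τ, h0, h1, h2⟩ := exists_norm_smul_fderivWithin_le hcompact hu hV hδ
  refine ⟨τ, hV, h0, fun t ht => ?_, fun t ht => h2 t (by rw [abs_of_nonneg ht.1]; exact ht.2)⟩
  have ht' : |t| ≤ τ := by rw [abs_of_nonneg ht.1]; exact ht.2
  have hp : MapsTo (fun x => x + t • V x) Ω Ω := hδm (by simpa using ht'.trans_lt h1)
  have hm : MapsTo (fun x => x - t • V x) Ω Ω := by
    have := hδm (y := -t) (by simpa using ht'.trans_lt h1)
    simpa [sub_eq_add_neg] using this
  exact ⟨hp, injOn_add_smul hconvex hV hu (h2 t ht'),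
    surjOn_add_smul hcompact hconvex hint hV (h2 t ht') hp hm⟩

end StraightFlow

/-! ### Strictly convex potentials of straight gradient flows. -/

section Potential

variable {d : ℕ} {Ω : Set (EuclideanSpace ℝ (Fin d))} {Ψ : EuclideanSpace ℝ (Fin d) → ℝ} {τ : ℝ}

/-- The potential `|x|² / 2 + t Ψ(x)` of the map `x + t ∇Ψ(x)`. -/
noncomputable def flowPotential (Ψ : EuclideanSpace ℝ (Fin d) → ℝ) (t : ℝ)
    (x : EuclideanSpace ℝ (Fin d)) : ℝ :=
  ‖x‖ ^ 2 / 2 + t * Ψ x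

theorem contDiffOn_flowPotential (hΨ : ContDiffOn ℝ ∞ Ψ Ω) (t : ℝ) :
    ContDiffOn ℝ ∞ (flowPotential Ψ t) Ω :=
  ((contDiff_norm_sq ℝ).contDiffOn.div_const 2).add (contDiffOn_const.mul hΨ)

theorem gradientWithin_flowPotential (hu : UniqueDiffOn ℝ Ω) (hΨ : ContDiffOn ℝ ∞ Ψ Ω) (t : ℝ)
    {x : EuclideanSpace ℝ (Fin d)} (hx : x ∈ Ω) :
    gradientWithin (flowPotential Ψ t) Ω x = x + t • gradientWithin Ψ Ω x := by
  refine HasGradientWithinAt.gradientWithin_eq ?_ hu hx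
  rw [hasGradientWithinAt_iff_hasFDerivWithinAt]
  have h1 : HasFDerivAt (fun x : EuclideanSpace ℝ (Fin d) => ‖x‖ ^ 2) (2 • innerSL ℝ x) x :=
    (hasStrictFDerivAt_norm_sq x).hasFDerivAt
  have h2 := (h1.const_mul (1 / 2 : ℝ)).hasFDerivWithinAt.add
    ((hΨ.hasFDerivWithinAt_inner hx).const_mul t)
  have h3 : flowPotential Ψ t = (fun y => 1 / 2 * ‖y‖ ^ 2) + fun y => t * Ψ y := by
    funext z
    simp only [flowPotential, Pi.add_apply]
    ring
  rw [h3]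
  refine h2.congr_fderiv ?_
  ext v
  simp

/-- Along a segment the derivative is strictly increasing: between parameters `s < r` the identity
contributes `(r - s)‖y - x‖²`, and the `1/2`-Lipschitz perturbation can cancel at most half of it.
-/
theorem strictConvexOn_flowPotential (hconvex : Convex ℝ Ω) (hu : UniqueDiffOn ℝ Ω)
    (hΨ : ContDiffOn ℝ ∞ Ψ Ω) {t : ℝ}
    (h : ∀ x ∈ Ω, ‖t • fderivWithin ℝ (gradientWithin Ψ Ω) Ω x‖ ≤ 1 / 2) :
    StrictConvexOn ℝ Ω (flowPotential Ψ t) := by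
  refine ⟨hconvex, fun x hx y hy hxy a b ha hb hab => ?_⟩
  have hΦ := contDiffOn_flowPotential hΨ t
  set g := fun s : ℝ => flowPotential Ψ t (x + s • (y - x)) with hg
  have hgd := fun {s : ℝ} (hs : s ∈ Icc (0 : ℝ) 1) => hasDerivWithinAt_segment hconvex hΦ hx hy hs
  have hgm : StrictMonoOn (deriv g) (interior (Icc (0 : ℝ) 1)) := by
    rw [interior_Icc]
    have hderiv : ∀ s ∈ Ioo (0 : ℝ) 1, deriv g s =
        inner ℝ (x + s • (y - x) + t • gradientWithin Ψ Ω (x + s • (y - x))) (y - x) := by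
      intro s hs
      rw [← gradientWithin_flowPotential hu hΨ t
        (hconvex.add_smul_sub_mem hx hy (Ioo_subset_Icc_self hs))]
      exact ((hgd (Ioo_subset_Icc_self hs)).hasDerivAt (Icc_mem_nhds hs.1 hs.2)).deriv
    intro s hs r hr hsr
    rw [hderiv s hs, hderiv r hr, ← sub_pos, ← inner_sub_left]
    set z := x + s • (y - x) with hz
    set w := x + r • (y - x) with hw
    have h1 := norm_smul_sub_le_of_fderivWithin_le hconvex (hΨ.gradientWithin hu) hu h
      (hconvex.add_smul_sub_mem hx hy (Ioo_subset_Icc_self hr))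
      (hconvex.add_smul_sub_mem hx hy (Ioo_subset_Icc_self hs))
    rw [← hz, ← hw] at h1
    have hwz : w - z = (r - s) • (y - x) := by simp only [hz, hw]; module
    have hpos : 0 < ‖y - x‖ := norm_pos_iff.2 (sub_ne_zero.2 hxy.symm)
    have hrs : 0 < r - s := sub_pos.2 hsr
    have h2 : w + t • gradientWithin Ψ Ω w - (z + t • gradientWithin Ψ Ω z) =
        (r - s) • (y - x) + (t • gradientWithin Ψ Ω w - t • gradientWithin Ψ Ω z) := by
      rw [← hwz]
      abel
    rw [h2, inner_add_left, real_inner_smul_left, real_inner_self_eq_norm_sq]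
    have h3 := (abs_le.1 (abs_real_inner_le_norm
      (t • gradientWithin Ψ Ω w - t • gradientWithin Ψ Ω z) (y - x))).1
    rw [hwz, norm_smul, Real.norm_of_nonneg hrs.le] at h1
    have h4 := mul_le_mul_of_nonneg_right h1 hpos.le
    have h5 : 0 < (r - s) * ‖y - x‖ ^ 2 := by positivity
    nlinarith
  have hgc : StrictConvexOn ℝ (Icc 0 1) g := by
    refine StrictMonoOn.strictConvexOn_of_deriv (convex_Icc 0 1) (fun s hs => ?_) hgm
    exact (hgd hs).continuousWithinAt
  have h6 := hgc.2 (left_mem_Icc.2 zero_le_one) (right_mem_Icc.2 zero_le_one) zero_ne_one ha hb hab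
  simp only [hg, smul_eq_mul, mul_zero, zero_add, mul_one, zero_smul, add_zero, one_smul,
    add_sub_cancel] at h6
  have h7 : a • x + b • y = x + b • (y - x) := by
    rw [← eq_sub_iff_add_eq] at hab
    rw [hab]
    module
  rw [h7]
  exact h6

theorem IsStraightFlow.isTransportPotential (hcompact : IsCompact Ω) (hconvex : Convex ℝ Ω)
    (hint : (interior Ω).Nonempty) (hΨ : ContDiffOn ℝ ∞ Ψ Ω)
    (h : IsStraightFlow Ω (gradientWithin Ψ Ω) τ) {t : ℝ} (ht : t ∈ Icc 0 τ)
    {q r : SmoothDensity Ω} (hr : IsPushforward (fun x => x + t • gradientWithin Ψ Ω x) q r) :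
    IsTransportPotential q r (flowPotential Ψ t) where
  smooth := contDiffOn_flowPotential hΨ t
  strictConvex := strictConvexOn_flowPotential hconvex (uniqueDiffOn_convex hconvex hint) hΨ
    (h.norm_le t ht)
  pushforward := hr.congr hcompact.measurableSet fun _ hx =>
    (gradientWithin_flowPotential (uniqueDiffOn_convex hconvex hint) hΨ t hx).symm

end Potential

/-! ### The weak continuity equation and derivatives along flows. -/

section WeakContinuityEquation

variable {d : ℕ} {Ω : Set (EuclideanSpace ℝ (Fin d))}
  {V : EuclideanSpace ℝ (Fin d) → EuclideanSpace ℝ (Fin d)} {τ : ℝ}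

/-- The weak form of the continuity equation along the push-forwards of `q` under `x + t V(x)`. -/
theorem IsStraightFlow.setIntegral_mul_deriv_curve (h : IsStraightFlow Ω V τ)
    (hcompact : IsCompact Ω) (hconvex : Convex ℝ Ω) (hu : UniqueDiffOn ℝ Ω) (q : SmoothDensity Ω)
    {ψ : EuclideanSpace ℝ (Fin d) → ℝ} (hψ : ContDiffOn ℝ ∞ ψ Ω) {t : ℝ} (ht : t ∈ Icc 0 τ)
    {c' : EuclideanSpace ℝ (Fin d) → ℝ} (hc' : ∀ x ∈ Ω,
      HasDerivWithinAt (fun s => h.curve hcompact hu q s x) (c' x) (Icc 0 τ) t) :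
    ∫ x in Ω, ψ x * c' x = ∫ x in Ω, inner ℝ (gradientWithin ψ Ω (x + t • V x)) (V x) * q x := by
  have hm : MapsTo (fun z : ℝ × EuclideanSpace ℝ (Fin d) => z.2 + z.1 • V z.2) (Icc 0 τ ×ˢ Ω) Ω :=
    fun z hz => (h.bijOn z.1 hz.1).mapsTo hz.2
  have hq : ContDiffOn ℝ ∞ (fun z : ℝ × EuclideanSpace ℝ (Fin d) => q z.2) (Icc 0 τ ×ˢ Ω) :=
    q.smooth.comp contDiffOn_snd fun z hz => hz.2
  have hψ2 : ContDiffOn ℝ ∞ (fun z : ℝ × EuclideanSpace ℝ (Fin d) => ψ z.2) (Icc 0 τ ×ˢ Ω) :=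
    hψ.comp contDiffOn_snd fun z hz => hz.2
  -- By the push-forward relation, `h1` and `h2` differentiate the same function of time, written
  -- once with the moving density and once with the moving point.
  have h1 := hasDerivWithinAt_setIntegral_of_contDiffOn (μ := volume) hcompact hconvex hu h.pos ht
    (g := fun s x => ψ x * h.curve hcompact hu q s x) (g' := fun x => ψ x * c' x)
    (hψ2.mul (h.isSmoothCurve hcompact hu q).2) fun x hx => (hc' x hx).const_mul (ψ x)
  have h2 := hasDerivWithinAt_setIntegral_of_contDiffOn (μ := volume) hcompact hconvex hu h.pos ht
    (g := fun s x => ψ (x + s • V x) * q x)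
    (g' := fun x => inner ℝ (gradientWithin ψ Ω (x + t • V x)) (V x) * q x)
    ((hψ.comp h.contDiffOn_flow hm).mul hq) fun x hx => ?_
  · refine (uniqueDiffOn_Icc h.pos t ht).eq_deriv _ h1 (h2.congr (fun s hs => ?_) ?_)
    all_goals
      refine (h.isPushforward hcompact hu q (by assumption)).integral_eq hcompact.measurableSet ?_
        hψ.continuousOn
      have := h.smooth.continuousOn
      fun_prop
  · have h3 : HasDerivWithinAt (fun s : ℝ => x + s • V x) (V x) (Icc 0 τ) t := by
      simpa using (((hasDerivAt_id t).smul_const (V x)).const_add x).hasDerivWithinAt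
    have h4 := (hψ.hasFDerivWithinAt_inner ((h.bijOn t ht).mapsTo hx)).comp_hasDerivWithinAt t h3
      (fun s hs => (h.bijOn s hs).mapsTo hx)
    exact h4.mul_const (q x)

/-- The derivative of a functional along the push-forwards of `q` under `x + t V(x)`. -/
theorem IsFirstVariation.hasDerivWithinAt_flow {F : SmoothDensity Ω → ℝ} {q : SmoothDensity Ω}
    {φ : EuclideanSpace ℝ (Fin d) → ℝ} (hφ : IsFirstVariation F q φ) (h : IsStraightFlow Ω V τ)
    (hcompact : IsCompact Ω) (hconvex : Convex ℝ Ω) (hint : (interior Ω).Nonempty) :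
    HasDerivWithinAt (fun t => F (h.curve hcompact (uniqueDiffOn_convex hconvex hint) q t))
      (∫ x in Ω, inner ℝ (gradientWithin φ Ω x) (V x) * q x) (Icc 0 τ) 0 := by
  have hu := uniqueDiffOn_convex hconvex hint
  have h1 := hφ.hasDerivWithinAt hcompact.measurableSet (h.isSmoothCurve hcompact hu q)
    (h.curve_zero hcompact hconvex hint q) fun x hx => h.hasDerivWithinAt_curve hcompact hu q hx
  refine h1.congr_deriv ?_
  rw [h.setIntegral_mul_deriv_curve hcompact hconvex hu q hφ.1 ⟨le_rfl, h.pos.le⟩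
    fun x hx => h.hasDerivWithinAt_curve hcompact hu q hx]
  simp only [zero_smul, add_zero]

end WeakContinuityEquation

/-! ### Displacement convexity, positivity of the divergence and zero distance. -/

section Nonnegativity

variable {d : ℕ} {Ω : Set (EuclideanSpace ℝ (Fin d))}

/-- `Φ(x) - |x|² / 2`, the potential of the displacement `∇Φ - id`. -/
noncomputable def displacementPotential (Φ : EuclideanSpace ℝ (Fin d) → ℝ)
    (x : EuclideanSpace ℝ (Fin d)) : ℝ :=
  Φ x - ‖x‖ ^ 2 / 2

theorem contDiffOn_displacementPotential {Φ : EuclideanSpace ℝ (Fin d) → ℝ}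
    (hΦ : ContDiffOn ℝ ∞ Φ Ω) : ContDiffOn ℝ ∞ (displacementPotential Φ) Ω :=
  hΦ.sub ((contDiff_norm_sq ℝ).contDiffOn.div_const 2)

theorem gradientWithin_displacementPotential (hu : UniqueDiffOn ℝ Ω)
    {Φ : EuclideanSpace ℝ (Fin d) → ℝ} (hΦ : ContDiffOn ℝ ∞ Φ Ω) {x : EuclideanSpace ℝ (Fin d)}
    (hx : x ∈ Ω) : gradientWithin (displacementPotential Φ) Ω x = gradientWithin Φ Ω x - x := by
  have h1 := gradientWithin_flowPotential hu (contDiffOn_displacementPotential hΦ) 1 hx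
  have h2 : flowPotential (displacementPotential Φ) 1 = Φ := by
    funext z
    simp [flowPotential, displacementPotential]
  rw [h2, one_smul] at h1
  rw [h1]
  abel

/-- Turns displacement interpolation into the straight flow of the gradient field `∇Φ - id`. -/
theorem displacementMap_eqOn (hu : UniqueDiffOn ℝ Ω) {Φ : EuclideanSpace ℝ (Fin d) → ℝ}
    (hΦ : ContDiffOn ℝ ∞ Φ Ω) (t : ℝ) :
    EqOn (displacementMap Ω Φ t)
      (fun x => x + t • gradientWithin (displacementPotential Φ) Ω x) Ω := by
  intro x hx
  simp only [displacementMap, gradientWithin_displacementPotential hu hΦ hx]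
  module

theorem IsGeodesicPotential.exists_isStraightFlow (hcompact : IsCompact Ω) (hu : UniqueDiffOn ℝ Ω)
    {q p : SmoothDensity Ω} {Φ : EuclideanSpace ℝ (Fin d) → ℝ} (hΦ : IsGeodesicPotential q p Φ) :
    ∃ τ, τ < 1 ∧ IsStraightFlow Ω (gradientWithin (displacementPotential Φ) Ω) τ :=
  exists_isStraightFlow_of_bijOn hcompact hu
    ((contDiffOn_displacementPotential hΦ.1.smooth).gradientWithin hu) one_pos fun t ht =>
      (hΦ.2 t ht).congr (displacementMap_eqOn hu hΦ.1.smooth t)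

/-- The left side is the derivative at time 0 of `F` along the interpolation, and convexity keeps
`F` below its chord. A flow for short times is enough, as only the derivative at 0 matters. -/
theorem IsDisplacementConvex.setIntegral_le (hcompact : IsCompact Ω) (hconvex : Convex ℝ Ω)
    (hint : (interior Ω).Nonempty) {F : SmoothDensity Ω → ℝ} (hF : IsDisplacementConvex F)
    {q p : SmoothDensity Ω} {Φ φ : EuclideanSpace ℝ (Fin d) → ℝ} (hΦ : IsGeodesicPotential q p Φ)
    (hφ : IsFirstVariation F q φ) :
    ∫ x in Ω, inner ℝ (gradientWithin φ Ω x) (gradientWithin Φ Ω x - x) * q x ≤ F p - F q := by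
  have hu := uniqueDiffOn_convex hconvex hint
  obtain ⟨τ, hτ, h⟩ := hΦ.exists_isStraightFlow hcompact hu
  have h1 := hφ.hasDerivWithinAt_flow h hcompact hconvex hint
  rw [setIntegral_congr_fun hcompact.measurableSet fun x hx => by
    rw [gradientWithin_displacementPotential hu hΦ.1.smooth hx]] at h1
  refine h1.le_of_le_add_mul h.pos fun t ht => ?_
  have h2 := hF q p Φ hΦ t ⟨ht.1, ht.2.trans hτ.le⟩ _ ((h.isPushforward hcompact hu q ht).congr
    hcompact.measurableSet (displacementMap_eqOn hu hΦ.1.smooth t).symm)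
  rw [h.curve_zero hcompact hconvex hint q]
  linarith

theorem transportBregman_nonneg (hcompact : IsCompact Ω) (hconvex : Convex ℝ Ω)
    (hint : (interior Ω).Nonempty) {F : SmoothDensity Ω → ℝ} (hF : IsDisplacementConvex F)
    {q p : SmoothDensity Ω} (hg : HasGeodesic q p) (hv : HasFirstVariation F q) :
    0 ≤ transportBregman F p q := by
  obtain ⟨Φ, hΦ⟩ := hg
  rw [transportBregman_eq hcompact hconvex hint hv.isFirstVariation hΦ.1]
  linarith [hF.setIntegral_le hcompact hconvex hint hΦ hv.isFirstVariation]

/-- An initial piece of a geodesic is again a geodesic: interpolating to time `s` with parameter `t`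
gives the flow at time `ts`. -/
theorem IsStraightFlow.isGeodesicPotential (hcompact : IsCompact Ω) (hconvex : Convex ℝ Ω)
    (hint : (interior Ω).Nonempty) {Ψ : EuclideanSpace ℝ (Fin d) → ℝ} {τ : ℝ}
    (hΨ : ContDiffOn ℝ ∞ Ψ Ω) (h : IsStraightFlow Ω (gradientWithin Ψ Ω) τ) {s : ℝ}
    (hs : s ∈ Icc 0 τ) {q r : SmoothDensity Ω}
    (hr : IsPushforward (fun x => x + s • gradientWithin Ψ Ω x) q r) :
    IsGeodesicPotential q r (flowPotential Ψ s) := by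
  refine ⟨h.isTransportPotential hcompact hconvex hint hΨ hs hr, fun t ht => ?_⟩
  have hts : t * s ∈ Icc 0 τ :=
    ⟨mul_nonneg ht.1 hs.1, (mul_le_of_le_one_left hs.1 ht.2).trans hs.2⟩
  refine (h.bijOn (t * s) hts).congr fun x hx => ?_
  simp only [displacementMap,
    gradientWithin_flowPotential (uniqueDiffOn_convex hconvex hint) hΨ s hx]
  module

/-- The tangent inequality is applied between `q` and the intermediate density `r` at time `τ < 1`:
`τ ∫ (∇φ, ∇Φ - x) q ≤ F(r) - F(q) < τ (F(p) - F(q))`, and division by `τ` preserves strictness. -/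
theorem transportBregman_pos (hcompact : IsCompact Ω) (hconvex : Convex ℝ Ω)
    (hint : (interior Ω).Nonempty) {F : SmoothDensity Ω → ℝ} (hF : IsStrictlyDisplacementConvex F)
    {q p : SmoothDensity Ω} (hg : HasGeodesic q p) (hv : HasFirstVariation F q) (hqp : q ≠ p) :
    0 < transportBregman F p q := by
  have hu := uniqueDiffOn_convex hconvex hint
  obtain ⟨Φ, hΦ⟩ := hg
  obtain ⟨τ, hτ, h⟩ := hΦ.exists_isStraightFlow hcompact hu
  have hΨ := contDiffOn_displacementPotential hΦ.1.smooth
  have hτI : τ ∈ Icc 0 τ := ⟨h.pos.le, le_rfl⟩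
  have hpush := h.isPushforward hcompact hu q hτI
  have h1 := hF.1.setIntegral_le hcompact hconvex hint
    (h.isGeodesicPotential hcompact hconvex hint hΨ hτI hpush) hv.isFirstVariation
  have h2 := hF.2 q p Φ hΦ hqp τ ⟨h.pos, hτ⟩ _
    (hpush.congr hcompact.measurableSet (displacementMap_eqOn hu hΦ.1.smooth τ).symm)
  rw [setIntegral_congr_fun (g := fun x => τ * (inner ℝ
    (gradientWithin (firstVariation F q) Ω x) (gradientWithin Φ Ω x - x) * q x))
    hcompact.measurableSet, integral_const_mul] at h1
  · rw [transportBregman_eq hcompact hconvex hint hv.isFirstVariation hΦ.1]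
    refine pos_of_mul_pos_right (a := τ) ?_ h.pos.le
    nlinarith
  · intro x hx
    simp only [gradientWithin_flowPotential hu hΨ τ hx, add_sub_cancel_left, inner_smul_right,
      gradientWithin_displacementPotential hu hΦ.1.smooth hx]
    ring

theorem isTransportPotential_self (hcompact : IsCompact Ω) (hconvex : Convex ℝ Ω)
    (hint : (interior Ω).Nonempty) (q : SmoothDensity Ω) :
    IsTransportPotential q q (flowPotential (fun _ => 0) 0) where
  smooth := contDiffOn_flowPotential contDiffOn_const 0
  strictConvex := strictConvexOn_flowPotential hconvex (uniqueDiffOn_convex hconvex hint)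
    contDiffOn_const fun x _ => by rw [norm_smul]; simp
  pushforward := IsPushforward.of_ae_id hcompact.measurableSet fun x hx => by
    rw [gradientWithin_flowPotential (uniqueDiffOn_convex hconvex hint) contDiffOn_const 0 hx]
    simp

theorem transportBregman_self (hcompact : IsCompact Ω) (hconvex : Convex ℝ Ω)
    (hint : (interior Ω).Nonempty) {F : SmoothDensity Ω → ℝ} {q : SmoothDensity Ω}
    (hv : HasFirstVariation F q) : transportBregman F q q = 0 := by
  rw [transportBregman_eq hcompact hconvex hint hv.isFirstVariation
    (isTransportPotential_self hcompact hconvex hint q), sub_self,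
    setIntegral_congr_fun (g := fun _ => 0) hcompact.measurableSet]
  · simp
  · intro x hx
    simp [gradientWithin_flowPotential (uniqueDiffOn_convex hconvex hint)
      (contDiffOn_const (c := (0 : ℝ))) 0 hx]

theorem transportDist_self (hcompact : IsCompact Ω) (q : SmoothDensity Ω) :
    transportDist q q = 0 := by
  rw [transportDist, ENNReal.rpow_eq_zero_iff]
  refine Or.inl ⟨?_, by norm_num⟩
  refine le_antisymm ?_ zero_le
  refine (iInf_le _ id).trans ((iInf_le _ ?_).trans ((iInf_le _ ?_).trans ?_))
  · exact ⟨contDiffOn_id, mapsTo_id _, id, contDiffOn_id, mapsTo_id _, fun _ _ => rfl,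
      fun _ _ => rfl⟩
  · exact IsPushforward.of_ae_id hcompact.measurableSet fun _ _ => rfl
  · simp

/-- Weak continuity in the transport cost for Lipschitz test functions. The pointwise bound `a ≤ ε/2
+ a²/(2ε)` takes the place of the Cauchy–Schwarz inequality. -/
theorem abs_setIntegral_sub_le (hcompact : IsCompact Ω) {p q : SmoothDensity Ω}
    {T : EuclideanSpace ℝ (Fin d) → EuclideanSpace ℝ (Fin d)} (hT : ContinuousOn T Ω)
    (hmaps : MapsTo T Ω Ω) (hpush : IsPushforward T q p) {ψ : EuclideanSpace ℝ (Fin d) → ℝ}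
    (hψ : ContinuousOn ψ Ω) {C ε : ℝ} (hε : 0 < ε) (hC : 0 ≤ C)
    (hlip : ∀ x ∈ Ω, ∀ y ∈ Ω, |ψ x - ψ y| ≤ C * ‖x - y‖)
    (hle : ∫ x in Ω, ‖T x - x‖ ^ 2 * q x ≤ ε ^ 2) :
    |(∫ x in Ω, ψ x * p x) - ∫ x in Ω, ψ x * q x| ≤ C * ε := by
  have hI := fun {f : EuclideanSpace ℝ (Fin d) → ℝ} (hf : ContinuousOn f Ω) =>
    hf.integrableOn_compact (μ := volume) hcompact
  have hq := q.continuousOn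
  have hψT : ContinuousOn (fun x => ψ (T x)) Ω := hψ.comp hT hmaps
  rw [hpush.integral_eq hcompact.measurableSet hT hψ, ← integral_sub (hI (by fun_prop))
    (hI (by fun_prop))]
  have hsq : ContinuousOn (fun x => ‖T x - x‖ ^ 2 * q x) Ω :=
    ((hT.sub continuousOn_id).norm.pow 2).mul hq
  calc |∫ x in Ω, (ψ (T x) * q x - ψ x * q x)| ≤ ∫ x in Ω, |ψ (T x) * q x - ψ x * q x| :=
        abs_integral_le_integral_abs
    _ ≤ ∫ x in Ω, C * (ε / 2 * q x + 1 / (2 * ε) * (‖T x - x‖ ^ 2 * q x)) := by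
        refine setIntegral_mono_on (hI ((hψT.mul hq).sub (hψ.mul hq)).abs)
          (hI (continuousOn_const.mul ((continuousOn_const.mul hq).add
            (continuousOn_const.mul hsq)))) hcompact.measurableSet fun x hx => ?_
        rw [← sub_mul, abs_mul, abs_of_nonneg (q.nonneg x)]
        have h1 : ‖T x - x‖ ≤ ε / 2 + 1 / (2 * ε) * ‖T x - x‖ ^ 2 := by
          have := sq_nonneg (‖T x - x‖ - ε)
          field_simp
          nlinarith
        calc |ψ (T x) - ψ x| * q x ≤ C * ‖T x - x‖ * q x := by
              gcongr
              · exact q.nonneg x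
              · exact hlip _ (hmaps hx) _ hx
          _ ≤ C * (ε / 2 + 1 / (2 * ε) * ‖T x - x‖ ^ 2) * q x := by
              gcongr
              exact q.nonneg x
          _ = _ := by ring
    _ = C * (ε / 2 + 1 / (2 * ε) * ∫ x in Ω, ‖T x - x‖ ^ 2 * q x) := by
        rw [integral_const_mul, integral_add ((hI hq).const_mul _)
          ((hI hsq).const_mul _), integral_const_mul, integral_const_mul,
          q.integral_eq_one, mul_one]
    _ ≤ C * (ε / 2 + 1 / (2 * ε) * ε ^ 2) := by gcongr
    _ = C * ε := by
        field_simp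
        ring

/-- There are transport maps of arbitrarily small cost, so `p` and `q` integrate Lipschitz functions
equally; the test function `p - q` gives `∫ (p - q)² = 0`. -/
theorem eq_of_transportDist_eq_zero (hcompact : IsCompact Ω) (hconvex : Convex ℝ Ω)
    (hint : (interior Ω).Nonempty) {p q : SmoothDensity Ω} (h : transportDist p q = 0) :
    p = q := by
  have hu := uniqueDiffOn_convex hconvex hint
  rw [transportDist, ENNReal.rpow_eq_zero_iff] at h
  have h0 := (h.resolve_right fun h => by norm_num at h).1
  have hI := fun {f : EuclideanSpace ℝ (Fin d) → ℝ} (hf : ContinuousOn f Ω) =>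
    hf.integrableOn_compact (μ := volume) hcompact
  have hp := p.continuousOn
  have hq := q.continuousOn
  set ψ := fun x => p x - q x with hψdef
  have hψ : ContDiffOn ℝ ∞ ψ Ω := p.smooth.sub q.smooth
  obtain ⟨C, hC⟩ := hcompact.exists_bound_of_continuousOn
    (hψ.continuousOn_fderivWithin hu (by simp))
  have hlip : ∀ x ∈ Ω, ∀ y ∈ Ω, |ψ x - ψ y| ≤ |C| * ‖x - y‖ := fun x hx y hy =>
    Convex.norm_image_sub_le_of_norm_fderivWithin_le (𝕜 := ℝ) (hψ.differentiableOn (by simp))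
      (fun z hz => (hC z hz).trans (le_abs_self C)) hconvex hy hx
  have key : ∀ ε > 0, |(∫ x in Ω, ψ x * p x) - ∫ x in Ω, ψ x * q x| ≤ |C| * ε := by
    intro ε hε
    have hlt : (⨅ (T : EuclideanSpace ℝ (Fin d) → EuclideanSpace ℝ (Fin d))
        (_ : IsDiffeoOn Ω T) (_ : IsPushforward T q p),
        ∫⁻ x in Ω, ENNReal.ofReal (‖T x - x‖ ^ 2 * q x)) < ENNReal.ofReal (ε ^ 2) := by
      rw [h0]
      exact ENNReal.ofReal_pos.2 (by positivity)
    simp only [iInf_lt_iff] at hlt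
    obtain ⟨T, hT, hpush, hlt⟩ := hlt
    have hTc := hT.1.continuousOn
    refine abs_setIntegral_sub_le hcompact hTc hT.2.1 hpush hψ.continuousOn hε (abs_nonneg C) hlip ?_
    have hsq : ContinuousOn (fun x => ‖T x - x‖ ^ 2 * q x) Ω :=
      ((hTc.sub continuousOn_id).norm.pow 2).mul hq
    rw [← ofReal_integral_eq_lintegral_ofReal (hI hsq)
      (.of_forall fun x => mul_nonneg (sq_nonneg _) (q.nonneg x)),
      ENNReal.ofReal_lt_ofReal_iff (by positivity)] at hlt
    exact hlt.le
  have h1 : (∫ x in Ω, ψ x * p x) - ∫ x in Ω, ψ x * q x = 0 := by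
    rw [← abs_eq_zero]
    refine le_antisymm (le_of_forall_pos_le_add fun ε hε => ?_) (abs_nonneg _)
    refine (key (ε / (|C| + 1)) (by positivity)).trans ?_
    rw [zero_add, ← mul_div_assoc, div_le_iff₀ (by positivity)]
    nlinarith [abs_nonneg C]
  have hψc := hψ.continuousOn
  rw [← integral_sub (hI (by fun_prop)) (hI (by fun_prop))] at h1
  have h2 : ∫ x in Ω, ψ x ^ 2 = 0 := by
    rw [← h1]
    congr 1 with x
    simp only [ψ]
    ring
  rw [integral_eq_zero_iff_of_nonneg (fun x => sq_nonneg _) (hI (hψc.pow 2))] at h2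
  refine SmoothDensity.ext' (eqOn_of_ae_eq_convex hconvex hint ?_ hp hq)
  filter_upwards [h2] with x hx
  have : ψ x = 0 := by simpa using hx
  exact sub_eq_zero.1 this

theorem transportBregman_eq_zero_iff (hcompact : IsCompact Ω) (hconvex : Convex ℝ Ω)
    (hint : (interior Ω).Nonempty) {F : SmoothDensity Ω → ℝ} (hF : IsStrictlyDisplacementConvex F)
    {q p : SmoothDensity Ω} (hg : HasGeodesic q p) (hv : HasFirstVariation F q) :
    transportBregman F p q = 0 ↔ transportDist p q = 0 := by
  constructor
  · intro h
    by_cases hqp : q = p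
    · rw [hqp, transportDist_self hcompact]
    · exact absurd h (transportBregman_pos hcompact hconvex hint hF hg hv hqp).ne'
  · intro h
    rw [eq_of_transportDist_eq_zero hcompact hconvex hint h,
      transportBregman_self hcompact hconvex hint hv]

end Nonnegativity

/-! ### Partial derivatives of jointly smooth functions on products. -/

section PartialDerivatives

variable {E F G : Type*} [NormedAddCommGroup E] [NormedSpace ℝ E] [NormedAddCommGroup F]
  [NormedSpace ℝ F] [NormedAddCommGroup G] [NormedSpace ℝ G] {s : Set E} {t : Set F}
  {f : E → F → G}

theorem ContDiffOn.hasFDerivWithinAt_slice_right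
    (hf : ContDiffOn ℝ ∞ (fun z : E × F => f z.1 z.2) (s ×ˢ t)) {x : E} (hx : x ∈ s) {y : F}
    (hy : y ∈ t) :
    HasFDerivWithinAt (f x) ((fderivWithin ℝ (fun z : E × F => f z.1 z.2) (s ×ˢ t) (x, y)).comp
      (ContinuousLinearMap.inr ℝ E F)) t y := by
  have h1 := (hf.differentiableOn (by simp) (x, y) ⟨hx, hy⟩).hasFDerivWithinAt
  exact h1.comp y (hasFDerivAt_prodMk_right x y).hasFDerivWithinAt
    (fun w hw => mk_mem_prod hx hw)

theorem ContDiffOn.hasFDerivWithinAt_slice_left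
    (hf : ContDiffOn ℝ ∞ (fun z : E × F => f z.1 z.2) (s ×ˢ t)) {x : E} (hx : x ∈ s) {y : F}
    (hy : y ∈ t) :
    HasFDerivWithinAt (fun x => f x y)
      ((fderivWithin ℝ (fun z : E × F => f z.1 z.2) (s ×ˢ t) (x, y)).comp
      (ContinuousLinearMap.inl ℝ E F)) s x := by
  have h1 := (hf.differentiableOn (by simp) (x, y) ⟨hx, hy⟩).hasFDerivWithinAt
  exact h1.comp x (hasFDerivAt_prodMk_left x y).hasFDerivWithinAt
    (fun w hw => mk_mem_prod hw hy)

theorem ContDiffOn.fderivWithin_slice_right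
    (hf : ContDiffOn ℝ ∞ (fun z : E × F => f z.1 z.2) (s ×ˢ t)) (hs : UniqueDiffOn ℝ s)
    (ht : UniqueDiffOn ℝ t) :
    ContDiffOn ℝ ∞ (fun z : E × F => fderivWithin ℝ (f z.1) t z.2) (s ×ˢ t) := by
  have h1 := hf.fderivWithin (hs.prod ht) (m := ∞) (by simp)
  refine (h1.clm_comp (contDiffOn_const (c := ContinuousLinearMap.inr ℝ E F))).congr fun z hz => ?_
  exact (hf.hasFDerivWithinAt_slice_right hz.1 hz.2).fderivWithin (ht z.2 hz.2)

theorem ContDiffOn.fderivWithin_slice_left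
    (hf : ContDiffOn ℝ ∞ (fun z : E × F => f z.1 z.2) (s ×ˢ t)) (hs : UniqueDiffOn ℝ s)
    (ht : UniqueDiffOn ℝ t) :
    ContDiffOn ℝ ∞ (fun z : E × F => fderivWithin ℝ (fun x => f x z.2) s z.1) (s ×ˢ t) := by
  have h1 := hf.fderivWithin (hs.prod ht) (m := ∞) (by simp)
  refine (h1.clm_comp (contDiffOn_const (c := ContinuousLinearMap.inl ℝ E F))).congr fun z hz => ?_
  exact (hf.hasFDerivWithinAt_slice_left hz.1 hz.2).fderivWithin (hs z.1 hz.1)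

theorem ContDiffOn.gradientWithin_slice {F : Type*} [NormedAddCommGroup F] [InnerProductSpace ℝ F]
    [CompleteSpace F] {t : Set F} {f : E → F → ℝ}
    (hf : ContDiffOn ℝ ∞ (fun z : E × F => f z.1 z.2) (s ×ˢ t)) (hs : UniqueDiffOn ℝ s)
    (ht : UniqueDiffOn ℝ t) :
    ContDiffOn ℝ ∞ (fun z : E × F => _root_.gradientWithin (f z.1) t z.2) (s ×ˢ t) :=
  (InnerProductSpace.toDual ℝ F).symm.toContinuousLinearEquiv.contDiff.comp_contDiffOn
    (hf.fderivWithin_slice_right hs ht)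

/-- The derivative along the diagonal is the sum of the partial derivatives. -/
theorem ContDiffOn.hasDerivWithinAt_add_slice {I : Set ℝ} {Ω : Set F} {W : ℝ → F → G}
    (hW : ContDiffOn ℝ ∞ (fun z : ℝ × F => W z.1 z.2) (I ×ˢ Ω)) {a : ℝ} (ha : a ∈ I) {x : F}
    {γ : ℝ → F} {γ' : F} (hγ : HasDerivWithinAt γ γ' I a) (hγ0 : γ a = x) (hm : MapsTo γ I Ω)
    (hI : UniqueDiffOn ℝ I) (hΩ : UniqueDiffOn ℝ Ω) :
    HasDerivWithinAt (fun s => W s (γ s))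
      (derivWithin (fun s => W s x) I a + fderivWithin ℝ (W a) Ω x γ') I a := by
  have hx : x ∈ Ω := hγ0 ▸ hm ha
  have h1 := (hW.differentiableOn (by simp) (a, x) ⟨ha, hx⟩).hasFDerivWithinAt
  have h2 := (hasDerivWithinAt_id a I).prodMk hγ
  rw [← hγ0] at h1
  have h3 := h1.comp_hasDerivWithinAt a h2 (fun s hs => mk_mem_prod hs (hm hs))
  refine h3.congr_deriv ?_
  rw [hγ0, (hW.hasFDerivWithinAt_slice_right ha hx).fderivWithin (hΩ x hx),
    (hW.hasFDerivWithinAt_slice_left ha hx).hasDerivWithinAt.derivWithin (hI a ha)]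
  simp only [ContinuousLinearMap.comp_apply, ContinuousLinearMap.inl_apply,
    ContinuousLinearMap.inr_apply, ← map_add]
  simp

end PartialDerivatives

/-! ### One-sided Taylor expansion of second order. -/

section Taylor

/-- Second order Taylor expansion at the left end of an interval, for a function whose derivative
is differentiable at that point. -/
theorem isLittleO_taylor_two {f g : ℝ → ℝ} {δ H : ℝ} (hδ : 0 < δ)
    (hf : ∀ t ∈ Icc 0 δ, HasDerivWithinAt f (g t) (Icc 0 δ) t)
    (hg : HasDerivWithinAt g H (Icc 0 δ) 0) :
    (fun t => f t - f 0 - t * g 0 - t ^ 2 / 2 * H) =o[𝓝[≥] 0] fun t => t ^ 2 := by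
  rw [Asymptotics.isLittleO_iff]
  intro ε hε
  have h1 := (hasDerivWithinAt_iff_isLittleO.1 hg).def hε
  rw [nhdsWithin_Icc_eq_nhdsGE hδ] at h1
  obtain ⟨η, hη, hη'⟩ := mem_nhdsGE_iff_exists_Icc_subset.1 h1
  have hη0 : 0 < η := hη
  filter_upwards [Icc_mem_nhdsGE (lt_min hδ hη0)] with t ht
  have htδ : t ≤ δ := ht.2.trans (min_le_left _ _)
  have htη : t ≤ η := ht.2.trans (min_le_right _ _)
  have hr : ∀ s ∈ Icc 0 t, HasDerivWithinAt (fun t => f t - f 0 - t * g 0 - t ^ 2 / 2 * H)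
      (g s - g 0 - s * H) (Icc 0 t) s := by
    intro s hs
    have h2 := (hf s ⟨hs.1, hs.2.trans htδ⟩).mono (Icc_subset_Icc_right htδ)
    have h3 := ((h2.sub_const (f 0)).sub ((hasDerivWithinAt_id s _).mul_const (g 0))).sub
      ((((hasDerivWithinAt_id s (Icc 0 t)).pow 2).div_const 2).mul_const H)
    refine h3.congr_deriv ?_
    simp
  -- Differentiability of `g` at 0 bounds the derivative of the remainder by `ε s ≤ ε t`; the mean
  -- value inequality supplies the second factor `t`.
  have hb : ∀ s ∈ Icc 0 t, ‖g s - g 0 - s * H‖ ≤ ε * t := by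
    intro s hs
    have := hη' ⟨hs.1, hs.2.trans htη⟩
    simp only [mem_ofPred_eq, sub_zero, smul_eq_mul, Real.norm_eq_abs] at this
    rw [abs_of_nonneg hs.1] at this
    exact this.trans (by gcongr; exact hs.2)
  have := (convex_Icc 0 t).norm_image_sub_le_of_norm_hasDerivWithin_le hr hb
    (left_mem_Icc.2 ht.1) (right_mem_Icc.2 ht.1)
  simp only [sub_self, zero_mul, sub_zero, ne_eq, OfNat.ofNat_ne_zero, not_false_eq_true, zero_pow,
    zero_div] at this
  refine this.trans (le_of_eq ?_)
  rw [Real.norm_of_nonneg ht.1, Real.norm_of_nonneg (by positivity)]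
  ring

end Taylor

/-! ### Second derivative of a functional along a straight flow. -/

section SecondVariation

variable {d : ℕ} {Ω : Set (EuclideanSpace ℝ (Fin d))}

/-- The derivative of a functional at an interior time of a smooth curve. -/
theorem IsFirstVariation.hasDerivWithinAt_of_mem (hΩ : MeasurableSet Ω) {F : SmoothDensity Ω → ℝ}
    {c : ℝ → SmoothDensity Ω} {τ t : ℝ} (hc : IsSmoothCurve c τ) (ht : t ∈ Ico 0 τ)
    {φ c' : EuclideanSpace ℝ (Fin d) → ℝ} (hφ : IsFirstVariation F (c t) φ)
    (hc' : ∀ x ∈ Ω, HasDerivWithinAt (fun s => c s x) (c' x) (Icc 0 τ) t) :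
    HasDerivWithinAt (fun s => F (c s)) (∫ x in Ω, φ x * c' x) (Icc 0 τ) t := by
  -- First variations only test curves issuing from a density, so the two one-sided derivatives are
  -- found separately: here for the curve restarted at time `t`, below for the reversed curve.
  have hfwd : HasDerivWithinAt (fun s => F (c s)) (∫ x in Ω, φ x * c' x) (Icc t τ) t := by
    have hm : MapsTo (fun s => t + s) (Icc 0 (τ - t)) (Icc 0 τ) := fun s hs =>
      ⟨add_nonneg ht.1 hs.1, by linarith [hs.2]⟩
    have hcurve : IsSmoothCurve (fun s => c (t + s)) (τ - t) :=
      ⟨sub_pos.2 ht.2, hc.2.comp (f := fun z : ℝ × EuclideanSpace ℝ (Fin d) => (t + z.1, z.2))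
        (by fun_prop) fun z hz => ⟨hm hz.1, hz.2⟩⟩
    have h1 := hφ.hasDerivWithinAt hΩ hcurve (c' := c') (by simp) fun x hx => by
      have h2 : HasDerivWithinAt (fun s => c s x) (c' x) (Icc 0 τ) (t + 0) := by
        simpa using hc' x hx
      simpa [Function.comp_def] using h2.comp (0 : ℝ)
        ((hasDerivWithinAt_id (0 : ℝ) _).const_add t) hm
    have h3 : HasDerivWithinAt (fun s => F (c (t + s))) (∫ x in Ω, φ x * c' x)
        (Icc 0 (τ - t)) (t - t) := by rwa [sub_self]
    have h4 := HasDerivWithinAt.comp (h := fun s => s - t) t h3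
      ((hasDerivWithinAt_id t (Icc t τ)).sub_const t)
      fun s hs => ⟨sub_nonneg.2 hs.1, sub_le_sub_right hs.2 t⟩
    simpa [Function.comp_def] using h4
  rcases ht.1.eq_or_lt with rfl | ht0
  · exact hfwd
  have hbwd : HasDerivWithinAt (fun s => F (c s)) (∫ x in Ω, φ x * c' x) (Icc 0 t) t := by
    have hm : MapsTo (fun s => t - s) (Icc 0 t) (Icc 0 τ) := fun s hs =>
      ⟨sub_nonneg.2 hs.2, by linarith [hs.1, ht.2]⟩
    have hcurve : IsSmoothCurve (fun s => c (t - s)) t :=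
      ⟨ht0, hc.2.comp (f := fun z : ℝ × EuclideanSpace ℝ (Fin d) => (t - z.1, z.2))
        (by fun_prop) fun z hz => ⟨hm hz.1, hz.2⟩⟩
    have h1 := hφ.hasDerivWithinAt hΩ hcurve (c' := fun x => -c' x) (by simp) fun x hx => by
      have h2 : HasDerivWithinAt (fun s => c s x) (c' x) (Icc 0 τ) (t - 0) := by
        simpa using hc' x hx
      simpa [Function.comp_def] using h2.comp (0 : ℝ)
        ((hasDerivWithinAt_id (0 : ℝ) _).const_sub t) hm
    have h3 : HasDerivWithinAt (fun s => F (c (t - s))) (∫ x in Ω, φ x * -c' x)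
        (Icc 0 t) (t - t) := by rwa [sub_self]
    have h4 := HasDerivWithinAt.comp (h := fun s => t - s) t h3
      ((hasDerivWithinAt_id t (Icc 0 t)).const_sub t)
      fun s hs => ⟨sub_nonneg.2 hs.2, sub_le_self t hs.1⟩
    simpa [Function.comp_def, integral_neg] using h4
  have := hbwd.union hfwd
  rwa [Icc_union_Icc_eq_Icc ht.1 ht.2.le] at this

variable {V : EuclideanSpace ℝ (Fin d) → EuclideanSpace ℝ (Fin d)} {τ : ℝ}

theorem IsStraightFlow.hasDerivWithinAt_curve_tangent (h : IsStraightFlow Ω V τ)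
    (hcompact : IsCompact Ω) (hu : UniqueDiffOn ℝ Ω) (q : SmoothDensity Ω) {σ : tangentSpaceAt Ω}
    (hσ : ∀ x ∈ Ω, σ.1 x = -divergenceWithin (fun y => q y • V y) Ω x)
    (x : EuclideanSpace ℝ (Fin d)) :
    HasDerivWithinAt (fun t => h.curve hcompact hu q t x) (σ.1 x) (Icc 0 τ) 0 := by
  by_cases hx : x ∈ Ω
  · rw [hσ x hx]
    exact h.hasDerivWithinAt_curve hcompact hu q hx
  · rw [σ.2.2.1 x hx]
    simp only [(h.curve hcompact hu q _).eq_zero x hx]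
    exact hasDerivWithinAt_const _ _ _

/-- Integration by parts against `σ = -∇ · (q V)` for fields `V` whose flow preserves `Ω`. -/
theorem IsStraightFlow.setIntegral_mul_tangent (h : IsStraightFlow Ω V τ)
    (hcompact : IsCompact Ω) (hconvex : Convex ℝ Ω) (hu : UniqueDiffOn ℝ Ω) {q : SmoothDensity Ω}
    {σ : tangentSpaceAt Ω} (hσ : ∀ x ∈ Ω, σ.1 x = -divergenceWithin (fun y => q y • V y) Ω x)
    {ψ : EuclideanSpace ℝ (Fin d) → ℝ} (hψ : ContDiffOn ℝ ∞ ψ Ω) :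
    ∫ x in Ω, ψ x * σ.1 x = ∫ x in Ω, inner ℝ (gradientWithin ψ Ω x) (V x) * q x := by
  rw [h.setIntegral_mul_deriv_curve hcompact hconvex hu q hψ ⟨le_rfl, h.pos.le⟩ fun x _ =>
    h.hasDerivWithinAt_curve_tangent hcompact hu q hσ x]
  simp only [zero_smul, add_zero]

/-- The derivative of `∫ (∇φ_t(x + t V(x)), V(x)) q(x) dx` at `t = 0`. -/
theorem IsStraightFlow.hasDerivWithinAt_pairing (h : IsStraightFlow Ω V τ)
    (hcompact : IsCompact Ω) (hconvex : Convex ℝ Ω) (hint : (interior Ω).Nonempty)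
    {q : SmoothDensity Ω}
    {σ : tangentSpaceAt Ω} (hσ : ∀ x ∈ Ω, σ.1 x = -divergenceWithin (fun y => q y • V y) Ω x)
    {φ : ℝ → EuclideanSpace ℝ (Fin d) → ℝ} {δ b : ℝ} (hδ : 0 < δ) (hδτ : δ ≤ τ)
    (hφ : ContDiffOn ℝ ∞ (fun z : ℝ × EuclideanSpace ℝ (Fin d) => φ z.1 z.2) (Icc 0 δ ×ˢ Ω))
    (hb : HasDerivWithinAt (fun t => ∫ x in Ω, φ t x * σ.1 x) b (Icc 0 δ) 0) :
    HasDerivWithinAt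
      (fun t => ∫ x in Ω, inner ℝ (gradientWithin (φ t) Ω (x + t • V x)) (V x) * q x)
      (b + ∫ x in Ω, inner ℝ (fderivWithin ℝ (gradientWithin (φ 0) Ω) Ω x (V x)) (V x) * q x)
      (Icc 0 δ) 0 := by
  have hu := uniqueDiffOn_convex hconvex hint
  have huI := uniqueDiffOn_Icc hδ
  have hI0 : (0 : ℝ) ∈ Icc 0 δ := ⟨le_rfl, hδ.le⟩
  have hW : ContDiffOn ℝ ∞ (fun z : ℝ × EuclideanSpace ℝ (Fin d) =>
      gradientWithin (φ z.1) Ω z.2) (Icc 0 δ ×ˢ Ω) := hφ.gradientWithin_slice huI hu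
  have hV : ContDiffOn ℝ ∞ (fun z : ℝ × EuclideanSpace ℝ (Fin d) => V z.2) (Icc 0 δ ×ˢ Ω) :=
    h.smooth.comp contDiffOn_snd fun z hz => hz.2
  have hq : ContDiffOn ℝ ∞ (fun z : ℝ × EuclideanSpace ℝ (Fin d) => q z.2) (Icc 0 δ ×ˢ Ω) :=
    q.smooth.comp contDiffOn_snd fun z hz => hz.2
  have hbij : ∀ t ∈ Icc 0 δ, MapsTo (fun x => x + t • V x) Ω Ω := fun t ht =>
    (h.bijOn t ⟨ht.1, ht.2.trans hδτ⟩).mapsTo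
  set w := fun x => derivWithin (fun s => gradientWithin (φ s) Ω x) (Icc 0 δ) 0 with hw
  have hw' : ∀ x ∈ Ω, HasDerivWithinAt (fun s => gradientWithin (φ s) Ω x) (w x) (Icc 0 δ) 0 :=
    fun x hx => ((hW.slice_left (g := fun s x => gradientWithin (φ s) Ω x) hx).differentiableOn
      (by simp) 0 hI0).hasDerivWithinAt
  have h1 := hasDerivWithinAt_setIntegral_of_contDiffOn (μ := volume) hcompact hconvex hu hδ hI0
    (g := fun s x => inner ℝ (gradientWithin (φ s) Ω x) (V x) * q x)
    (g' := fun x => inner ℝ (w x) (V x) * q x) ((hW.inner ℝ hV).mul hq) fun x hx => by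
      have := ((hw' x hx).inner ℝ (hasDerivWithinAt_const (0 : ℝ) (Icc 0 δ) (V x))).mul_const (q x)
      simpa using this
  -- With `σ` fixed in time, integration by parts rewrites `∫ φ_t σ` as `∫ (∇φ_t, V) q`; comparing
  -- derivatives expresses the second variation by `∂ₜ∇φ_t`.
  have h2 : b = ∫ x in Ω, inner ℝ (w x) (V x) * q x := by
    refine (huI 0 hI0).eq_deriv _ hb (h1.congr (fun t ht => ?_) ?_)
    · exact h.setIntegral_mul_tangent hcompact hconvex hu hσ (hφ.slice_right ht)
    · exact h.setIntegral_mul_tangent hcompact hconvex hu hσ (hφ.slice_right hI0)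
  have hflow : ContDiffOn ℝ ∞ (fun z : ℝ × EuclideanSpace ℝ (Fin d) => (z.1, z.2 + z.1 • V z.2))
      (Icc 0 δ ×ˢ Ω) := contDiffOn_fst.prodMk (contDiffOn_snd.add (contDiffOn_fst.smul hV))
  -- The chain rule along `(s, x + sV)` produces the time derivative `w` and the spatial derivative
  -- of `∇φ₀` in direction `V`.
  have h3 := hasDerivWithinAt_setIntegral_of_contDiffOn (μ := volume) hcompact hconvex hu hδ hI0
    (g := fun s x => inner ℝ (gradientWithin (φ s) Ω (x + s • V x)) (V x) * q x)
    (g' := fun x => inner ℝ (w x) (V x) * q x +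
      inner ℝ (fderivWithin ℝ (gradientWithin (φ 0) Ω) Ω x (V x)) (V x) * q x)
    (((hW.comp hflow fun z hz => ⟨hz.1, hbij z.1 hz.1 hz.2⟩).inner ℝ hV).mul hq) fun x hx => by
      have hγ : HasDerivWithinAt (fun s : ℝ => x + s • V x) (V x) (Icc 0 δ) 0 := by
        simpa using (((hasDerivAt_id (0 : ℝ)).smul_const (V x)).const_add x).hasDerivWithinAt
      have h4 := hW.hasDerivWithinAt_add_slice (W := fun s x => gradientWithin (φ s) Ω x) hI0 hγ
        (x := x) (by simp) (fun s hs => hbij s hs hx) huI hu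
      have := (h4.inner ℝ (hasDerivWithinAt_const (0 : ℝ) (Icc 0 δ) (V x))).mul_const (q x)
      refine this.congr_deriv ?_
      simp only [inner_zero_right, zero_add, inner_add_left, add_mul]
      rfl
  refine h3.congr_deriv ?_
  rw [h2]
  have hVc := h.smooth.continuousOn
  have hqc := q.continuousOn
  refine integral_add ?_ ?_
  · have hwc : ContinuousOn w Ω := by
      have h5 := (hW.fderivWithin_slice_left
        (f := fun s x => gradientWithin (φ s) Ω x) huI hu).slice_right
        (g := fun t x => fderivWithin ℝ (fun s => gradientWithin (φ s) Ω x) (Icc 0 δ) t) hI0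
      exact h5.continuousOn.clm_apply continuousOn_const
    exact ContinuousOn.integrableOn_compact hcompact (by fun_prop)
  · have h6 : ContinuousOn (fderivWithin ℝ (gradientWithin (φ 0) Ω) Ω) Ω :=
      ((hφ.slice_right hI0).gradientWithin hu).continuousOn_fderivWithin hu (by simp)
    exact ContinuousOn.integrableOn_compact hcompact
      (((h6.clm_apply hVc).inner hVc).mul hqc)

theorem HasSecondVariation.isSecondVariation {F : SmoothDensity Ω → ℝ} {q : SmoothDensity Ω}
    (h : HasSecondVariation F q) : IsSecondVariation F q (secondVariation F q) := by
  rw [secondVariation, dif_pos h]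
  exact h.choose_spec

theorem IsFirstVariation.hessianLocalTerm_eq (hcompact : IsCompact Ω) (hconvex : Convex ℝ Ω)
    (hint : (interior Ω).Nonempty) {F : SmoothDensity Ω → ℝ} {q : SmoothDensity Ω}
    {φ Φ : EuclideanSpace ℝ (Fin d) → ℝ} (hφ : IsFirstVariation F q φ) :
    hessianLocalTerm F q Φ = ∫ x in Ω, inner ℝ (fderivWithin ℝ (gradientWithin φ Ω) Ω x
      (gradientWithin Φ Ω x)) (gradientWithin Φ Ω x) * q x := by
  have h1 := (HasFirstVariation.isFirstVariation ⟨φ, hφ⟩).gradientWithin_eqOn hcompact hconvex hint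
    hφ
  refine setIntegral_congr_fun hcompact.measurableSet fun x hx => ?_
  simp only [fderivWithin_congr h1 (h1 hx)]

/-- The one-sided second order expansion of the transport Bregman divergence. -/
theorem IsStraightFlow.isLittleO_transportBregman {Ψ : EuclideanSpace ℝ (Fin d) → ℝ}
    (hΨ : ContDiffOn ℝ ∞ Ψ Ω) (h : IsStraightFlow Ω (gradientWithin Ψ Ω) τ)
    (hcompact : IsCompact Ω) (hconvex : Convex ℝ Ω) (hint : (interior Ω).Nonempty)
    {F : SmoothDensity Ω → ℝ} {q : SmoothDensity Ω} (hF : HasSecondVariation F q)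
    {σ : tangentSpaceAt Ω}
    (hσ : ∀ x ∈ Ω, σ.1 x = -divergenceWithin (fun y => q y • gradientWithin Ψ Ω y) Ω x)
    {c : ℝ → SmoothDensity Ω}
    (hc : ∀ᶠ t in 𝓝[≥] (0 : ℝ), IsPushforward (fun x => x + t • gradientWithin Ψ Ω x) q (c t)) :
    (fun t => transportBregman F (c t) q - t ^ 2 / 2 * transportHessian F q σ Ψ)
      =o[𝓝[≥] 0] fun t => t ^ 2 := by
  have hu := uniqueDiffOn_convex hconvex hint
  set C := h.curve hcompact hu q with hC
  have hCs : IsSmoothCurve C τ := h.isSmoothCurve hcompact hu q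
  have hC0 : C 0 = q := h.curve_zero hcompact hconvex hint q
  obtain ⟨δ, φ, hδ, hδτ, hφs, hφ, hB⟩ := hF.isSecondVariation C τ hCs hC0
  have hI0 : (0 : ℝ) ∈ Icc 0 δ := ⟨le_rfl, hδ.le⟩
  have hφ0 : IsFirstVariation F q (φ 0) := hC0 ▸ hφ 0 hI0
  have h1 := h.hasDerivWithinAt_pairing hcompact hconvex hint hσ hδ hδτ hφs
    (hB σ σ (h.hasDerivWithinAt_curve_tangent hcompact hu q hσ))
  rw [← hφ0.hessianLocalTerm_eq hcompact hconvex hint] at h1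
  -- Halving keeps the times strictly below `τ`, where forward curves still exist.
  have hδ2 : 0 < δ / 2 := half_pos hδ
  have hsub : Icc 0 (δ / 2) ⊆ Icc 0 δ := Icc_subset_Icc_right (by linarith)
  have h2 : ∀ t ∈ Icc 0 (δ / 2), HasDerivWithinAt (fun t => F (C t))
      (∫ x in Ω, inner ℝ (gradientWithin (φ t) Ω (x + t • gradientWithin Ψ Ω x))
        (gradientWithin Ψ Ω x) * q x) (Icc 0 (δ / 2)) t := by
    intro t ht
    have htτ : t ∈ Ico 0 τ := ⟨ht.1, by linarith [ht.2]⟩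
    have hd : ∀ x ∈ Ω, HasDerivWithinAt (fun s => C s x)
        (derivWithin (fun s => C s x) (Icc 0 τ) t) (Icc 0 τ) t := fun x hx =>
      ((hCs.2.slice_left (g := fun s x => C s x) hx).differentiableOn (by simp) t
        (Ico_subset_Icc_self htτ)).hasDerivWithinAt
    have h3 := (hφ t (hsub ht)).hasDerivWithinAt_of_mem hcompact.measurableSet hCs htτ hd
    rw [h.setIntegral_mul_deriv_curve hcompact hconvex hu q (hφ t (hsub ht)).1
      (Ico_subset_Icc_self htτ) hd] at h3
    exact h3.mono (hsub.trans (Icc_subset_Icc_right hδτ))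
  have h4 := isLittleO_taylor_two hδ2 h2 (h1.mono hsub)
  refine h4.congr' ?_ EventuallyEq.rfl
  filter_upwards [hc, Icc_mem_nhdsGE h.pos] with t htc ht
  have h5 : C t = c t :=
    IsPushforward.unique hcompact hconvex hint (h.isPushforward hcompact hu q ht) htc
  have h6 : ∫ x in Ω, inner ℝ (gradientWithin (φ 0) Ω x)
      (gradientWithin (flowPotential Ψ t) Ω x - x) * q x =
      t * ∫ x in Ω, inner ℝ (gradientWithin (φ 0) Ω x) (gradientWithin Ψ Ω x) * q x := by
    rw [← integral_const_mul]
    refine setIntegral_congr_fun hcompact.measurableSet fun x hx => ?_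
    simp only [gradientWithin_flowPotential hu hΨ t hx, add_sub_cancel_left, inner_smul_right,
      mul_assoc]
  rw [transportBregman_eq hcompact hconvex hint hφ0
    (h.isTransportPotential hcompact hconvex hint hΨ ht htc), h6, h5, hC0, transportHessian]
  simp only [zero_smul, add_zero]

end SecondVariation

/-! ### Two-sided expansion and smooth kernels. -/

section TransportHessian

variable {d : ℕ} {Ω : Set (EuclideanSpace ℝ (Fin d))}

/-- Closedness gives the identity at all points: off the closure of Ω the derivative within Ω is
zero by convention. -/
theorem gradientWithin_neg (hΩ : IsClosed Ω) (hu : UniqueDiffOn ℝ Ω)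
    (Φ : EuclideanSpace ℝ (Fin d) → ℝ) :
    gradientWithin (fun x => -Φ x) Ω = fun x => -gradientWithin Φ Ω x := by
  funext x
  simp only [gradientWithin]
  rw [← map_neg]
  congr 1
  by_cases hx : x ∈ Ω
  · exact fderivWithin_fun_neg (hu x hx)
  · rw [← hΩ.closure_eq] at hx
    rw [fderivWithin_zero_of_notMem_closure hx, fderivWithin_zero_of_notMem_closure hx, neg_zero]

theorem IsTangentPotential.neg (hΩ : IsClosed Ω) (hu : UniqueDiffOn ℝ Ω) {q : SmoothDensity Ω} {σ : tangentSpaceAt Ω}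
    {Φ : EuclideanSpace ℝ (Fin d) → ℝ} (h : IsTangentPotential q σ Φ) :
    IsTangentPotential q (-σ) (fun x => -Φ x) := by
  refine ⟨h.1.neg, fun x hx => ?_⟩
  have h1 : (fun y => q y • gradientWithin (fun x => -Φ x) Ω y) =
      fun y => -(q y • gradientWithin Φ Ω y) := by
    funext y
    rw [gradientWithin_neg hΩ hu, smul_neg]
  have h2 : (-σ).1 x = -σ.1 x := rfl
  rw [h2, h.2 x hx, h1, divergenceWithin, divergenceWithin,
    show fderivWithin ℝ (fun y => -(q y • gradientWithin Φ Ω y)) Ω x = _ from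
      fderivWithin_fun_neg (hu x hx),
    ContinuousLinearMap.toLinearMap_neg, map_neg]

theorem transportHessian_neg (hΩ : IsClosed Ω) (hu : UniqueDiffOn ℝ Ω) (F : SmoothDensity Ω → ℝ) (q : SmoothDensity Ω)
    (σ : tangentSpaceAt Ω) (Φ : EuclideanSpace ℝ (Fin d) → ℝ) :
    transportHessian F q (-σ) (fun x => -Φ x) = transportHessian F q σ Φ := by
  simp only [transportHessian, hessianLocalTerm, gradientWithin_neg hΩ hu, map_neg, LinearMap.neg_apply,
    neg_neg, inner_neg_neg]

/-- The push-forwards of `q` under `x + ε ∇Φ(x)`, for `ε` near `0`, are smooth densities, and they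
have transport coordinates. -/
theorem eventually_exists_isPushforward (hcompact : IsCompact Ω) (hconvex : Convex ℝ Ω)
    (hint : (interior Ω).Nonempty) (q : SmoothDensity Ω) {Φ : EuclideanSpace ℝ (Fin d) → ℝ}
    (hΦ : ContDiffOn ℝ ∞ Φ Ω)
    (hmaps : ∀ᶠ ε : ℝ in 𝓝 0, MapsTo (fun x => x + ε • gradientWithin Φ Ω x) Ω Ω) :
    ∀ᶠ ε : ℝ in 𝓝 0, ∃ r : SmoothDensity Ω,
      IsPushforward (fun x => x + ε • gradientWithin Φ Ω x) q r ∧ HasTransportPotential q r := by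
  have hu := uniqueDiffOn_convex hconvex hint
  have key : ∀ {Ψ : EuclideanSpace ℝ (Fin d) → ℝ}, ContDiffOn ℝ ∞ Ψ Ω →
      (∀ᶠ ε : ℝ in 𝓝 0, MapsTo (fun x => x + ε • gradientWithin Ψ Ω x) Ω Ω) →
      ∀ᶠ ε : ℝ in 𝓝[≥] 0, ∃ r : SmoothDensity Ω,
        IsPushforward (fun x => x + ε • gradientWithin Ψ Ω x) q r ∧ HasTransportPotential q r := by
    intro Ψ hΨ hm
    obtain ⟨τ, h⟩ := exists_isStraightFlow_of_mapsTo hcompact hconvex hint (hΨ.gradientWithin hu) hm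
    filter_upwards [Icc_mem_nhdsGE h.pos] with t ht
    have hr := h.isPushforward hcompact hu q ht
    exact ⟨_, hr, _, h.isTransportPotential hcompact hconvex hint hΨ ht hr⟩
  have hneg : Tendsto (fun ε : ℝ => -ε) (𝓝 0) (𝓝 0) := by
    simpa using (continuous_neg (G := ℝ)).tendsto 0
  have hneg' : Tendsto (fun ε : ℝ => -ε) (𝓝[≤] 0) (𝓝[≥] 0) :=
    tendsto_nhdsWithin_of_tendsto_nhds_of_eventually_within _ (hneg.mono_left nhdsWithin_le_nhds)
      (by filter_upwards [self_mem_nhdsWithin] with t ht using neg_nonneg.2 (mem_Iic.1 ht))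
  rw [← nhdsLE_sup_nhdsGE, eventually_sup]
  refine ⟨?_, key hΦ hmaps⟩
  -- Negative ε for Φ is positive ε for `-Φ`.
  have h1 := key hΦ.neg (by
    simp only [gradientWithin_neg hcompact.isClosed hu, smul_neg, ← neg_smul]
    exact hneg.eventually hmaps)
  simp only [gradientWithin_neg hcompact.isClosed hu, smul_neg, ← neg_smul] at h1
  simpa using hneg'.eventually h1

/-- The second order expansion of the transport Bregman divergence. -/
theorem isLittleO_transportBregman (hcompact : IsCompact Ω) (hconvex : Convex ℝ Ω)
    (hint : (interior Ω).Nonempty) {F : SmoothDensity Ω → ℝ} {q : SmoothDensity Ω}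
    (hF : HasSecondVariation F q) {σ : tangentSpaceAt Ω} {Φ : EuclideanSpace ℝ (Fin d) → ℝ}
    (hΦ : IsTangentPotential q σ Φ)
    (hmaps : ∀ᶠ ε : ℝ in 𝓝 0, MapsTo (fun x => x + ε • gradientWithin Φ Ω x) Ω Ω)
    {c : ℝ → SmoothDensity Ω}
    (hc : ∀ᶠ ε : ℝ in 𝓝 0, IsPushforward (fun x => x + ε • gradientWithin Φ Ω x) q (c ε)) :
    (fun ε : ℝ => transportBregman F (c ε) q - ε ^ 2 / 2 * transportHessian F q σ Φ)
      =o[𝓝 0] (fun ε : ℝ => ε ^ 2) := by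
  have hu := uniqueDiffOn_convex hconvex hint
  have key : ∀ {Ψ : EuclideanSpace ℝ (Fin d) → ℝ} {η : tangentSpaceAt Ω} {b : ℝ → SmoothDensity Ω},
      IsTangentPotential q η Ψ →
      (∀ᶠ ε : ℝ in 𝓝 0, MapsTo (fun x => x + ε • gradientWithin Ψ Ω x) Ω Ω) →
      (∀ᶠ ε : ℝ in 𝓝 0, IsPushforward (fun x => x + ε • gradientWithin Ψ Ω x) q (b ε)) →
      (fun ε : ℝ => transportBregman F (b ε) q - ε ^ 2 / 2 * transportHessian F q η Ψ)
        =o[𝓝[≥] 0] (fun ε : ℝ => ε ^ 2) := by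
    intro Ψ η b hΨ hm hb
    obtain ⟨τ, h⟩ := exists_isStraightFlow_of_mapsTo hcompact hconvex hint
      (hΨ.1.gradientWithin hu) hm
    exact h.isLittleO_transportBregman hΨ.1 hcompact hconvex hint hF hΨ.2
      (hb.filter_mono nhdsWithin_le_nhds)
  have hneg : Tendsto (fun ε : ℝ => -ε) (𝓝 0) (𝓝 0) := by
    simpa using (continuous_neg (G := ℝ)).tendsto 0
  have hneg' : Tendsto (fun ε : ℝ => -ε) (𝓝[≤] 0) (𝓝[≥] 0) :=
    tendsto_nhdsWithin_of_tendsto_nhds_of_eventually_within _ (hneg.mono_left nhdsWithin_le_nhds)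
      (by filter_upwards [self_mem_nhdsWithin] with t ht using neg_nonneg.2 (mem_Iic.1 ht))
  rw [← nhdsLE_sup_nhdsGE]
  refine Asymptotics.IsLittleO.sup ?_ (key hΦ hmaps hc)
  -- The pair `(-σ, -Φ)` has the same Hessian, which is quadratic, so the expansion for negative ε
  -- is the reflected one.
  have h1 := key (b := fun ε => c (-ε)) (hΦ.neg hcompact.isClosed hu) (by
    simp only [gradientWithin_neg hcompact.isClosed hu, smul_neg, ← neg_smul]
    exact hneg.eventually hmaps) (by
    simp only [gradientWithin_neg hcompact.isClosed hu, smul_neg, ← neg_smul]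
    exact hneg.eventually hc)
  rw [transportHessian_neg hcompact.isClosed hu] at h1
  have h2 := h1.comp_tendsto hneg'
  simpa [Function.comp_def] using h2

/-- Two second variations of the same functional agree on tangent vectors that are realized by a
flow. -/
theorem IsSecondVariation.apply_self_eq (hcompact : IsCompact Ω) (hconvex : Convex ℝ Ω)
    (hint : (interior Ω).Nonempty) {F : SmoothDensity Ω → ℝ} {q : SmoothDensity Ω}
    {B₁ B₂ : LinearMap.BilinForm ℝ (tangentSpaceAt Ω)} (h₁ : IsSecondVariation F q B₁)
    (h₂ : IsSecondVariation F q B₂)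
    {V : EuclideanSpace ℝ (Fin d) → EuclideanSpace ℝ (Fin d)} {τ : ℝ} (h : IsStraightFlow Ω V τ)
    {σ : tangentSpaceAt Ω} (hσ : ∀ x ∈ Ω, σ.1 x = -divergenceWithin (fun y => q y • V y) Ω x) :
    B₁ σ σ = B₂ σ σ := by
  have hu := uniqueDiffOn_convex hconvex hint
  have hCs := h.isSmoothCurve hcompact hu q
  have hC0 := h.curve_zero hcompact hconvex hint q
  have hσ' := h.hasDerivWithinAt_curve_tangent hcompact hu q hσ
  obtain ⟨δ₁, φ₁, hδ₁, -, hs₁, hφ₁, hB₁⟩ := h₁ _ τ hCs hC0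
  obtain ⟨δ₂, φ₂, hδ₂, -, hs₂, hφ₂, hB₂⟩ := h₂ _ τ hCs hC0
  have hδ : 0 < min δ₁ δ₂ := lt_min hδ₁ hδ₂
  have hI₁ : Icc 0 (min δ₁ δ₂) ⊆ Icc 0 δ₁ := Icc_subset_Icc_right (min_le_left _ _)
  have hI₂ : Icc 0 (min δ₁ δ₂) ⊆ Icc 0 δ₂ := Icc_subset_Icc_right (min_le_right _ _)
  -- At each time the two first variations differ by a constant, which `∫ σ = 0` annihilates.
  have key : ∀ t ∈ Icc 0 (min δ₁ δ₂), ∫ x in Ω, φ₁ t x * σ.1 x = ∫ x in Ω, φ₂ t x * σ.1 x := by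
    intro t ht
    obtain ⟨m, hm⟩ := (hφ₁ t (hI₁ ht)).unique hcompact hconvex hint (hφ₂ t (hI₂ ht))
    have h1 : IntegrableOn (fun x => φ₂ t x * σ.1 x) Ω :=
      ((hφ₂ t (hI₂ ht)).1.continuousOn.mul σ.2.1.continuousOn).integrableOn_compact hcompact
    rw [setIntegral_congr_fun (g := fun x => φ₂ t x * σ.1 x + m * σ.1 x) hcompact.measurableSet
      fun x hx => by simp only [hm x hx, add_mul], integral_add h1 (σ.2.2.2.1.const_mul m),
      integral_const_mul, σ.2.2.2.2, mul_zero, add_zero]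
  have hI0 : (0 : ℝ) ∈ Icc 0 (min δ₁ δ₂) := ⟨le_rfl, hδ.le⟩
  exact (uniqueDiffOn_Icc hδ 0 hI0).eq_deriv _ ((hB₁ σ σ hσ').mono hI₁)
    (((hB₂ σ σ hσ').mono hI₂).congr key (key 0 hI0))

theorem setIntegral_setIntegral_swap (hcompact : IsCompact Ω)
    {f : EuclideanSpace ℝ (Fin d) → EuclideanSpace ℝ (Fin d) → ℝ}
    (hf : ContinuousOn (fun z : EuclideanSpace ℝ (Fin d) × EuclideanSpace ℝ (Fin d) => f z.1 z.2)
      (Ω ×ˢ Ω)) :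
    ∫ x in Ω, ∫ y in Ω, f x y = ∫ y in Ω, ∫ x in Ω, f x y := by
  refine integral_integral_swap ?_
  rw [Measure.prod_restrict]
  exact hf.integrableOn_compact (hcompact.prod hcompact)

/-- For a smooth kernel, the second variation on `σ ⊗ σ` is the mixed derivative of the kernel
tested with `q V ⊗ q V`. -/
theorem IsStraightFlow.setIntegral_kernel_eq
    {V : EuclideanSpace ℝ (Fin d) → EuclideanSpace ℝ (Fin d)} {τ : ℝ} (h : IsStraightFlow Ω V τ)
    (hcompact : IsCompact Ω) (hconvex : Convex ℝ Ω) (hint : (interior Ω).Nonempty)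
    {q : SmoothDensity Ω} {σ : tangentSpaceAt Ω}
    (hσ : ∀ x ∈ Ω, σ.1 x = -divergenceWithin (fun y => q y • V y) Ω x)
    {K : EuclideanSpace ℝ (Fin d) → EuclideanSpace ℝ (Fin d) → ℝ}
    (hK : ContDiffOn ℝ ∞ (fun z : EuclideanSpace ℝ (Fin d) × EuclideanSpace ℝ (Fin d) => K z.1 z.2)
      (Ω ×ˢ Ω)) :
    ∫ x in Ω, ∫ y in Ω, K x y * σ.1 x * σ.1 y = ∫ x in Ω, ∫ y in Ω,
      fderivWithin ℝ (fun x' => fderivWithin ℝ (fun y' => K x' y') Ω y (V y)) Ω x (V x) *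
        q x * q y := by
  have hu := uniqueDiffOn_convex hconvex hint
  have hmeas := hcompact.measurableSet
  have hV : ContDiffOn ℝ ∞ (fun z : EuclideanSpace ℝ (Fin d) × EuclideanSpace ℝ (Fin d) => V z.2)
      (Ω ×ˢ Ω) := h.smooth.comp contDiffOn_snd fun z hz => hz.2
  have hV1 : ContinuousOn (fun z : EuclideanSpace ℝ (Fin d) × EuclideanSpace ℝ (Fin d) => V z.1)
      (Ω ×ˢ Ω) := h.smooth.continuousOn.comp continuousOn_fst fun z hz => hz.1
  have hq1 : ContinuousOn (fun z : EuclideanSpace ℝ (Fin d) × EuclideanSpace ℝ (Fin d) => q z.1)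
      (Ω ×ˢ Ω) := q.continuousOn.comp continuousOn_fst fun z hz => hz.1
  have hq2 : ContinuousOn (fun z : EuclideanSpace ℝ (Fin d) × EuclideanSpace ℝ (Fin d) => q z.2)
      (Ω ×ˢ Ω) := q.continuousOn.comp continuousOn_snd fun z hz => hz.2
  have hσ1 : ContinuousOn (fun z : EuclideanSpace ℝ (Fin d) × EuclideanSpace ℝ (Fin d) => σ.1 z.1)
      (Ω ×ˢ Ω) := σ.2.1.continuousOn.comp continuousOn_fst fun z hz => hz.1
  set A : EuclideanSpace ℝ (Fin d) → EuclideanSpace ℝ (Fin d) → ℝ :=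
    fun x y => fderivWithin ℝ (K x) Ω y (V y) with hA
  have hAs : ContDiffOn ℝ ∞
      (fun z : EuclideanSpace ℝ (Fin d) × EuclideanSpace ℝ (Fin d) => A z.1 z.2) (Ω ×ˢ Ω) :=
    (hK.fderivWithin_slice_right hu hu).clm_apply hV
  have hDA : ContinuousOn (fun z : EuclideanSpace ℝ (Fin d) × EuclideanSpace ℝ (Fin d) =>
      fderivWithin ℝ (fun x => A x z.2) Ω z.1 (V z.1)) (Ω ×ˢ Ω) :=
    (hAs.fderivWithin_slice_left hu hu).continuousOn.clm_apply hV1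
  have weak : ∀ {ψ : EuclideanSpace ℝ (Fin d) → ℝ}, ContDiffOn ℝ ∞ ψ Ω →
      ∫ x in Ω, ψ x * σ.1 x = ∫ x in Ω, fderivWithin ℝ ψ Ω x (V x) * q x := by
    intro ψ hψ
    rw [h.setIntegral_mul_tangent hcompact hconvex hu hσ hψ]
    refine setIntegral_congr_fun hmeas fun x hx => ?_
    simp only [inner_gradientWithin_left]
  have hslice : ∀ y ∈ Ω, ContDiffOn ℝ ∞ (fun x => A x y) Ω := fun y hy =>
    hAs.comp (f := fun x : EuclideanSpace ℝ (Fin d) => (x, y)) (by fun_prop) fun x hx => ⟨hx, hy⟩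
  have hKslice : ∀ x ∈ Ω, ContDiffOn ℝ ∞ (K x) Ω := fun x hx =>
    hK.comp (f := fun y : EuclideanSpace ℝ (Fin d) => (x, y)) (by fun_prop) fun y hy => ⟨hx, hy⟩
  -- Integration by parts is done first in `y`, then in `x`, with Fubini's theorem putting the
  -- relevant variable innermost.
  calc ∫ x in Ω, ∫ y in Ω, K x y * σ.1 x * σ.1 y
      = ∫ x in Ω, ∫ y in Ω, A x y * σ.1 x * q y := by
        refine setIntegral_congr_fun hmeas fun x hx => ?_
        have h1 : ∀ y, K x y * σ.1 x * σ.1 y = σ.1 x * (K x y * σ.1 y) := fun y => by ring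
        have h2 : ∀ y, A x y * σ.1 x * q y = σ.1 x * (A x y * q y) := fun y => by ring
        simp only [h1, h2, integral_const_mul]
        rw [weak (hKslice x hx)]
    _ = ∫ y in Ω, ∫ x in Ω, A x y * σ.1 x * q y :=
        setIntegral_setIntegral_swap hcompact ((hAs.continuousOn.mul hσ1).mul hq2)
    _ = ∫ y in Ω, ∫ x in Ω, fderivWithin ℝ (fun x => A x y) Ω x (V x) * q x * q y := by
        refine setIntegral_congr_fun hmeas fun y hy => ?_
        simp only [integral_mul_const]
        rw [weak (hslice y hy)]
    _ = ∫ x in Ω, ∫ y in Ω, fderivWithin ℝ (fun x => A x y) Ω x (V x) * q x * q y :=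
        (setIntegral_setIntegral_swap hcompact ((hDA.mul hq1).mul hq2)).symm

/-- The Hessian uses a chosen second variation; on `(σ, σ)` it agrees with the one given by the
kernel, since `σ` comes from a flow. -/
theorem transportHessian_eq_hessianKernelTerm (hcompact : IsCompact Ω) (hconvex : Convex ℝ Ω)
    (hint : (interior Ω).Nonempty) {F : SmoothDensity Ω → ℝ} {q : SmoothDensity Ω}
    (hF : HasSecondVariation F q) {σ : tangentSpaceAt Ω} {Φ : EuclideanSpace ℝ (Fin d) → ℝ}
    (hΦ : IsTangentPotential q σ Φ)
    (hmaps : ∀ᶠ ε : ℝ in 𝓝 0, MapsTo (fun x => x + ε • gradientWithin Φ Ω x) Ω Ω)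
    {K : EuclideanSpace ℝ (Fin d) → EuclideanSpace ℝ (Fin d) → ℝ}
    (hK : IsSecondVariationKernel F q K) :
    transportHessian F q σ Φ = hessianKernelTerm q K Φ + hessianLocalTerm F q Φ := by
  obtain ⟨τ, h⟩ := exists_isStraightFlow_of_mapsTo hcompact hconvex hint
    (hΦ.1.gradientWithin (uniqueDiffOn_convex hconvex hint)) hmaps
  obtain ⟨hKs, B, hB, hBK⟩ := hK
  rw [transportHessian, hF.isSecondVariation.apply_self_eq hcompact hconvex hint hB h hΦ.2, hBK,
    h.setIntegral_kernel_eq hcompact hconvex hint hΦ.2 hKs, hessianKernelTerm]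

end TransportHessian

/-! ### First variation of the entropy at positive densities. -/

section EntropyFirstVariation

variable {d : ℕ} {Ω : Set (EuclideanSpace ℝ (Fin d))}

/-- The initial density has a positive minimum on Ω, and uniform continuity on `[0, τ] × Ω` limits
the change by less than that minimum. -/
theorem IsSmoothCurve.exists_pos (hcompact : IsCompact Ω) {c : ℝ → SmoothDensity Ω} {τ : ℝ}
    (hc : IsSmoothCurve c τ) (h0 : ∀ x ∈ Ω, 0 < c 0 x) :
    ∃ δ, 0 < δ ∧ δ ≤ τ ∧ ∀ t ∈ Icc 0 δ, ∀ x ∈ Ω, 0 < c t x := by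
  rcases Ω.eq_empty_or_nonempty with rfl | hne
  · exact ⟨τ, hc.1, le_rfl, by simp⟩
  obtain ⟨x₀, hx₀, hmin⟩ := hcompact.exists_isMinOn hne (c 0).continuousOn
  have huc := (isCompact_Icc.prod hcompact).uniformContinuousOn_of_continuous hc.2.continuousOn
  obtain ⟨η, hη, h⟩ := Metric.uniformContinuousOn_iff.1 huc _ (h0 x₀ hx₀)
  have hτ := hc.1
  refine ⟨min τ (η / 2), by positivity, min_le_left _ _, fun t ht x hx => ?_⟩
  have htη : t ≤ η / 2 := ht.2.trans (min_le_right _ _)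
  have h1 := h (t, x) ⟨⟨ht.1, ht.2.trans (min_le_left _ _)⟩, hx⟩ (0, x) ⟨⟨le_rfl, hτ.le⟩, hx⟩ (by
    rw [Prod.dist_eq, dist_self, max_lt_iff, Real.dist_eq, sub_zero, abs_of_nonneg ht.1]
    exact ⟨by linarith, hη⟩)
  have h2 : c 0 x₀ ≤ c 0 x := hmin hx
  rw [Real.dist_eq] at h1
  have := (abs_lt.1 h1).1
  simp only at this
  linarith

/-- The first variation of the negative entropy at a positive density is `log q + 1`. -/
theorem isFirstVariation_negEntropy (hcompact : IsCompact Ω) (hconvex : Convex ℝ Ω)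
    (hint : (interior Ω).Nonempty) {q : SmoothDensity Ω} (hq : ∀ x ∈ Ω, 0 < q x) :
    IsFirstVariation negEntropy q (fun x => Real.log (q x) + 1) := by
  have hu := uniqueDiffOn_convex hconvex hint
  refine ⟨(q.smooth.log fun x hx => (hq x hx).ne').add contDiffOn_const, fun c τ hc h0 => ?_⟩
  obtain ⟨δ, hδ, hδτ, hpos⟩ := hc.exists_pos hcompact (by rw [h0]; exact hq)
  have hsub : Icc 0 δ ⊆ Icc 0 τ := Icc_subset_Icc_right hδτ
  have hcs := hc.2.mono (prod_mono hsub (Subset.refl Ω))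
  have hI0 : (0 : ℝ) ∈ Icc 0 δ := ⟨le_rfl, hδ.le⟩
  have h1 := hasDerivWithinAt_setIntegral_of_contDiffOn (μ := volume) hcompact hconvex hu hδ hI0
    (g := fun t x => c t x * Real.log (c t x))
    (g' := fun x => (Real.log (q x) + 1) * derivWithin (fun t => c t x) (Icc 0 τ) 0)
    (hcs.mul (hcs.log fun z hz => (hpos z.1 hz.1 z.2 hz.2).ne')) fun x hx => by
      have h2 : HasDerivWithinAt (fun t => c t x) (derivWithin (fun t => c t x) (Icc 0 τ) 0)
          (Icc 0 δ) 0 := (((hc.2.slice_left (g := fun s x => c s x) hx).differentiableOn (by simp) 0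
        (hsub hI0)).hasDerivWithinAt).mono hsub
      have hne : c 0 x ≠ 0 := (hpos 0 hI0 x hx).ne'
      refine (h2.mul (h2.log hne)).congr_deriv ?_
      rw [h0] at hne ⊢
      field_simp
  -- A derivative at 0 within `[0, τ]` depends only on short times, for which the logarithm is
  -- smooth along the curve.
  refine h1.mono_of_mem_nhdsWithin ?_
  rw [nhdsWithin_Icc_eq_nhdsGE hc.1]
  exact Icc_mem_nhdsGE hδ

end EntropyFirstVariation

/-! ### Reduction to functions of one real variable on the unit segment. -/

section UnitSegment

theorem mem_unitSegment {x : EuclideanSpace ℝ (Fin 1)} :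
    x ∈ unitSegment ↔ x 0 ∈ Icc (0 : ℝ) 1 := Iff.rfl

theorem single_mem_unitSegment {t : ℝ} :
    (EuclideanSpace.single 0 t : EuclideanSpace ℝ (Fin 1)) ∈ unitSegment ↔ t ∈ Icc (0 : ℝ) 1 := by
  simp [mem_unitSegment]

theorem single_coord (x : EuclideanSpace ℝ (Fin 1)) : EuclideanSpace.single 0 (x 0) = x := by
  ext i
  rw [Subsingleton.elim i 0]
  simp

theorem unitSegment_eq_image :
    unitSegment = (fun t : ℝ => (EuclideanSpace.single 0 t : EuclideanSpace ℝ (Fin 1))) ''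
      Icc 0 1 := by
  ext x
  constructor
  · intro hx
    exact ⟨x 0, hx, single_coord x⟩
  · rintro ⟨t, ht, rfl⟩
    exact single_mem_unitSegment.2 ht

/-- The coordinate of a point of the line `EuclideanSpace ℝ (Fin 1)`. -/
noncomputable def lineCoord : EuclideanSpace ℝ (Fin 1) →L[ℝ] ℝ := EuclideanSpace.proj 0

/-- The point of the line `EuclideanSpace ℝ (Fin 1)` with a given coordinate. -/
noncomputable def linePoint : ℝ →L[ℝ] EuclideanSpace ℝ (Fin 1) :=
  (ContinuousLinearMap.id ℝ ℝ).smulRight (EuclideanSpace.single 0 1)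

theorem lineCoord_apply (x : EuclideanSpace ℝ (Fin 1)) : lineCoord x = x 0 := rfl

theorem linePoint_apply (t : ℝ) : linePoint t = EuclideanSpace.single 0 t := by
  ext i
  rw [Subsingleton.elim i 0]
  simp [linePoint]

theorem isCompact_unitSegment : IsCompact unitSegment := by
  rw [unitSegment_eq_image]
  simp only [← linePoint_apply]
  exact isCompact_Icc.image linePoint.continuous

theorem convex_unitSegment : Convex ℝ unitSegment :=
  (convex_Icc (0 : ℝ) 1).is_linear_preimage lineCoord.toLinearMap.isLinear

theorem interior_unitSegment_nonempty : (interior unitSegment).Nonempty := by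
  refine ⟨EuclideanSpace.single 0 (1 / 2), mem_interior.2
    ⟨lineCoord ⁻¹' Ioo 0 1, fun x hx => Ioo_subset_Icc_self hx,
      isOpen_Ioo.preimage lineCoord.continuous, ?_⟩⟩
  rw [mem_preimage, lineCoord_apply]
  norm_num

theorem uniqueDiffOn_unitSegment : UniqueDiffOn ℝ unitSegment :=
  uniqueDiffOn_convex convex_unitSegment interior_unitSegment_nonempty

theorem setIntegral_unitSegment (g : ℝ → ℝ) :
    ∫ x in unitSegment, g (x 0) = ∫ t in (0 : ℝ)..1, g t := by
  have h := (volume_preserving_funUnique (Fin 1) ℝ).comp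
    (EuclideanSpace.volume_preserving_symm_measurableEquiv_toLp (Fin 1))
  have he : MeasurableEmbedding ((MeasurableEquiv.funUnique (Fin 1) ℝ) ∘
      (MeasurableEquiv.toLp 2 (Fin 1 → ℝ)).symm) :=
    (MeasurableEquiv.measurableEmbedding _).comp (MeasurableEquiv.measurableEmbedding _)
  rw [intervalIntegral.integral_of_le zero_le_one, ← integral_Icc_eq_integral_Ioc,
    ← h.setIntegral_preimage_emb he]
  rfl

theorem contDiffOn_comp_coord {g : ℝ → ℝ} (hg : ContDiffOn ℝ ∞ g (Icc 0 1)) :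
    ContDiffOn ℝ ∞ (fun x : EuclideanSpace ℝ (Fin 1) => g (x 0)) unitSegment :=
  hg.comp (f := lineCoord) lineCoord.contDiff.contDiffOn fun _ hx => hx

theorem gradientWithin_comp_coord {g : ℝ → ℝ} {g' : ℝ} {x : EuclideanSpace ℝ (Fin 1)}
    (hx : x ∈ unitSegment) (hg : HasDerivWithinAt g g' (Icc 0 1) (x 0)) :
    gradientWithin (fun x : EuclideanSpace ℝ (Fin 1) => g (x 0)) unitSegment x =
      EuclideanSpace.single 0 g' := by
  refine HasGradientWithinAt.gradientWithin_eq ?_ uniqueDiffOn_unitSegment hx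
  rw [hasGradientWithinAt_iff_hasFDerivWithinAt]
  have h1 := HasDerivWithinAt.comp_hasFDerivWithinAt (h₂ := g) (f := lineCoord) x
    (s := unitSegment) (t := Icc 0 1) hg lineCoord.hasFDerivWithinAt fun _ hy => hy
  refine h1.congr_fderiv ?_
  ext v
  simp [lineCoord_apply, EuclideanSpace.inner_single_left]

open Classical in
/-- The density on the unit segment with a given profile. -/
noncomputable def segmentDensity (g : ℝ → ℝ) (hg : ContDiffOn ℝ ∞ g (Icc 0 1))
    (h0 : ∀ t ∈ Icc (0 : ℝ) 1, 0 < g t) (hI : ∫ t in (0 : ℝ)..1, g t = 1) :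
    SmoothDensity unitSegment where
  toFun x := if x ∈ unitSegment then g (x 0) else 0
  smooth := (contDiffOn_comp_coord hg).congr fun x hx => if_pos hx
  nonneg x := by
    split_ifs with hx
    · exact (h0 _ hx).le
    · exact le_rfl
  eq_zero x hx := if_neg hx
  integral_eq_one := by
    rw [← hI, ← setIntegral_unitSegment]
    exact setIntegral_congr_fun isCompact_unitSegment.measurableSet fun x hx => if_pos hx

/-- `p` has the profile `g` on the unit segment. -/
def HasProfile (p : SmoothDensity unitSegment) (g : ℝ → ℝ) : Prop :=
  ∀ x ∈ unitSegment, p x = g (x 0)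

theorem hasProfile_segmentDensity {g : ℝ → ℝ} (hg : ContDiffOn ℝ ∞ g (Icc 0 1))
    (h0 : ∀ t ∈ Icc (0 : ℝ) 1, 0 < g t) (hI : ∫ t in (0 : ℝ)..1, g t = 1) :
    HasProfile (segmentDensity g hg h0 hI) g := fun _ hx => if_pos hx

theorem HasProfile.apply_single {p : SmoothDensity unitSegment} {g : ℝ → ℝ} (h : HasProfile p g)
    {t : ℝ} (ht : t ∈ Icc (0 : ℝ) 1) : p (EuclideanSpace.single 0 t) = g t := by
  rw [h _ (single_mem_unitSegment.2 ht)]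
  simp

theorem HasProfile.negEntropy_eq {p : SmoothDensity unitSegment} {g : ℝ → ℝ}
    (h : HasProfile p g) : negEntropy p = ∫ t in (0 : ℝ)..1, g t * Real.log (g t) := by
  rw [← setIntegral_unitSegment (fun t => g t * Real.log (g t)), negEntropy]
  exact setIntegral_congr_fun isCompact_unitSegment.measurableSet fun x hx => by simp only [h x hx]

/-- Monotone transport on the unit segment. -/
theorem isTransportPotential_segment {q p : SmoothDensity unitSegment} {G T T' : ℝ → ℝ}
    (hG : ContDiffOn ℝ ∞ G (Icc 0 1))
    (hGT : ∀ t ∈ Icc (0 : ℝ) 1, HasDerivWithinAt G (T t) (Icc 0 1) t)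
    (hT : ∀ t ∈ Icc (0 : ℝ) 1, HasDerivWithinAt T (T' t) (Icc 0 1) t)
    (hT' : ∀ t ∈ Icc (0 : ℝ) 1, 0 < T' t) (hmono : StrictMonoOn T (Icc 0 1))
    (hbij : BijOn T (Icc 0 1) (Icc 0 1))
    (hp : ∀ t ∈ Icc (0 : ℝ) 1, T' t * p (EuclideanSpace.single 0 (T t)) =
      q (EuclideanSpace.single 0 t)) :
    IsTransportPotential q p (fun x => G (x 0)) where
  smooth := contDiffOn_comp_coord hG
  strictConvex := by
    have hGc : StrictConvexOn ℝ (Icc 0 1) G := by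
      refine StrictMonoOn.strictConvexOn_of_deriv (convex_Icc 0 1) hG.continuousOn ?_
      have hd : ∀ t ∈ Ioo (0 : ℝ) 1, deriv G t = T t := fun t ht =>
        ((hGT t (Ioo_subset_Icc_self ht)).hasDerivAt (Icc_mem_nhds ht.1 ht.2)).deriv
      rw [interior_Icc]
      intro s hs t ht hst
      rw [hd s hs, hd t ht]
      exact hmono (Ioo_subset_Icc_self hs) (Ioo_subset_Icc_self ht) hst
    refine ⟨convex_unitSegment, fun x hx y hy hxy a b ha hb hab => ?_⟩
    have hne : x 0 ≠ y 0 := fun h => hxy (by rw [← single_coord x, h, single_coord])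
    simpa using hGc.2 hx hy hne ha hb hab
  pushforward := by
    have hgrad : EqOn (fun x : EuclideanSpace ℝ (Fin 1) => linePoint (T (lineCoord x)))
        (gradientWithin (fun x : EuclideanSpace ℝ (Fin 1) => G (x 0)) unitSegment)
        unitSegment := fun x hx => by
      simp only [linePoint_apply]
      exact (gradientWithin_comp_coord hx (hGT _ hx)).symm
    have hpush : IsPushforward (fun x => linePoint (T (lineCoord x))) q p := by
      refine IsPushforward.of_det_eq isCompact_unitSegment.measurableSet
        (T' := fun x => T' (x 0) • ContinuousLinearMap.id ℝ _) (fun x hx => ?_) ?_ fun x hx => ?_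
      · have h1 := HasDerivWithinAt.comp_hasFDerivWithinAt (h₂ := T) (f := lineCoord) x
          (s := unitSegment) (t := Icc 0 1) (hT _ hx) lineCoord.hasFDerivWithinAt fun _ hy => hy
        have h2 := linePoint.hasFDerivAt.comp_hasFDerivWithinAt x h1
        refine h2.congr_fderiv ?_
        ext v i
        rw [Subsingleton.elim i 0]
        simp [linePoint_apply, lineCoord_apply]
      · refine ⟨fun x hx => ?_, fun x hx y hy hxy => ?_, fun y hy => ?_⟩
        · simp only [linePoint_apply]
          exact single_mem_unitSegment.2 (hbij.mapsTo hx)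
        · simp only [linePoint_apply] at hxy
          have h1 : T (x 0) = T (y 0) := by
            have := congrArg lineCoord hxy
            simpa [lineCoord_apply] using this
          rw [← single_coord x, hbij.injOn hx hy h1, single_coord]
        · obtain ⟨t, ht, hty⟩ := hbij.surjOn hy
          refine ⟨EuclideanSpace.single 0 t, single_mem_unitSegment.2 ht, ?_⟩
          simp only [linePoint_apply, lineCoord_apply]
          simp [hty, single_coord]
      · have hdet : (T' (x 0) • ContinuousLinearMap.id ℝ (EuclideanSpace ℝ (Fin 1))).det =
            T' (x 0) := by
          rw [euclidean_det_eq, Matrix.det_unique]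
          simp
        rw [hdet, abs_of_pos (hT' _ hx), linePoint_apply, lineCoord_apply, hp _ hx, single_coord]
    exact hpush.congr isCompact_unitSegment.measurableSet hgrad

/-- The gradient of `log q + 1` is `g'/g`, and the weight `q` cancels the denominator. -/
theorem transportBregman_negEntropy_segment {q p : SmoothDensity unitSegment} {g g' T G : ℝ → ℝ}
    (hq : HasProfile q g) (hpos : ∀ t ∈ Icc (0 : ℝ) 1, 0 < g t)
    (hg : ∀ t ∈ Icc (0 : ℝ) 1, HasDerivWithinAt g (g' t) (Icc 0 1) t)
    (hGT : ∀ t ∈ Icc (0 : ℝ) 1, HasDerivWithinAt G (T t) (Icc 0 1) t)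
    (hG : IsTransportPotential q p (fun x => G (x 0))) :
    transportBregman negEntropy p q =
      negEntropy p - negEntropy q - ∫ t in (0 : ℝ)..1, g' t * (T t - t) := by
  have hfv := isFirstVariation_negEntropy isCompact_unitSegment convex_unitSegment
    interior_unitSegment_nonempty (q := q) fun x hx => by rw [hq x hx]; exact hpos _ hx
  rw [transportBregman_eq isCompact_unitSegment convex_unitSegment interior_unitSegment_nonempty
    hfv hG, ← setIntegral_unitSegment (fun t => g' t * (T t - t))]
  congr 1
  refine setIntegral_congr_fun isCompact_unitSegment.measurableSet fun x hx => ?_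
  have h1 : gradientWithin (fun x => Real.log (q x) + 1) unitSegment x =
      EuclideanSpace.single 0 (g' (x 0) / g (x 0)) := by
    rw [← gradientWithin_comp_coord (g := fun t => Real.log (g t) + 1) hx
      (((hg _ hx).log (hpos _ hx).ne').add_const 1)]
    refine gradientWithin_congr_add_const (m := 0) (fun y hy => ?_) hx
    simp only [hq y hy, add_zero]
  have hne := (hpos _ hx).ne'
  simp only [h1, gradientWithin_comp_coord hx (hGT _ hx), hq x hx]
  rw [EuclideanSpace.inner_single_left]
  simp
  field_simp

theorem quantile_eq {p : SmoothDensity unitSegment} {S : ℝ → ℝ}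
    (hS : ∀ x ∈ Icc (0 : ℝ) 1, ∫ s in (0 : ℝ)..x, p (EuclideanSpace.single 0 s) = S x)
    (hmono : StrictMonoOn S (Icc 0 1)) {x : ℝ} (hx : x ∈ Icc (0 : ℝ) 1) :
    quantile p (S x) = x := by
  refine IsLeast.csInf_eq ⟨⟨hx.1, (hS x hx).ge⟩, fun z hz => ?_⟩
  by_contra! hlt
  have hzI : z ∈ Icc (0 : ℝ) 1 := ⟨hz.1, hlt.le.trans hx.2⟩
  have h1 := hz.2
  rw [hS z hzI] at h1
  exact absurd (hmono hzI hx hlt) (not_lt.2 h1)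

/-- Near an interior `y` the quantile coincides with the inverse `T` of the distribution function
`S`. The endpoints are excluded because this identification is only available inside the unit
interval. -/
theorem deriv_quantile_eq {p : SmoothDensity unitSegment} {S T : ℝ → ℝ} {T' y : ℝ}
    (hS : ∀ x ∈ Icc (0 : ℝ) 1, ∫ s in (0 : ℝ)..x, p (EuclideanSpace.single 0 s) = S x)
    (hmono : StrictMonoOn S (Icc 0 1)) (hT : MapsTo T (Icc 0 1) (Icc 0 1))
    (hST : ∀ y ∈ Icc (0 : ℝ) 1, S (T y) = y) (hy : y ∈ Ioo (0 : ℝ) 1) (hd : HasDerivAt T T' y) :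
    deriv (quantile p) y = T' := by
  have : quantile p =ᶠ[𝓝 y] T := by
    filter_upwards [Icc_mem_nhds hy.1 hy.2] with z hz
    conv_lhs => rw [← hST z hz]
    exact quantile_eq hS hmono (hT hz)
  rw [this.deriv_eq, hd.deriv]

end UnitSegment

/-! ### The uniform density against a Möbius density. -/

section Asymmetry

theorem two_sub_pos_of_mem {t : ℝ} (ht : t ∈ Icc (0 : ℝ) 1) : 0 < 2 - t := by linarith [ht.2]

theorem one_add_pos_of_mem {t : ℝ} (ht : t ∈ Icc (0 : ℝ) 1) : 0 < 1 + t := by linarith [ht.1]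

theorem integral_eq_sub_of_hasDerivAt_unitInterval {f f' : ℝ → ℝ} {b : ℝ} (hb : b ∈ Icc (0 : ℝ) 1)
    (hderiv : ∀ t ∈ Icc (0 : ℝ) 1, HasDerivAt f (f' t) t) (hc : ContinuousOn f' (Icc 0 1)) :
    ∫ t in (0 : ℝ)..b, f' t = f b - f 0 := by
  have hsub : uIcc 0 b ⊆ Icc 0 1 := by
    rw [uIcc_of_le hb.1]
    exact Icc_subset_Icc_right hb.2
  exact intervalIntegral.integral_eq_sub_of_hasDerivAt (fun t ht => hderiv t (hsub ht))
    (hc.mono hsub).intervalIntegrable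

theorem hasDerivAt_two_sub (t : ℝ) : HasDerivAt (fun t : ℝ => 2 - t) (-1) t :=
  (hasDerivAt_id t).const_sub 2

theorem hasDerivAt_one_add (t : ℝ) : HasDerivAt (fun t : ℝ => 1 + t) 1 t :=
  (hasDerivAt_id t).const_add 1

theorem continuousOn_two_div_sq : ContinuousOn (fun t : ℝ => 2 / (2 - t) ^ 2) (Icc 0 1) :=
  ContinuousOn.div (by fun_prop) (by fun_prop) fun t ht =>
    (pow_pos (two_sub_pos_of_mem ht) 2).ne'

theorem integral_two_div_sq {b : ℝ} (hb : b ∈ Icc (0 : ℝ) 1) :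
    ∫ t in (0 : ℝ)..b, 2 / (2 - t) ^ 2 = b / (2 - b) := by
  rw [integral_eq_sub_of_hasDerivAt_unitInterval (f := fun t => t / (2 - t)) hb (fun t ht => ?_)
    continuousOn_two_div_sq]
  · simp
  · have h := two_sub_pos_of_mem ht
    refine ((hasDerivAt_id t).div (hasDerivAt_two_sub t) h.ne').congr_deriv ?_
    simp

theorem hasDerivAt_forward {t : ℝ} (ht : t ∈ Icc (0 : ℝ) 1) :
    HasDerivAt (fun t : ℝ => 2 * t / (1 + t)) (2 / (1 + t) ^ 2) t := by
  have h := one_add_pos_of_mem ht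
  refine (((hasDerivAt_id t).const_mul 2).div (hasDerivAt_one_add t) h.ne').congr_deriv ?_
  simp
  ring

theorem hasDerivAt_backward {t : ℝ} (ht : t ∈ Icc (0 : ℝ) 1) :
    HasDerivAt (fun t : ℝ => t / (2 - t)) (2 / (2 - t) ^ 2) t := by
  have h := two_sub_pos_of_mem ht
  refine ((hasDerivAt_id t).div (hasDerivAt_two_sub t) h.ne').congr_deriv ?_
  simp

theorem mapsTo_forward : MapsTo (fun t : ℝ => 2 * t / (1 + t)) (Icc 0 1) (Icc 0 1) := fun t ht => by
  have h := one_add_pos_of_mem ht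
  exact ⟨div_nonneg (by linarith [ht.1]) h.le, (div_le_one h).2 (by linarith [ht.2])⟩

theorem mapsTo_backward : MapsTo (fun t : ℝ => t / (2 - t)) (Icc 0 1) (Icc 0 1) := fun t ht => by
  have h := two_sub_pos_of_mem ht
  exact ⟨div_nonneg ht.1 h.le, (div_le_one h).2 (by linarith [ht.2])⟩

theorem two_sub_forward {t : ℝ} (ht : t ∈ Icc (0 : ℝ) 1) : 2 - 2 * t / (1 + t) = 2 / (1 + t) := by
  have h := one_add_pos_of_mem ht
  field_simp
  ring

theorem one_add_backward {t : ℝ} (ht : t ∈ Icc (0 : ℝ) 1) : 1 + t / (2 - t) = 2 / (2 - t) := by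
  have h := two_sub_pos_of_mem ht
  field_simp
  ring

theorem backward_forward {t : ℝ} (ht : t ∈ Icc (0 : ℝ) 1) :
    (2 * t / (1 + t)) / (2 - 2 * t / (1 + t)) = t := by
  have h := one_add_pos_of_mem ht
  rw [two_sub_forward ht]
  field_simp

theorem forward_backward {t : ℝ} (ht : t ∈ Icc (0 : ℝ) 1) :
    2 * (t / (2 - t)) / (1 + t / (2 - t)) = t := by
  have h := two_sub_pos_of_mem ht
  rw [one_add_backward ht]
  field_simp

theorem strictMonoOn_forward : StrictMonoOn (fun t : ℝ => 2 * t / (1 + t)) (Icc 0 1) := by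
  intro s hs t ht hst
  have h1 := one_add_pos_of_mem hs
  have h2 := one_add_pos_of_mem ht
  simp only
  rw [div_lt_div_iff₀ h1 h2]
  nlinarith

theorem strictMonoOn_backward : StrictMonoOn (fun t : ℝ => t / (2 - t)) (Icc 0 1) := by
  intro s hs t ht hst
  have h1 := two_sub_pos_of_mem hs
  have h2 := two_sub_pos_of_mem ht
  simp only
  rw [div_lt_div_iff₀ h1 h2]
  nlinarith

theorem bijOn_forward : BijOn (fun t : ℝ => 2 * t / (1 + t)) (Icc 0 1) (Icc 0 1) :=
  ⟨mapsTo_forward, strictMonoOn_forward.injOn, fun t ht =>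
    ⟨t / (2 - t), mapsTo_backward ht, forward_backward ht⟩⟩

theorem bijOn_backward : BijOn (fun t : ℝ => t / (2 - t)) (Icc 0 1) (Icc 0 1) :=
  ⟨mapsTo_backward, strictMonoOn_backward.injOn, fun t ht =>
    ⟨2 * t / (1 + t), mapsTo_forward ht, backward_forward ht⟩⟩

theorem contDiffOn_log_one_add : ContDiffOn ℝ ∞ (fun t : ℝ => Real.log (1 + t)) (Icc 0 1) :=
  ContDiffOn.log (by fun_prop) fun _ ht => (one_add_pos_of_mem ht).ne'

theorem contDiffOn_log_two_sub : ContDiffOn ℝ ∞ (fun t : ℝ => Real.log (2 - t)) (Icc 0 1) :=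
  ContDiffOn.log (by fun_prop) fun _ ht => (two_sub_pos_of_mem ht).ne'

/-- The uniform density on the unit segment. -/
noncomputable def uniformSegment : SmoothDensity unitSegment :=
  segmentDensity (fun _ => 1) contDiffOn_const (fun _ _ => one_pos) (by simp)

/-- The density `2 / (2 - t)²` on the unit segment. -/
noncomputable def moebiusSegment : SmoothDensity unitSegment :=
  segmentDensity (fun t => 2 / (2 - t) ^ 2)
    (ContDiffOn.div contDiffOn_const (by fun_prop) fun _ ht =>
      (pow_pos (two_sub_pos_of_mem ht) 2).ne')
    (fun _ ht => div_pos two_pos (pow_pos (two_sub_pos_of_mem ht) 2))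
    (by rw [integral_two_div_sq ⟨zero_le_one, le_rfl⟩]; norm_num)

theorem hasProfile_uniformSegment : HasProfile uniformSegment fun _ => 1 :=
  hasProfile_segmentDensity _ _ _

theorem hasProfile_moebiusSegment : HasProfile moebiusSegment fun t => 2 / (2 - t) ^ 2 :=
  hasProfile_segmentDensity _ _ _

theorem isTransportPotential_forward : IsTransportPotential uniformSegment moebiusSegment
    (fun x => (fun t => 2 * t - 2 * Real.log (1 + t)) (x 0)) := by
  refine isTransportPotential_segment (T := fun t => 2 * t / (1 + t))
    (T' := fun t => 2 / (1 + t) ^ 2)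
    (ContDiffOn.sub (by fun_prop) (contDiffOn_const.mul contDiffOn_log_one_add)) (fun t ht => ?_)
    (fun t ht => (hasDerivAt_forward ht).hasDerivWithinAt)
    (fun t ht => div_pos two_pos (pow_pos (one_add_pos_of_mem ht) 2)) strictMonoOn_forward
    bijOn_forward fun t ht => ?_
  · have h := one_add_pos_of_mem ht
    refine ((((hasDerivAt_id t).const_mul 2).sub
      (((hasDerivAt_one_add t).log h.ne').const_mul 2)).congr_deriv ?_).hasDerivWithinAt
    field_simp
    ring
  · have h := one_add_pos_of_mem ht
    rw [hasProfile_moebiusSegment.apply_single (mapsTo_forward ht),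
      hasProfile_uniformSegment.apply_single ht]
    simp only [two_sub_forward ht]
    field_simp

theorem isTransportPotential_backward : IsTransportPotential moebiusSegment uniformSegment
    (fun x => (fun t => -t - 2 * Real.log (2 - t)) (x 0)) := by
  refine isTransportPotential_segment (T := fun t => t / (2 - t)) (T' := fun t => 2 / (2 - t) ^ 2)
    (ContDiffOn.sub (by fun_prop) (contDiffOn_const.mul contDiffOn_log_two_sub)) (fun t ht => ?_)
    (fun t ht => (hasDerivAt_backward ht).hasDerivWithinAt)
    (fun t ht => div_pos two_pos (pow_pos (two_sub_pos_of_mem ht) 2)) strictMonoOn_backward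
    bijOn_backward fun t ht => ?_
  · have h := two_sub_pos_of_mem ht
    refine (((hasDerivAt_id t).neg.sub
      (((hasDerivAt_two_sub t).log h.ne').const_mul 2)).congr_deriv ?_).hasDerivWithinAt
    field_simp
    ring
  · rw [hasProfile_uniformSegment.apply_single (mapsTo_backward ht),
      hasProfile_moebiusSegment.apply_single ht, mul_one]

theorem negEntropy_uniformSegment : negEntropy uniformSegment = 0 := by
  rw [hasProfile_uniformSegment.negEntropy_eq]
  simp

theorem negEntropy_moebiusSegment : negEntropy moebiusSegment = 3 * Real.log 2 - 2 := by
  rw [hasProfile_moebiusSegment.negEntropy_eq]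
  rw [integral_eq_sub_of_hasDerivAt_unitInterval
    -- Integration by parts, with `2/(2 - t)` as antiderivative of the density and the logarithm of
    -- the density as the other factor.
    (f := fun t => 2 / (2 - t) * (Real.log 2 - 2 * Real.log (2 - t)) - 4 / (2 - t))
    (right_mem_Icc.2 zero_le_one) (fun t ht => ?_) ?_]
  · norm_num
    ring
  · exact continuousOn_two_div_sq.mul (continuousOn_two_div_sq.log fun t ht =>
      (div_pos two_pos (pow_pos (two_sub_pos_of_mem ht) 2)).ne')
  · have h := two_sub_pos_of_mem ht
    have h1 := hasDerivAt_two_sub t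
    refine ((((hasDerivAt_const t 2).div h1 h.ne').mul
      (((h1.log h.ne').const_mul 2).const_sub (Real.log 2))).sub
      ((hasDerivAt_const t 4).div h1 h.ne')).congr_deriv ?_
    rw [Real.log_div two_ne_zero (pow_pos h 2).ne', Real.log_pow]
    simp only [Pi.div_apply]
    field_simp
    push_cast
    ring

theorem transportBregman_moebius_uniform :
    transportBregman negEntropy moebiusSegment uniformSegment = 3 * Real.log 2 - 2 := by
  rw [transportBregman_negEntropy_segment (g' := fun _ => 0) (T := fun t => 2 * t / (1 + t))
    (G := fun t => 2 * t - 2 * Real.log (1 + t))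
    hasProfile_uniformSegment (fun _ _ => one_pos) (fun _ _ => hasDerivWithinAt_const _ _ _)
    (fun t ht => ?_) isTransportPotential_forward, negEntropy_moebiusSegment,
    negEntropy_uniformSegment]
  · simp
  · have h := one_add_pos_of_mem ht
    refine ((((hasDerivAt_id t).const_mul 2).sub
      (((hasDerivAt_one_add t).log h.ne').const_mul 2)).congr_deriv ?_).hasDerivWithinAt
    field_simp
    ring

theorem transportBregman_uniform_moebius :
    transportBregman negEntropy uniformSegment moebiusSegment = 13 / 6 - 3 * Real.log 2 := by
  rw [transportBregman_negEntropy_segment (g' := fun t => 4 / (2 - t) ^ 3)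
    (T := fun t => t / (2 - t)) (G := fun t => -t - 2 * Real.log (2 - t)) hasProfile_moebiusSegment
    (fun _ ht => div_pos two_pos (pow_pos (two_sub_pos_of_mem ht) 2)) (fun t ht => ?_)
    (fun t ht => ?_) isTransportPotential_backward, negEntropy_moebiusSegment,
    negEntropy_uniformSegment]
  · rw [integral_eq_sub_of_hasDerivAt_unitInterval
      -- With `u = 2 - t` the integrand is `8/u⁴ - 12/u³ + 4/u²`.
      (f := fun t => 8 / (3 * (2 - t) ^ 3) - 6 / (2 - t) ^ 2 + 4 / (2 - t))
      (right_mem_Icc.2 zero_le_one) (fun t ht => ?_) ?_]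
    · norm_num
      ring
    · refine ContinuousOn.mul ?_ (ContinuousOn.sub ?_ continuousOn_id)
      · exact ContinuousOn.div (by fun_prop) (by fun_prop) fun t ht =>
          (pow_pos (two_sub_pos_of_mem ht) 3).ne'
      · exact ContinuousOn.div (by fun_prop) (by fun_prop) fun t ht =>
          (two_sub_pos_of_mem ht).ne'
    · have h := two_sub_pos_of_mem ht
      have h1 := hasDerivAt_two_sub t
      refine ((((hasDerivAt_const t 8).div ((h1.pow 3).const_mul 3)
        (mul_pos three_pos (pow_pos h 3)).ne').sub
        ((hasDerivAt_const t 6).div (h1.pow 2) (pow_pos h 2).ne')).add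
        ((hasDerivAt_const t 4).div h1 h.ne')).congr_deriv ?_
      simp
      field_simp
      ring
  · have h := two_sub_pos_of_mem ht
    refine (((hasDerivAt_const t 2).div ((hasDerivAt_two_sub t).pow 2)
      (pow_pos h 2).ne').congr_deriv ?_).hasDerivWithinAt
    simp
    field_simp
    ring
  · have h := two_sub_pos_of_mem ht
    refine (((hasDerivAt_id t).neg.sub
      (((hasDerivAt_two_sub t).log h.ne').const_mul 2)).congr_deriv ?_).hasDerivWithinAt
    field_simp
    ring

theorem integral_uniformSegment {b : ℝ} (hb : b ∈ Icc (0 : ℝ) 1) :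
    ∫ s in (0 : ℝ)..b, uniformSegment (EuclideanSpace.single 0 s) = b := by
  rw [intervalIntegral.integral_congr (g := fun _ => 1)]
  · simp
  · intro s hs
    rw [uIcc_of_le hb.1] at hs
    exact hasProfile_uniformSegment.apply_single ⟨hs.1, hs.2.trans hb.2⟩

theorem integral_moebiusSegment {b : ℝ} (hb : b ∈ Icc (0 : ℝ) 1) :
    ∫ s in (0 : ℝ)..b, moebiusSegment (EuclideanSpace.single 0 s) = b / (2 - b) := by
  rw [← integral_two_div_sq hb]
  refine intervalIntegral.integral_congr fun s hs => ?_
  rw [uIcc_of_le hb.1] at hs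
  exact hasProfile_moebiusSegment.apply_single ⟨hs.1, hs.2.trans hb.2⟩

theorem deriv_quantile_uniformSegment {y : ℝ} (hy : y ∈ Ioo (0 : ℝ) 1) :
    deriv (quantile uniformSegment) y = 1 :=
  deriv_quantile_eq (S := id) (T := id) (fun _ hx => integral_uniformSegment hx)
    (strictMono_id.strictMonoOn _) (mapsTo_id _) (fun _ _ => rfl) hy (hasDerivAt_id y)

theorem deriv_quantile_moebiusSegment {y : ℝ} (hy : y ∈ Ioo (0 : ℝ) 1) :
    deriv (quantile moebiusSegment) y = 2 / (1 + y) ^ 2 :=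
  deriv_quantile_eq (fun _ hx => integral_moebiusSegment hx) strictMonoOn_backward mapsTo_forward
    (fun _ hy => backward_forward hy) hy (hasDerivAt_forward (Ioo_subset_Icc_self hy))

theorem integral_unitInterval_congr {f g : ℝ → ℝ} (h : ∀ t ∈ Ioo (0 : ℝ) 1, f t = g t) :
    ∫ t in (0 : ℝ)..1, f t = ∫ t in (0 : ℝ)..1, g t := by
  rw [intervalIntegral.integral_of_le zero_le_one, intervalIntegral.integral_of_le zero_le_one,
    integral_Ioc_eq_integral_Ioo, integral_Ioc_eq_integral_Ioo]
  exact setIntegral_congr_fun measurableSet_Ioo h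

theorem hasDerivAt_one_add_mul_log {t : ℝ} (ht : t ∈ Icc (0 : ℝ) 1) :
    HasDerivAt (fun t : ℝ => (1 + t) * Real.log (1 + t) - (1 + t)) (Real.log (1 + t)) t := by
  have h := one_add_pos_of_mem ht
  have h1 := hasDerivAt_one_add t
  refine ((h1.mul (h1.log h.ne')).sub h1).congr_deriv ?_
  field_simp
  ring

theorem itakuraSaito_moebius_uniform :
    itakuraSaito moebiusSegment uniformSegment = 3 * Real.log 2 - 2 := by
  rw [itakuraSaito, integral_unitInterval_congr
    (g := fun t => 2 / (1 + t) ^ 2 - (Real.log 2 - 2 * Real.log (1 + t)) - 1) fun t ht => ?_,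
    integral_eq_sub_of_hasDerivAt_unitInterval (f := fun t => -2 / (1 + t) - (Real.log 2 * t -
      2 * ((1 + t) * Real.log (1 + t) - (1 + t))) - t)
      (right_mem_Icc.2 zero_le_one) (fun t ht => ?_) ?_]
  · norm_num
    ring
  · have hlog : ContinuousOn (fun t : ℝ => Real.log (1 + t)) (Icc 0 1) :=
      contDiffOn_log_one_add.continuousOn
    have hdiv : ContinuousOn (fun t : ℝ => 2 / (1 + t) ^ 2) (Icc 0 1) :=
      ContinuousOn.div (by fun_prop) (by fun_prop) fun t ht =>
        (pow_pos (one_add_pos_of_mem ht) 2).ne'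
    fun_prop
  · have h := one_add_pos_of_mem ht
    refine ((((hasDerivAt_const t (-2)).div (hasDerivAt_one_add t) h.ne').sub
      (((hasDerivAt_id t).const_mul (Real.log 2)).sub
        ((hasDerivAt_one_add_mul_log ht).const_mul 2))).sub (hasDerivAt_id t)).congr_deriv ?_
    simp
  · have h := one_add_pos_of_mem (Ioo_subset_Icc_self ht)
    rw [deriv_quantile_moebiusSegment ht, deriv_quantile_uniformSegment ht, div_one,
      Real.log_div two_ne_zero (pow_pos h 2).ne', Real.log_pow]
    push_cast
    ring

theorem itakuraSaito_uniform_moebius :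
    itakuraSaito uniformSegment moebiusSegment = 13 / 6 - 3 * Real.log 2 := by
  rw [itakuraSaito, integral_unitInterval_congr
    (g := fun t => (1 + t) ^ 2 / 2 - (2 * Real.log (1 + t) - Real.log 2) - 1) fun t ht => ?_,
    integral_eq_sub_of_hasDerivAt_unitInterval (f := fun t => (1 + t) ^ 3 / 6 -
      (2 * ((1 + t) * Real.log (1 + t) - (1 + t)) - Real.log 2 * t) - t)
      (right_mem_Icc.2 zero_le_one) (fun t ht => ?_) ?_]
  · norm_num
    ring
  · have hlog : ContinuousOn (fun t : ℝ => Real.log (1 + t)) (Icc 0 1) :=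
      contDiffOn_log_one_add.continuousOn
    fun_prop
  · refine (((((hasDerivAt_one_add t).pow 3).div_const 6).sub
      (((hasDerivAt_one_add_mul_log ht).const_mul 2).sub
        ((hasDerivAt_id t).const_mul (Real.log 2)))).sub (hasDerivAt_id t)).congr_deriv ?_
    simp
    ring
  · have h := one_add_pos_of_mem (Ioo_subset_Icc_self ht)
    have h1 : (1 : ℝ) / (2 / (1 + t) ^ 2) = (1 + t) ^ 2 / 2 := by field_simp
    rw [deriv_quantile_moebiusSegment ht, deriv_quantile_uniformSegment ht, h1,
      Real.log_div (pow_pos h 2).ne' two_ne_zero, Real.log_pow]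
    push_cast
    ring

/-- The transport Bregman divergence of the negative entropy is not symmetric. -/
theorem exists_transportBregman_negEntropy_ne : ∃ p q : SmoothDensity unitSegment,
    (∀ x ∈ unitSegment, 0 < p x) ∧ (∀ x ∈ unitSegment, 0 < q x) ∧
    HasTransportPotential q p ∧ HasTransportPotential p q ∧
    HasFirstVariation negEntropy p ∧ HasFirstVariation negEntropy q ∧
    transportBregman negEntropy p q = itakuraSaito p q ∧
    transportBregman negEntropy q p = itakuraSaito q p ∧
    transportBregman negEntropy p q ≠ transportBregman negEntropy q p := by
  have hp : ∀ x ∈ unitSegment, 0 < moebiusSegment x := fun x hx => by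
    rw [hasProfile_moebiusSegment x hx]
    exact div_pos two_pos (pow_pos (two_sub_pos_of_mem hx) 2)
  have hq : ∀ x ∈ unitSegment, 0 < uniformSegment x := fun x hx => by
    rw [hasProfile_uniformSegment x hx]
    exact one_pos
  refine ⟨moebiusSegment, uniformSegment, hp, hq, ⟨_, isTransportPotential_forward⟩,
    ⟨_, isTransportPotential_backward⟩,
    ⟨_, isFirstVariation_negEntropy isCompact_unitSegment convex_unitSegment
      interior_unitSegment_nonempty hp⟩,
    ⟨_, isFirstVariation_negEntropy isCompact_unitSegment convex_unitSegment
      interior_unitSegment_nonempty hq⟩, ?_, ?_, ?_⟩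
  · rw [transportBregman_moebius_uniform, itakuraSaito_moebius_uniform]
  · rw [transportBregman_uniform_moebius, itakuraSaito_uniform_moebius]
  · rw [transportBregman_moebius_uniform, transportBregman_uniform_moebius]
    intro h
    -- Equality would force `log 2 = 25/36 ≈ 0.6944`, above the true value `0.6931…`.
    linarith [Real.log_two_lt_d9]

end Asymmetry

theorem mainTheorem3 {d : ℕ} (Ω : Set (EuclideanSpace ℝ (Fin d))) (hcompact : IsCompact Ω)
    (hconvex : Convex ℝ Ω) (hint : (interior Ω).Nonempty) :
    -- non-negativity
    (∀ F : SmoothDensity Ω → ℝ, IsDisplacementConvex F →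
      ∀ p q : SmoothDensity Ω, HasGeodesic q p → HasFirstVariation F q →
        0 ≤ transportBregman F p q) ∧
    (∀ F : SmoothDensity Ω → ℝ, IsStrictlyDisplacementConvex F →
      ∀ p q : SmoothDensity Ω, HasGeodesic q p → HasFirstVariation F q →
        (transportBregman F p q = 0 ↔ transportDist p q = 0)) ∧
    -- transport Hessian metric
    (∀ (F : SmoothDensity Ω → ℝ) (q : SmoothDensity Ω), HasSecondVariation F q →
      ∀ (σ : tangentSpaceAt Ω) (Φ : EuclideanSpace ℝ (Fin d) → ℝ), IsTangentPotential q σ Φ →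
        (∀ᶠ ε : ℝ in 𝓝 0, MapsTo (fun x => x + ε • gradientWithin Φ Ω x) Ω Ω) →
        (∀ᶠ ε : ℝ in 𝓝 0, ∃ r : SmoothDensity Ω,
          IsPushforward (fun x => x + ε • gradientWithin Φ Ω x) q r ∧
          HasTransportPotential q r) ∧
        (∀ c : ℝ → SmoothDensity Ω,
          (∀ᶠ ε : ℝ in 𝓝 0, IsPushforward (fun x => x + ε • gradientWithin Φ Ω x) q (c ε)) →
          (fun ε : ℝ => transportBregman F (c ε) q - ε ^ 2 / 2 * transportHessian F q σ Φ)
            =o[𝓝 0] (fun ε : ℝ => ε ^ 2)) ∧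
        (∀ K : EuclideanSpace ℝ (Fin d) → EuclideanSpace ℝ (Fin d) → ℝ,
          IsSecondVariationKernel F q K →
          transportHessian F q σ Φ = hessianKernelTerm q K Φ + hessianLocalTerm F q Φ)) ∧
    -- linearity
    (∀ (F G : SmoothDensity Ω → ℝ) (a : ℝ), 0 < a →
      ∀ p q : SmoothDensity Ω, HasTransportPotential q p →
        HasFirstVariation F q → HasFirstVariation G q →
        HasFirstVariation (fun r => F r + a * G r) q ∧
        transportBregman (fun r => F r + a * G r) p q =
          transportBregman F p q + a * transportBregman G p q) ∧
    -- asymmetry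
    (∃ p q : SmoothDensity unitSegment,
      (∀ x ∈ unitSegment, 0 < p x) ∧ (∀ x ∈ unitSegment, 0 < q x) ∧
      HasTransportPotential q p ∧ HasTransportPotential p q ∧
      HasFirstVariation negEntropy p ∧ HasFirstVariation negEntropy q ∧
      transportBregman negEntropy p q = itakuraSaito p q ∧
      transportBregman negEntropy q p = itakuraSaito q p ∧
      transportBregman negEntropy p q ≠ transportBregman negEntropy q p) := by
  exact ⟨fun F hF p q hg hv => transportBregman_nonneg hcompact hconvex hint hF hg hv,
    fun F hF p q hg hv => transportBregman_eq_zero_iff hcompact hconvex hint hF hg hv,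
    fun F q hF σ Φ hΦ hmaps =>
      ⟨eventually_exists_isPushforward hcompact hconvex hint q hΦ.1 hmaps,
        fun c hc => isLittleO_transportBregman hcompact hconvex hint hF hΦ hmaps hc,
        fun K hK => transportHessian_eq_hessianKernelTerm hcompact hconvex hint hF hΦ hmaps hK⟩,
    fun F G a _ p q hqp hF hG =>
      transportBregman_add_const_mul hcompact hconvex hint a hqp hF hG,
    exists_transportBregman_negEntropy_ne⟩
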